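/- **Setting.** Let $\mathbb T$ be one of $\{0,\dots,N\}$ ($N\in\mathbb N_0$), $\mathbb N_0$, $\mathbb N_0\cup\{\infty\}$, and write $\mathbb T_t=\{s\in\mathbb T: s\ge t\}$. Let $(\Omega,\mathcal F,(\mathcal F_n)_{n\in\mathbb T\cap\mathbb N_0},P)$ be a filtered probability space, $\mathcal F_\infty=\sigma(\bigcup_n\mathcal F_n)$. Let $L^\infty_t=L^\infty(\Omega,\mathcal F_t,P)$, let $\mathcal R^\infty$ be the space of adapted processes $X=(X_s)_{s\in\mathbb T}$ with $\sup_s|X_s|$ $P$-essentially bounded, and let $\mathcal R^\infty_t=\pi_t(\mathcal R^\infty)$, where $\pi_t(X)_s=1_{\{s\ge t\}}X_s$. For a probability measure $R$ on $(\Omega,\mathcal F)$, an adapted process $\nu$ is called an optional probability measure on $\mathbb T$ under $R$ if $R$-a.s. $\nu_s\ge0$ for all $s$ and $\sum_{s\in\mathbb T}\nu_s=1$. Fix such a process $\mu$ under $P$ with $\mu_s>0$ for all $s\in\mathbb T$ $P$-a.s. For weights $\nu$ on $\mathbb T$, let $\nu^t$ be the normalized restriction to $\mathbb T_t$, $\nu^t_s=\nu_s/\sum_{j\in\mathbb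 T_t}\nu_j$ if $\sum_{j\in\mathbb T_t}\nu_j>0$ and $\nu^t_s=0$ otherwise, $s\in\mathbb T_t$. On $\bar\Omega=\Omega\times\mathbb T$ consider the optional $\sigma$-field $\bar{\mathcal F}=\sigma(A\times\{s\}: A\in\mathcal F_s,\,s\in\mathbb T)$, the optional filtration $\bar{\mathcal F}_t=\sigma(A_j\times\{j\},\,A_t\times\mathbb T_t: A_j\in\mathcal F_j,\,j<t,\,A_t\in\mathcal F_t)$, and the probability measure $\bar P=P\otimes\mu$ given by $E_{\bar P}[X]=E_P[\sum_{s\in\mathbb T}\mu_sX_s]$. Then $\mathcal R^\infty=L^\infty(\bar\Omega,\bar{\mathcal F},\bar P)$. Fix $t\in\mathbb T\cap\mathbb N_0$ and $R_t=(r_0,\dots,r_{t-1},r_t,r_t,\dots)$ with $r_s>0$ and $r_s,\,r_s^{-1}\in L^\infty_s$ for $s=0,\dots,t$. The conditional entropic risk measure on the optional product space is $$\bar\rho_t(X)=\frac1{R_t}\log E_{\bar P}\big[e^{-R_tX}\,\big|\,\bar{\mathcal F}_t\big],\qquad X\in\mathcal R^\infty .$$ A map $\rho_t:\mathcal R_t^\infty\to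 L^\infty_t$ is associated to $\bar\rho_t$ if, for all $X\in\mathcal R^\infty$, $\bar P$-a.s. $$\bar\rho_t(X)=-X_01_{\{0\}}-\dots-X_{t-1}1_{\{t-1\}}+\rho_t(\pi_t(X))\,1_{\mathbb T_t}.$$ A probability measure $Q$ on $(\Omega,\mathcal F)$ belongs to $\mathcal M_{\rm loc}(P)$ if $Q\ll P$ on $\mathcal F_n$ for all $n\in\mathbb T\cap\mathbb N_0$; put $M_n=\frac{dQ}{dP}\big|_{\mathcal F_n}$ and, if $\infty\in\mathbb T$, $M_\infty=\lim_nM_n\in[0,\infty]$ (the limit exists $P$- and $Q$-a.s.). Let $\Gamma(Q)$ be the set of optional probability measures $\gamma$ on $\mathbb T$ under $Q$ such that, if $\infty\in\mathbb T$, $\gamma_\infty=0$ $Q$-a.s. on $\{M_\infty=\infty\}$. The pairs $Q\in\mathcal M_{\rm loc}(P)$, $\gamma\in\Gamma(Q)$ define the measures $Q\otimes\gamma\ll\bar P$, $E_{Q\otimes\gamma}[X]=E_Q[\sum_{s\in\mathbb T}\gamma_sX_s]$. With $D_t=1-\sum_{s<t}\gamma_s$, the minimal penalty function of $\rho_t$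 is, $Q$-a.s. on $\{D_t>0\}$, $$\alpha_t(Q\otimes\gamma)=Q\text{-}\operatorname{ess\,sup}\Big\{E_Q\Big[-\sum_{s\in\mathbb T_t}\frac{\gamma_s}{D_t}X_s\,\Big|\,\mathcal F_t\Big]\ :\ X\in\mathcal R^\infty_t,\ \rho_t(X)\le0\ P\text{-a.s.}\Big\}.$$ **Proposition.** There is a map $\rho_t:\mathcal R^\infty_t\to L^\infty_t$ associated to $\bar\rho_t$, and every such map has the following properties. (1) For all $X\in\mathcal R^\infty_t$, $P$-a.s. $$\rho_t(X)=\rho_t^{P,r_t}\Big(-\rho_t^{\mu(\omega),r_t(\omega)}\big(X_\cdot(\omega)\big)\Big),$$ where $\rho^{P,r_t}_t(Y)=\frac1{r_t}\log E_P[e^{-r_tY}\,|\,\mathcal F_t]$ is the conditional entropic risk measure for random variables, and $\rho^{\nu,r}_t(x)=\frac1r\log\big(\sum_{s\in\mathbb T_t}e^{-rx_s}\nu^t_s\big)$, for a bounded sequence $x=(x_s)_{s\in\mathbb T}$, a probability measure $\nu$ on $\mathbb T$ and $r>0$, is the entropic risk measure with respect to time. (2) For all $Q\in\mathcal M_{\rm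 loc}(P)$ under which $\mu$ is also an optional probability measure on $\mathbb T$ (automatic if $\mu(\omega)$ is a probability measure on $\mathbb T$ for every $\omega$, if $Q\ll P$, or if $\mathbb T$ is finite), and all $\gamma\in\Gamma(Q)$, $Q$-a.s. on $\{D_t>0\}$ $$\alpha_t(Q\otimes\gamma)=\frac1{r_t}E_Q\Big[\sum_{s\in\mathbb T_t}\gamma^t_s\log\frac{M_s}{M_t}\,\Big|\,\mathcal F_t\Big]+\frac1{r_t}E_Q\big[H(\gamma^t(\cdot)\,|\,\mu^t(\cdot))\,\big|\,\mathcal F_t\big],$$ an identity in $(-\infty,\infty]$, with $0\cdot\infty=0$, where $H(\cdot|\cdot)\in[0,\infty]$ is the relative entropy of probability measures on $\mathbb T_t$. -/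

import Mathlib

open MeasureTheory Filter
open scoped ENNReal

noncomputable section

namespace ProcessRisk

/-! ### Time sets -/

/-- The three kinds of time horizon: `{0, …, N}`, `ℕ`, and `ℕ ∪ {∞}`. -/
inductive Horizon where
  | finite (N : ℕ)
  | nat
  | natInfty

/-- The set `𝕋` of time points, as a subset of `ℕ ∪ {∞}`. -/
def Horizon.times : Horizon → Set ℕ∞
  | .finite N => Set.Iic (N : ℕ∞)
  | .nat => {s | s ≠ ⊤}
  | .natInfty => Set.univ

/-- The set `𝕋` as a type. Below, `𝕋_t = {s ∈ 𝕋 | s ≥ t}` is `Set.Ici t`. -/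
def Horizon.Time (H : Horizon) : Type := {s : ℕ∞ // s ∈ H.times}

instance (H : Horizon) : LinearOrder H.Time :=
  inferInstanceAs (LinearOrder {s : ℕ∞ // s ∈ H.times})

instance (H : Horizon) : Countable H.Time :=
  inferInstanceAs (Countable {s : ℕ∞ // s ∈ H.times})

instance (H : Horizon) : MeasurableSpace H.Time := ⊤

variable {Ω : Type*} {mΩ : MeasurableSpace Ω} {H : Horizon}

/-- The σ-field `ℱ_s` for `s ∈ ℕ ∪ {∞}`, with `ℱ_∞ = σ(⋃ₙ ℱₙ)`. For the horizon `{0, …, N}` only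
the members `ℱ_0, …, ℱ_N` of the filtration are ever used. -/
@[reducible]
def sigmaAt (ℱ : Filtration ℕ mΩ) (s : ℕ∞) : MeasurableSpace Ω :=
  if s = ⊤ then ⨆ n, ℱ n else ℱ s.toNat

/-! ### Spaces of random variables and processes -/

/-- `Y ∈ L^∞(Ω, m, P)`. -/
def MemLInf (P : Measure Ω) (m : MeasurableSpace Ω) (Y : Ω → ℝ) : Prop :=
  Measurable[m] Y ∧ ∃ C : ℝ, ∀ᵐ ω ∂P, |Y ω| ≤ C

def IsAdapted (ℱ : Filtration ℕ mΩ) (X : H.Time → Ω → ℝ) : Prop :=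
  ∀ s, Measurable[sigmaAt ℱ s.1] (X s)

/-- The space `ℛ^∞` of adapted processes with `sup_{s ∈ 𝕋} |X_s|` essentially bounded. -/
def RInf (ℱ : Filtration ℕ mΩ) (P : Measure Ω) (H : Horizon) : Set (H.Time → Ω → ℝ) :=
  {X | IsAdapted ℱ X ∧ ∃ C : ℝ, ∀ᵐ ω ∂P, ∀ s, |X s ω| ≤ C}

/-- The projection `π_{t,T}`: `π_{t,T}(X)_s = 1_{t ≤ s} X_s`. -/
def proj (t : H.Time) (X : H.Time → Ω → ℝ) : H.Time → Ω → ℝ :=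
  fun s ω => if t ≤ s then X s ω else 0

/-- The space `ℛ_t^∞ = π_{t,T}(ℛ^∞)`. -/
def RInfFrom (ℱ : Filtration ℕ mΩ) (P : Measure Ω) (t : H.Time) : Set (H.Time → Ω → ℝ) :=
  proj t '' RInf ℱ P H

/-- An optional probability measure on `𝕋`, normalized with respect to `ν`: an adapted process
`γ` such that `ν`-almost surely `γ_s ≥ 0` for all `s` and `∑_{s ∈ 𝕋} γ_s = 1`. -/
def IsOptionalProb (ℱ : Filtration ℕ mΩ) (ν : Measure Ω) (γ : H.Time → Ω → ℝ) : Prop :=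
  IsAdapted ℱ γ ∧ ∀ᵐ ω ∂ν, (∀ s, 0 ≤ γ s ω) ∧ HasSum (fun s => γ s ω) 1

/-! ### The optional product space -/

/-- The product space `Ω × 𝕋`, to be equipped with the optional σ-field of `ℱ`; its points are
the pairs `(ω, s)` of a scenario `ω` and a time `s`. -/
@[ext]
structure OptSpace {Ω : Type*} {mΩ : MeasurableSpace Ω} (ℱ : Filtration ℕ mΩ) (H : Horizon) where
  scen : Ω
  time : H.Time

/-- The set `A × S ⊆ Ω × 𝕋`. -/
def rect (ℱ : Filtration ℕ mΩ) (A : Set Ω) (S : Set H.Time) : Set (OptSpace ℱ H) :=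
  {z | z.scen ∈ A ∧ z.time ∈ S}

/-- The optional σ-field, generated by the sets `A × {s}` with `A ∈ ℱ_s`. -/
instance (ℱ : Filtration ℕ mΩ) (H : Horizon) : MeasurableSpace (OptSpace ℱ H) :=
  MeasurableSpace.generateFrom
    {B | ∃ (s : H.Time) (A : Set Ω), MeasurableSet[sigmaAt ℱ s.1] A ∧ B = rect ℱ A {s}}

/-- The member of the optional filtration at time `t`, generated by the sets `A × {j}` with
`j < t`, `A ∈ ℱ_j`, and the sets `A × 𝕋_t` with `A ∈ ℱ_t`. -/
@[reducible]
def optSigma (ℱ : Filtration ℕ mΩ) (t : H.Time) : MeasurableSpace (OptSpace ℱ H) :=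
  MeasurableSpace.generateFrom
    ({B | ∃ (j : H.Time) (A : Set Ω), j < t ∧ MeasurableSet[sigmaAt ℱ j.1] A ∧
        B = rect ℱ A {j}} ∪
      {B | ∃ A : Set Ω, MeasurableSet[sigmaAt ℱ t.1] A ∧ B = rect ℱ A (Set.Ici t)})

/-- The measure `P ⊗ μ` on the optional σ-field, `E_{P ⊗ μ}[X] = E_P[∑_{s ∈ 𝕋} X_s μ_s]`: the sum
over `s` of the images of `μ_s dP` under `ω ↦ (ω, s)`. -/
def optMeasure (ℱ : Filtration ℕ mΩ) (P : Measure Ω) (μ : H.Time → Ω → ℝ) :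
    Measure (OptSpace ℱ H) :=
  Measure.sum fun s : H.Time =>
    (P.withDensity fun ω => ENNReal.ofReal (μ s ω)).map fun ω => ⟨ω, s⟩

/-! ### Entropic risk measures -/

/-- The conditional entropic risk measure on the optional product space,
`ρ̄_t(X) = (1/R_t) log E_{P ⊗ μ}[exp(-R_t X) | ℱ̄_t]` with `R_t = (r_0, …, r_{t-1}, r_t, r_t, …)`. -/
def entropicBar (ℱ : Filtration ℕ mΩ) (P : Measure Ω) (μ r : H.Time → Ω → ℝ) (t : H.Time)
    (X : H.Time → Ω → ℝ) : OptSpace ℱ H → ℝ :=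
  let R : OptSpace ℱ H → ℝ := fun z => r (min z.time t) z.scen
  fun z => 1 / R z *
    Real.log (((optMeasure ℱ P μ)[fun y => Real.exp (-R y * X y.time y.scen) | optSigma ℱ t]) z)

/-- `ρ : ℛ_t^∞ → L_t^∞` is associated to `ρbar : L̄^∞ = ℛ^∞ → L̄_t^∞`, that is, for `X ∈ ℛ^∞`,
`ρbar(X) = -X_0 1_{0} - … - X_{t-1} 1_{t-1} + ρ(π_{t,T} X) 1_{𝕋_t}`, almost surely under `P ⊗ μ`. -/
def IsAssociated (ℱ : Filtration ℕ mΩ) (P : Measure Ω) (μ : H.Time → Ω → ℝ) (t : H.Time)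
    (ρbar : (H.Time → Ω → ℝ) → OptSpace ℱ H → ℝ) (ρ : (H.Time → Ω → ℝ) → Ω → ℝ) : Prop :=
  (∀ X ∈ RInfFrom ℱ P t, MemLInf P (sigmaAt ℱ t.1) (ρ X)) ∧
  ∀ X ∈ RInf ℱ P H, ρbar X =ᵐ[optMeasure ℱ P μ]
    fun z => if z.time < t then -X z.time z.scen else ρ (proj t X) z.scen

/-- The conditional entropic risk measure for random variables,
`ρ_t^{P,r}(Y) = (1/r) log E_P[exp(-r Y) | ℱ_t]`. -/
def entropicRV (ℱ : Filtration ℕ mΩ) (P : Measure Ω) (r : Ω → ℝ) (t : H.Time) (Y : Ω → ℝ) :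
    Ω → ℝ :=
  fun ω => 1 / r ω * Real.log ((P[fun ω' => Real.exp (-r ω' * Y ω') | sigmaAt ℱ t.1]) ω)

/-- The normalized restriction `ν^t` of `ν` to `𝕋_t`. -/
def normRestr (t : H.Time) (ν : H.Time → ℝ) (s : Set.Ici t) : ℝ :=
  if 0 < ∑' j : Set.Ici t, ν j then ν s / ∑' j : Set.Ici t, ν j else 0

/-- The entropic risk measure with respect to time,
`ρ_t^{ν,r}(x) = (1/r) log ∑_{s ∈ 𝕋_t} exp(-r x_s) ν_s^t`. -/
def entropicTime (t : H.Time) (ν : H.Time → ℝ) (r : ℝ) (x : H.Time → ℝ) : ℝ :=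
  1 / r * Real.log (∑' s : Set.Ici t, Real.exp (-r * x s) * normRestr t ν s)

/-! ### Local absolute continuity, densities, discounting -/

/-- `Q` is locally absolutely continuous with respect to `P`: `Q ≪ P` on `ℱ_n` for every
`n ∈ 𝕋 ∩ ℕ`. -/
def IsLocAC (ℱ : Filtration ℕ mΩ) (H : Horizon) (P Q : Measure Ω) : Prop :=
  ∀ n : ℕ, (n : ℕ∞) ∈ H.times → Q.trim (ℱ.le n) ≪ P.trim (ℱ.le n)

/-- The density process `M_n = dQ/dP` on `ℱ_n`, with `M_∞ = lim_n M_n`; the limit exists in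
`[0, ∞]` almost surely under `P` and under `Q`, and the limes superior is a version of it. -/
def densityProc (ℱ : Filtration ℕ mΩ) (P Q : Measure Ω) (s : ℕ∞) : Ω → ℝ≥0∞ :=
  if s = ⊤ then fun ω =>
    limsup (fun n : ℕ => (Q.trim (ℱ.le n)).rnDeriv (P.trim (ℱ.le n)) ω) atTop
  else (Q.trim (ℱ.le s.toNat)).rnDeriv (P.trim (ℱ.le s.toNat))

/-- The set `Γ(Q)` of optional random measures on `𝕋` normalized with respect to `Q`; if
`𝕋 = ℕ ∪ {∞}`, they satisfy in addition `γ_∞ = 0` `Q`-a.s. on `{M_∞ = ∞}`. -/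
def Gam (ℱ : Filtration ℕ mΩ) (P Q : Measure Ω) (H : Horizon) : Set (H.Time → Ω → ℝ) :=
  {γ | IsOptionalProb ℱ Q γ ∧
    ∀ s : H.Time, s.1 = ⊤ → ∀ᵐ ω ∂Q, densityProc ℱ P Q ⊤ ω = ⊤ → γ s ω = 0}

/-- The discounting process `D_t = 1 - ∑_{s < t} γ_s` of `γ`, for `t ∈ 𝕋 ∩ ℕ`. -/
def discount (γ : H.Time → Ω → ℝ) (t : H.Time) (ω : Ω) : ℝ :=
  1 - ∑' s : Set.Iio t, γ s ω

/-! ### Minimal penalty function -/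

/-- `g` is (a version of) the essential supremum under `R` of the family `f`. -/
def IsEssSup {ι : Type*} (R : Measure Ω) (f : ι → Ω → EReal) (g : Ω → EReal) : Prop :=
  AEMeasurable g R ∧ (∀ i, f i ≤ᵐ[R] g) ∧
    ∀ h : Ω → EReal, AEMeasurable h R → (∀ i, f i ≤ᵐ[R] h) → g ≤ᵐ[R] h

/-- The acceptance set `𝒜_t = {X ∈ ℛ_t^∞ | ρ(X) ≤ 0}`. -/
def acceptance (ℱ : Filtration ℕ mΩ) (P : Measure Ω) (t : H.Time)
    (ρ : (H.Time → Ω → ℝ) → Ω → ℝ) : Set (H.Time → Ω → ℝ) :=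
  {X | X ∈ RInfFrom ℱ P t ∧ ρ X ≤ᵐ[P] 0}

/-- `a` is the value at `Q ⊗ γ` of the minimal penalty function of `ρ`, that is, `Q`-a.s. on
`{D_t > 0}`, the essential supremum of `E_Q[-∑_{s ∈ 𝕋_t} (γ_s / D_t) X_s | ℱ_t]` over
`X ∈ 𝒜_t`. -/
def IsMinimalPenalty (ℱ : Filtration ℕ mΩ) (P : Measure Ω) (t : H.Time)
    (ρ : (H.Time → Ω → ℝ) → Ω → ℝ) (Q : Measure Ω) (γ : H.Time → Ω → ℝ) (a : Ω → EReal) : Prop :=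
  IsEssSup (Q.restrict {ω | 0 < discount γ t ω})
    (fun (X : acceptance ℱ P t ρ) (ω : Ω) =>
      (((Q[fun ω' => -∑' s : Set.Ici t, γ s ω' / discount γ t ω' * X.1 s ω' |
        sigmaAt ℱ t.1]) ω : ℝ) : EReal)) a

/-! ### The entropic penalty -/

/-- The sum of a countable family in `[-∞, ∞]`: the sum of the positive parts minus the sum of
the negative parts. -/
def erealSum {ι : Type*} (f : ι → EReal) : EReal :=
  ((∑' i, (f i).toENNReal : ℝ≥0∞) : EReal) - ((∑' i, (-f i).toENNReal : ℝ≥0∞) : EReal)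

/-- The conditional expectation of a random variable with values in `[-∞, ∞]`: that of its
positive part minus that of its negative part. -/
def condEReal (Q : Measure Ω) (m : MeasurableSpace Ω) (f : Ω → EReal) : Ω → EReal :=
  fun ω => ((Q⁻[fun ω' => (f ω').toENNReal | m] ω : ℝ≥0∞) : EReal) -
    ((Q⁻[fun ω' => (-f ω').toENNReal | m] ω : ℝ≥0∞) : EReal)

/-- The measure on `𝕋_t` with weights `w`. -/
def weightMeasure {t : H.Time} (w : Set.Ici t → ℝ) : Measure (Set.Ici t) :=
  Measure.sum fun s => ENNReal.ofReal (w s) • Measure.dirac s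

/-- `(1/r) E_Q[∑_{s ∈ 𝕋_t} γ_s^t log(M_s / M_t) | ℱ_t] + (1/r) E_Q[H(γ^t | μ^t) | ℱ_t]`. -/
def entropicPenalty (ℱ : Filtration ℕ mΩ) (P : Measure Ω) (μ : H.Time → Ω → ℝ) (r : Ω → ℝ)
    (t : H.Time) (Q : Measure Ω) (γ : H.Time → Ω → ℝ) : Ω → EReal :=
  fun ω =>
    ((1 / r ω : ℝ) : EReal) * condEReal Q (sigmaAt ℱ t.1) (fun ω' =>
      erealSum fun s : Set.Ici t => ((normRestr t (fun j => γ j ω') s : ℝ) : EReal) *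
        ENNReal.log (densityProc ℱ P Q s.1.1 ω' / densityProc ℱ P Q t.1 ω')) ω +
    ((1 / r ω : ℝ) : EReal) * ((Q⁻[fun ω' =>
      InformationTheory.klDiv (weightMeasure (normRestr t fun j => γ j ω'))
        (weightMeasure (normRestr t fun j => μ j ω')) | sigmaAt ℱ t.1] ω : ℝ≥0∞) : EReal)

end ProcessRisk

end

noncomputable section

namespace ProcessRisk

/-! ### Conditional Lebesgue expectations -/

section CondLExp

variable {α : Type*} {m m₀ : MeasurableSpace α} {ν : Measure[m₀] α}

/-! Conditioning on `ℱ̄_t` resolves the times before `t` and sees all of `𝕋_t` as one block. Hence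
`E_{P⊗μ}[Z | ℱ̄_t]` is `Z_s` at times `s < t`, and on `𝕋_t` it is `E_P[∑_{s ≥ t} μ_s^t Z_s | ℱ_t]`
(`condLExp_optMeasure`). With `Z = exp(-R_t X)`, every associated map must agree with `(1/r_t) log
E_P[∑_{s ≥ t} μ_s^t exp(-r_t X_s) | ℱ_t]` (`entropicCond`). Claim (1) only rewrites the inner sum as
the exponential of its logarithm.

For (2), put `J_s = (γ_s^t M_s) / (μ_s^t M_t)`, the density of `Q ⊗ γ` with respect to `P ⊗ μ` given
`ℱ_t`. The claim is Gibbs' variational principle `r_t α_t = E_Q[∑ γ_s^t log J_s | ℱ_t]`, in which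
`log J_s` splits into `log (M_s / M_t)` and `log (γ_s^t / μ_s^t)`. The upper bound is `1 + x ≤ exp
x` at `x = -r_t X_s - log J_s` (`young_le`), combined with a change of measure that turns
acceptability of `X` under `P` into `E_Q[∑ μ_s^t exp(-r_t X_s) M_t / M_s | ℱ_t] ≤ 1`
(`condLExp_tsum_div_ratio_le`). The formal optimizer `-(1/r_t) log J` is unbounded; clipping `J` to
`[1/c, c]` and shifting by a constant that tends to zero gives bounded acceptable processes
(`nearOptimal`), and `c → ∞` by monotone convergence.

Two points need care. First, `Q` is only locally absolutely continuous, so `M_∞ P` is only the part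
of `Q` on `{M_∞ < ∞}` (`lintegral_mul_densityProc_top`). The condition `γ_∞ = 0` on the rest keeps
`Q ⊗ γ` away from the singular part. Second, the entropies may be infinite. Logarithms are therefore
carried as positive and negative parts in `[0, ∞]`, and identities are written as equalities of
sums. Passing back to differences requires the negative parts to be `Q`-integrable. For `log J` this
comes from the same change of measure (`lintegral_jointNeg_ne_top`); for `log (M_s / M_t)` it comes
from the maximal inequality `Q(∃ n ≥ t, M_n ≤ c M_t) ≤ c` (`measure_exists_densityProc_le`). -/

theorem lintegral_mul_condLExp (hm : m ≤ m₀) [SigmaFinite (ν.trim hm)] {f g : α → ℝ≥0∞}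
    (hf : Measurable[m] f) (hg : AEMeasurable g ν) :
    ∫⁻ x, f x * condLExp m ν g x ∂ν = ∫⁻ x, f x * g x ∂ν := by
  -- The two densities define the same measure on `m`, so no integrability of `f` or `g` is needed.
  have key : (ν.withDensity (condLExp m ν g)).trim hm = (ν.withDensity g).trim hm := by
    refine @Measure.ext _ m _ _ fun s hs => ?_
    rw [trim_measurableSet_eq hm hs, trim_measurableSet_eq hm hs, withDensity_apply _ (hm s hs),
      withDensity_apply _ (hm s hs), setLIntegral_condLExp hm ν g hs]
  have h1 := lintegral_withDensity_eq_lintegral_mul₀ hg (hf.mono hm le_rfl).aemeasurable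
  have h2 := lintegral_withDensity_eq_lintegral_mul₀ (μ := ν)
    (measurable_condLExp' m ν g).aemeasurable (hf.mono hm le_rfl).aemeasurable
  rw [← lintegral_trim hm hf] at h1 h2
  rw [key, h1] at h2
  simpa [mul_comm] using h2.symm

theorem condLExp_mul_left (hm : m ≤ m₀) [SigmaFinite (ν.trim hm)] {f g : α → ℝ≥0∞}
    (hf : Measurable[m] f) (hg : AEMeasurable g ν) :
    condLExp m ν (fun x => f x * g x) =ᵐ[ν] fun x => f x * condLExp m ν g x := by
  symm
  refine ae_eq_condLExp hm _ _ (hf.mul (measurable_condLExp m ν g)) fun s hs => ?_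
  have h := lintegral_mul_condLExp hm (hf.indicator hs) hg
  rw [← lintegral_indicator (hm s hs), ← lintegral_indicator (hm s hs)]
  simpa only [Set.indicator_mul_left] using h

/-- Tests an upper bound on `m`-measurable sets. Changes of measure between `P` and `Q` lose
singular parts, so only inequalities are available there. -/
theorem condLExp_le_of_forall_setLIntegral_le (hm : m ≤ m₀) [SigmaFinite (ν.trim hm)]
    {f g : α → ℝ≥0∞} (hg : Measurable[m] g)
    (h : ∀ s, MeasurableSet[m] s → ∫⁻ x in s, f x ∂ν ≤ ∫⁻ x in s, g x ∂ν) :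
    condLExp m ν f ≤ᵐ[ν] g := by
  apply ae_le_of_ae_le_trim (hm := hm)
  refine ae_le_of_forall_setLIntegral_le_of_sigmaFinite (measurable_condLExp m ν f)
    fun s hs _ => ?_
  rw [setLIntegral_condLExp_trim hm _ _ hs, setLIntegral_trim hm hg hs]
  exact h s hs

/-- Conditional monotone convergence; it removes the truncation at the end of the proof. -/
theorem condLExp_iSup (hm : m ≤ m₀) [SigmaFinite (ν.trim hm)] {f : ℕ → α → ℝ≥0∞}
    (hf : ∀ n, Measurable (f n)) (hmono : ∀ x, Monotone fun n => f n x) :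
    condLExp m ν (fun x => ⨆ n, f n x) =ᵐ[ν] fun x => ⨆ n, condLExp m ν (f n) x := by
  symm
  refine ae_eq_condLExp hm _ _ (.iSup fun n => measurable_condLExp m ν (f n)) fun s hs => ?_
  rw [lintegral_iSup hf (fun i j hij x => hmono x hij)]
  rw [lintegral_iSup_ae fun n => measurable_condLExp' m ν (f n)]
  · exact iSup_congr fun n => setLIntegral_condLExp hm ν (f n) hs
  · exact fun n => ae_restrict_of_ae
      (condLExp_mono (.of_forall fun x => hmono x (Nat.le_succ n)))

end CondLExp

/-! ### The density process and the Lebesgue decomposition -/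

section Density

variable {Ω : Type*} {mΩ : MeasurableSpace Ω}

theorem sigmaAt_top (ℱ : Filtration ℕ mΩ) : sigmaAt ℱ ⊤ = ⨆ n, ℱ n := if_pos rfl

theorem sigmaAt_coe (ℱ : Filtration ℕ mΩ) (n : ℕ) : sigmaAt ℱ (n : ℕ∞) = ℱ n := by
  simp [sigmaAt]

theorem sigmaAt_le (ℱ : Filtration ℕ mΩ) (s : ℕ∞) : sigmaAt ℱ s ≤ mΩ := by
  induction s using ENat.recTopCoe with
  | top => rw [sigmaAt_top]; exact iSup_le ℱ.le
  | coe n => rw [sigmaAt_coe]; exact ℱ.le n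

theorem sigmaAt_mono (ℱ : Filtration ℕ mΩ) : Monotone (sigmaAt ℱ) := by
  intro s t hst
  induction t using ENat.recTopCoe with
  | top =>
    rw [sigmaAt_top]
    induction s using ENat.recTopCoe with
    | top => rw [sigmaAt_top]
    | coe n => rw [sigmaAt_coe]; exact le_iSup (fun n => ℱ n) n
  | coe k =>
    induction s using ENat.recTopCoe with
    | top => simp at hst
    | coe n => rw [sigmaAt_coe, sigmaAt_coe]; exact ℱ.mono (by exact_mod_cast hst)

theorem densityProc_coe (ℱ : Filtration ℕ mΩ) (P Q : Measure Ω) (n : ℕ) :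
    densityProc ℱ P Q (n : ℕ∞) = (Q.trim (ℱ.le n)).rnDeriv (P.trim (ℱ.le n)) :=
  if_neg (ENat.natCast_ne_top n)

theorem densityProc_top (ℱ : Filtration ℕ mΩ) (P Q : Measure Ω) :
    densityProc ℱ P Q ⊤ = fun ω => limsup (fun n : ℕ => densityProc ℱ P Q (n : ℕ∞) ω) atTop := by
  simp only [densityProc_coe]
  exact if_pos rfl

theorem measurable_densityProc (ℱ : Filtration ℕ mΩ) (P Q : Measure Ω) (s : ℕ∞) :
    Measurable[sigmaAt ℱ s] (densityProc ℱ P Q s) := by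
  have hc (n : ℕ) : Measurable[ℱ n] (densityProc ℱ P Q (n : ℕ∞)) := by
    rw [densityProc_coe]
    exact Measure.measurable_rnDeriv _ _
  induction s using ENat.recTopCoe with
  | top =>
    rw [densityProc_top, sigmaAt_top]
    exact Measurable.limsup fun n => (hc n).mono (le_iSup (fun n => ℱ n) n) le_rfl
  | coe n => rw [sigmaAt_coe]; exact hc n

theorem lintegral_mul_rnDeriv_trim {m : MeasurableSpace Ω} (hm : m ≤ mΩ) {P Q : Measure[mΩ] Ω}
    [IsFiniteMeasure P] [IsFiniteMeasure Q] (h : Q.trim hm ≪ P.trim hm) {f : Ω → ℝ≥0∞}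
    (hf : Measurable[m] f) :
    ∫⁻ ω, f ω * (Q.trim hm).rnDeriv (P.trim hm) ω ∂P = ∫⁻ ω, f ω ∂Q := by
  rw [← lintegral_trim hm (f := fun ω => f ω * (Q.trim hm).rnDeriv (P.trim hm) ω)
    (hf.mul (Measure.measurable_rnDeriv _ _)), ← lintegral_trim hm hf,
    ← lintegral_rnDeriv_mul h hf.aemeasurable]
  simp only [mul_comm]

/-- The density process converges, under `P + Q`, to the ratio of the densities of the traces of
`Q` and `P` on the limit σ-field with respect to `P + Q`. -/
theorem ae_limsup_densityProc_eq (ℱ : Filtration ℕ mΩ) {P Q : Measure Ω}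
    [IsFiniteMeasure P] [IsFiniteMeasure Q]
    (h : ∀ n : ℕ, Q.trim (ℱ.le n) ≪ P.trim (ℱ.le n)) (hm : (⨆ n, ℱ n) ≤ mΩ) :
    ∀ᵐ ω ∂(P + Q),
      ((Q.trim hm).rnDeriv ((P + Q).trim hm) ω + (P.trim hm).rnDeriv ((P + Q).trim hm) ω = 1) ∧
      densityProc ℱ P Q ⊤ ω =
        (Q.trim hm).rnDeriv ((P + Q).trim hm) ω / (P.trim hm).rnDeriv ((P + Q).trim hm) ω := by
  set κ := P + Q with hκ
  have hPκ : P ≪ κ := Measure.AbsolutelyContinuous.rfl.add_right Q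
  have hQκ : Q ≪ κ := Measure.AbsolutelyContinuous.rfl.add_right' P
  have hsum : ∀ᵐ ω ∂κ, (Q.trim hm).rnDeriv (κ.trim hm) ω + (P.trim hm).rnDeriv (κ.trim hm) ω = 1 := by
    apply ae_of_ae_trim hm
    have h1 := Measure.rnDeriv_add (Q.trim hm) (P.trim hm) (κ.trim hm)
    have h2 : Q.trim hm + P.trim hm = κ.trim hm := by
      rw [hκ, trim_add, add_comm]
    rw [h2] at h1
    filter_upwards [h1, Measure.rnDeriv_self (κ.trim hm)] with ω h3 h4
    rw [← Pi.add_apply, ← h3, h4]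
  -- The trace densities are the conditional expectations of `dS/dκ`, so Lévy's upward theorem
  -- applies.
  have conv : ∀ S : Measure Ω, IsFiniteMeasure S → S ≪ κ → ∀ᵐ ω ∂κ,
      Tendsto (fun n : ℕ => (S.trim (ℱ.le n)).rnDeriv (κ.trim (ℱ.le n)) ω) atTop
        (nhds ((S.trim hm).rnDeriv (κ.trim hm) ω)) := by
    intro S _ hS
    have hn : ∀ᵐ ω ∂κ, ∀ n : ℕ, (S.trim (ℱ.le n)).rnDeriv (κ.trim (ℱ.le n)) ω =
        ENNReal.ofReal ((κ[fun x => (S.rnDeriv κ x).toReal | ℱ n]) ω) :=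
      ae_all_iff.2 fun n => ae_of_ae_trim _ (rnDeriv_trim (ℱ.le n) hS)
    filter_upwards [hn, ae_of_ae_trim _ (rnDeriv_trim hm hS),
      tendsto_ae_condExp (ℱ := ℱ) (μ := κ) fun x => (S.rnDeriv κ x).toReal] with ω h1 h2 h3
    rw [h2]
    simp only [h1]
    exact (ENNReal.continuous_ofReal.tendsto _).comp h3
  -- Positivity is clear under `P`; local absolute continuity carries it to `Q`, hence to `κ`. With
  -- the chain rule, `M_n` is then a quotient of densities with respect to `κ`.
  have hpos : ∀ᵐ ω ∂κ, ∀ n : ℕ, 0 < (P.trim (ℱ.le n)).rnDeriv (κ.trim (ℱ.le n)) ω := by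
    refine ae_all_iff.2 fun n => ?_
    have h1 : ∀ᵐ ω ∂(P.trim (ℱ.le n)), 0 < (P.trim (ℱ.le n)).rnDeriv (κ.trim (ℱ.le n)) ω :=
      Measure.rnDeriv_pos (hPκ.trim (ℱ.le n))
    rw [hκ, ae_add_measure_iff]
    exact ⟨ae_of_ae_trim _ h1, ae_of_ae_trim _ ((h n).ae_le h1)⟩
  have hmul : ∀ᵐ ω ∂κ, ∀ n : ℕ, densityProc ℱ P Q (n : ℕ∞) ω *
      (P.trim (ℱ.le n)).rnDeriv (κ.trim (ℱ.le n)) ω =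
        (Q.trim (ℱ.le n)).rnDeriv (κ.trim (ℱ.le n)) ω := by
    refine ae_all_iff.2 fun n => ?_
    rw [densityProc_coe]
    exact ae_of_ae_trim _ (Measure.rnDeriv_mul_rnDeriv (h n))
  have hfin : ∀ᵐ ω ∂κ, ∀ n : ℕ, (P.trim (ℱ.le n)).rnDeriv (κ.trim (ℱ.le n)) ω ≠ ⊤ :=
    ae_all_iff.2 fun n => ae_of_ae_trim _ (Measure.rnDeriv_ne_top _ _)
  filter_upwards [hsum, conv P inferInstance hPκ, conv Q inferInstance hQκ, hpos, hmul, hfin]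
    with ω h1 h2 h3 h4 h5 h6
  refine ⟨h1, ?_⟩
  have hq : (Q.trim hm).rnDeriv (κ.trim hm) ω ≠ ⊤ := by
    intro h; simp [h] at h1
  have hp : (P.trim hm).rnDeriv (κ.trim hm) ω ≠ ⊤ := by
    intro h; simp [h] at h1
  rw [densityProc_top]
  refine Tendsto.limsup_eq ?_
  -- The limits add up to one, which excludes the indeterminate quotient `0 / 0`.
  have h7 := ENNReal.Tendsto.div h3 (by
    by_contra! hc
    simp [hc.1, hc.2] at h1) h2 (Or.inr hq)
  refine h7.congr fun n => ?_
  rw [← h5 n, mul_div_assoc, ENNReal.div_self (h4 n).ne' (h6 n), mul_one]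

/-- This is the Lebesgue decomposition of `Q` on `ℱ_∞`. With `a` and `b` the densities of `Q` and
`P` with respect to `P + Q`, one has `M_∞ = a / b`, so `M_∞ b = a` where `b > 0`, and `{b = 0}` is
`{M_∞ = ∞}`. -/
theorem lintegral_mul_densityProc_top (ℱ : Filtration ℕ mΩ) {P Q : Measure Ω}
    [IsFiniteMeasure P] [IsFiniteMeasure Q]
    (h : ∀ n : ℕ, Q.trim (ℱ.le n) ≪ P.trim (ℱ.le n)) {f : Ω → ℝ≥0∞}
    (hf : Measurable[⨆ n, ℱ n] f) :
    ∫⁻ ω, f ω * densityProc ℱ P Q ⊤ ω ∂P =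
      ∫⁻ ω, {ω | densityProc ℱ P Q ⊤ ω ≠ ⊤}.indicator f ω ∂Q := by
  have hm : (⨆ n, ℱ n) ≤ mΩ := iSup_le ℱ.le
  have hL : Measurable[⨆ n, ℱ n] (densityProc ℱ P Q ⊤) := by
    rw [← sigmaAt_top]
    exact measurable_densityProc ℱ P Q ⊤
  have hPR : P ≪ P + Q := Measure.AbsolutelyContinuous.rfl.add_right Q
  have hQR : Q ≪ P + Q := Measure.AbsolutelyContinuous.rfl.add_right' P
  have hset : MeasurableSet[⨆ n, ℱ n] {ω | densityProc ℱ P Q ⊤ ω ≠ ⊤} :=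
    (hL (measurableSet_singleton ⊤)).compl
  rw [← lintegral_mul_rnDeriv_trim hm (hPR.trim hm)
    (f := fun ω => f ω * densityProc ℱ P Q ⊤ ω) (hf.mul hL),
    ← lintegral_mul_rnDeriv_trim hm (hQR.trim hm) (hf.indicator hset)]
  refine lintegral_congr_ae ?_
  filter_upwards [ae_limsup_densityProc_eq ℱ h hm] with ω h1
  obtain ⟨h1, h2⟩ := h1
  set a := (Q.trim hm).rnDeriv ((P + Q).trim hm) ω
  set b := (P.trim hm).rnDeriv ((P + Q).trim hm) ω
  have ha : a ≠ ⊤ := by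
    intro h; simp [h] at h1
  have hb : b ≠ ⊤ := by
    intro h; simp [h] at h1
  -- If `b = 0`, then `a = 1` and `M_∞ = ∞`: the left side vanishes by `∞ * 0 = 0`, the right side
  -- by the indicator.
  by_cases hb0 : b = 0
  · have ha1 : a = 1 := by simpa [hb0] using h1
    have : densityProc ℱ P Q ⊤ ω = ⊤ := by rw [h2, hb0, ha1]; simp
    simp [this, hb0]
  · have hne : densityProc ℱ P Q ⊤ ω ≠ ⊤ := by
      rw [h2]; exact ENNReal.div_ne_top ha hb0
    rw [Set.indicator_of_mem (by exact hne), mul_assoc, h2, ENNReal.div_mul_cancel hb0 hb]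

theorem Horizon.coe_mem_times {H : Horizon} (h : ⊤ ∈ H.times) (n : ℕ) : (n : ℕ∞) ∈ H.times := by
  cases H <;> simp_all [Horizon.times]

theorem ae_densityProc_coe_ne_top {ℱ : Filtration ℕ mΩ} {P Q : Measure Ω} {H : Horizon}
    [IsFiniteMeasure P] [IsFiniteMeasure Q] (h : IsLocAC ℱ H P Q) {n : ℕ}
    (hn : (n : ℕ∞) ∈ H.times) : ∀ᵐ ω ∂Q, densityProc ℱ P Q (n : ℕ∞) ω ≠ ⊤ := by
  rw [densityProc_coe]
  exact ae_of_ae_trim _ ((h n hn).ae_le (Measure.rnDeriv_ne_top _ _))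

/-- One formula for all times. At finite times `M_s < ∞` holds `Q`-a.s., and the indicator has no
effect. -/
theorem lintegral_mul_densityProc {ℱ : Filtration ℕ mΩ} {P Q : Measure Ω} {H : Horizon}
    [IsFiniteMeasure P] [IsFiniteMeasure Q] (h : IsLocAC ℱ H P Q) (s : H.Time) {f : Ω → ℝ≥0∞}
    (hf : Measurable[sigmaAt ℱ s.1] f) :
    ∫⁻ ω, f ω * densityProc ℱ P Q s.1 ω ∂P =
      ∫⁻ ω, {ω | densityProc ℱ P Q s.1 ω ≠ ⊤}.indicator f ω ∂Q := by
  obtain ⟨s, hs⟩ := s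
  induction s using ENat.recTopCoe with
  | top =>
    rw [sigmaAt_top] at hf
    exact lintegral_mul_densityProc_top ℱ (fun n => h n (Horizon.coe_mem_times hs n)) hf
  | coe n =>
    rw [sigmaAt_coe] at hf
    have h1 := lintegral_mul_rnDeriv_trim (ℱ.le n) (h n hs) hf
    simp only [densityProc_coe] at h1 ⊢
    rw [h1]
    refine lintegral_congr_ae ?_
    filter_upwards [ae_densityProc_coe_ne_top h hs] with ω hω
    rw [densityProc_coe] at hω
    rw [Set.indicator_of_mem (by exact hω)]

end Density

end ProcessRisk

namespace ProcessRisk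

/-! ### A maximal inequality and the negative part of `log (M_s / M_t)` -/

section Maximal

variable {Ω : Type*} {mΩ : MeasurableSpace Ω} {ℱ : Filtration ℕ mΩ} {P Q : Measure Ω} {H : Horizon}

/-- The indicator of `{M_s = 0}` has integral zero against `M_s dP`, and this set avoids `{M_s =
∞}`. -/
theorem ae_densityProc_ne_zero [IsFiniteMeasure P] [IsFiniteMeasure Q] (h : IsLocAC ℱ H P Q)
    (s : H.Time) : ∀ᵐ ω ∂Q, densityProc ℱ P Q s.1 ω ≠ 0 := by
  have hM := measurable_densityProc ℱ P Q s.1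
  have hS : MeasurableSet[sigmaAt ℱ s.1] {ω | densityProc ℱ P Q s.1 ω = 0} :=
    hM (measurableSet_singleton 0)
  have h1 := lintegral_mul_densityProc h s
    ((measurable_const (a := (1 : ℝ≥0∞))).indicator hS)
  have h2 : ∀ ω, {ω | densityProc ℱ P Q s.1 ω ≠ ⊤}.indicator
      ({ω | densityProc ℱ P Q s.1 ω = 0}.indicator fun _ => (1 : ℝ≥0∞)) ω =
      {ω | densityProc ℱ P Q s.1 ω = 0}.indicator (fun _ => (1 : ℝ≥0∞)) ω := by
    intro ω
    by_cases h0 : densityProc ℱ P Q s.1 ω = 0 <;> simp [Set.indicator, h0]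
  have h3 : ∀ ω, {ω | densityProc ℱ P Q s.1 ω = 0}.indicator (fun _ => (1 : ℝ≥0∞)) ω *
      densityProc ℱ P Q s.1 ω = 0 := by
    intro ω
    by_cases h0 : densityProc ℱ P Q s.1 ω = 0 <;> simp [Set.indicator, h0]
  simp only [h2, h3, lintegral_zero] at h1
  rw [lintegral_indicator_const (sigmaAt_le ℱ _ _ hS), one_mul] at h1
  rw [ae_iff]
  simpa using h1.symm

/-- A maximal inequality for the reciprocal of the density process. -/
theorem measure_exists_densityProc_le [IsProbabilityMeasure P] [IsProbabilityMeasure Q]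
    (h : IsLocAC ℱ H P Q) (t : H.Time) (c : ℝ≥0∞) :
    Q {ω | ∃ n : ℕ, t.1 ≤ n ∧ (n : ℕ∞) ∈ H.times ∧
      densityProc ℱ P Q (n : ℕ∞) ω ≤ c * densityProc ℱ P Q t.1 ω} ≤ c := by
  classical
  set M := densityProc ℱ P Q with hMdef
  set B : ℕ → Set Ω := fun n =>
    {ω | t.1 ≤ n ∧ (n : ℕ∞) ∈ H.times ∧ M (n : ℕ∞) ω ≤ c * M t.1 ω} with hB
  have hBmeas : ∀ n k : ℕ, n ≤ k → MeasurableSet[sigmaAt ℱ (k : ℕ∞)] (B n) := by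
    intro n k hnk
    by_cases h1 : t.1 ≤ n ∧ (n : ℕ∞) ∈ H.times
    · have h2 : B n = {ω | M (n : ℕ∞) ω ≤ c * M t.1 ω} := by
        ext ω; simp [hB, h1.1, h1.2]
      have hnk' : (n : ℕ∞) ≤ k := by exact_mod_cast hnk
      rw [h2]
      exact (((measurable_densityProc ℱ P Q _).mono (sigmaAt_mono ℱ hnk') le_rfl).prodMk
        (((measurable_densityProc ℱ P Q _).mono
          (sigmaAt_mono ℱ (h1.1.trans hnk')) le_rfl).const_mul c)) measurableSet_le'
    · have h2 : B n = ∅ := by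
        ext ω; simp only [hB, Set.mem_ofPred_eq, Set.mem_empty_iff_false, iff_false]; tauto
      rw [h2]; exact @MeasurableSet.empty _ (sigmaAt ℱ (k : ℕ∞))
  -- `disjointed B n` is the event that `n` is the first time at which `M_n ≤ c M_t`; it lies in
  -- `ℱ_n`.
  have hT : ∀ n : ℕ, MeasurableSet[sigmaAt ℱ (n : ℕ∞)] (disjointed B n) := by
    intro n
    rw [disjointed_eq_inter_compl]
    exact (hBmeas n n le_rfl).inter (MeasurableSet.iInter fun j =>
      MeasurableSet.iInter fun hj => (hBmeas j n hj.le).compl)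
  have hT' : ∀ n : ℕ, MeasurableSet (disjointed B n) := fun n => sigmaAt_le ℱ _ _ (hT n)
  -- On `ℱ_n` the measure `Q` has density `M_n`, which is at most `c M_t` on the first-entry event.
  -- Summing over these disjoint events leaves `c E_P[M_t] ≤ c`.
  have hle : ∀ n : ℕ, Q (disjointed B n) ≤ ∫⁻ ω in disjointed B n, c * M t.1 ω ∂P := by
    intro n
    by_cases h1 : (n : ℕ∞) ∈ H.times
    · have h2 := lintegral_mul_densityProc h ⟨n, h1⟩
        ((measurable_const (a := (1 : ℝ≥0∞))).indicator (hT n))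
      have h3 : ∫⁻ ω, {ω | M (n : ℕ∞) ω ≠ ⊤}.indicator
          ((disjointed B n).indicator fun _ => (1 : ℝ≥0∞)) ω ∂Q = Q (disjointed B n) := by
        rw [← lintegral_indicator_one (hT' n)]
        refine lintegral_congr_ae ?_
        filter_upwards [ae_densityProc_coe_ne_top h h1] with ω hω
        rw [Set.indicator_of_mem (by exact hω)]
        rfl
      rw [← h3, ← h2, ← lintegral_indicator (hT' n)]
      refine lintegral_mono fun ω => ?_
      by_cases hω : ω ∈ disjointed B n
      · simp only [Set.indicator_of_mem hω, one_mul]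
        exact (disjointed_subset B n hω).2.2
      · simp [Set.indicator_of_notMem hω]
    · have h2 : disjointed B n = ∅ := by
        refine Set.eq_empty_of_forall_notMem fun ω hω => h1 (disjointed_subset B n hω).2.1
      rw [h2]; simp
  have hset : {ω | ∃ n : ℕ, t.1 ≤ n ∧ (n : ℕ∞) ∈ H.times ∧ M (n : ℕ∞) ω ≤ c * M t.1 ω} =
      ⋃ n, disjointed B n := by
    rw [iUnion_disjointed]; ext ω; simp [hB]
  have hMt : ∫⁻ ω, M t.1 ω ∂P ≤ 1 := by
    have h1 := lintegral_mul_densityProc h t (measurable_const (a := (1 : ℝ≥0∞)))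
    simp only [one_mul] at h1
    rw [hMdef, h1]
    calc _ ≤ ∫⁻ _, (1 : ℝ≥0∞) ∂Q := lintegral_mono fun ω => Set.indicator_le_self _ _ ω
      _ = 1 := by simp
  rw [hset]
  calc Q (⋃ n, disjointed B n) ≤ ∑' n, Q (disjointed B n) := measure_iUnion_le _
    _ ≤ ∑' n, ∫⁻ ω in disjointed B n, c * M t.1 ω ∂P := ENNReal.tsum_le_tsum hle
    _ = ∫⁻ ω in ⋃ n, disjointed B n, c * M t.1 ω ∂P :=
        (lintegral_iUnion hT' (disjoint_disjointed B) _).symm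
    _ ≤ ∫⁻ ω, c * M t.1 ω ∂P := setLIntegral_le_lintegral _ _
    _ = c * ∫⁻ ω, M t.1 ω ∂P := lintegral_const_mul _
        ((measurable_densityProc ℱ P Q _).mono (sigmaAt_le ℱ _) le_rfl)
    _ ≤ c * 1 := by gcongr
    _ = c := mul_one c

theorem le_tsum_ite_natCast_lt (y : ℝ≥0∞) :
    y ≤ ∑' k : ℕ, if (k : ℝ≥0∞) < y then 1 else 0 := by
  induction y with
  | top => simp
  | coe y =>
    calc (y : ℝ≥0∞) ≤ (⌈y⌉₊ : ℝ≥0∞) := by exact_mod_cast Nat.le_ceil y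
      _ = ∑ k ∈ Finset.range ⌈y⌉₊, 1 := by simp
      _ = ∑ k ∈ Finset.range ⌈y⌉₊, if (k : ℝ≥0∞) < (y : ℝ≥0∞) then (1 : ℝ≥0∞) else 0 := by
          refine Finset.sum_congr rfl fun k hk => ?_
          rw [if_pos]
          exact_mod_cast Nat.lt_ceil.1 (Finset.mem_range.1 hk)
      _ ≤ _ := ENNReal.sum_le_tsum _

/-- The negative parts of `log (M_s / M_t)`, `s ≥ t`, have an integrable majorant. -/
theorem exists_majorant_neg_log_densityProc [IsProbabilityMeasure P] [IsProbabilityMeasure Q]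
    (h : IsLocAC ℱ H P Q) (t : H.Time) (ht : t.1 ≠ ⊤) :
    ∃ N : Ω → ℝ≥0∞, ∫⁻ ω, N ω ∂Q ≠ ⊤ ∧ ∀ᵐ ω ∂Q, ∀ s : Set.Ici t,
      (-(ENNReal.log (densityProc ℱ P Q s.1.1 ω / densityProc ℱ P Q t.1 ω))).toENNReal ≤ N ω := by
  classical
  set M := densityProc ℱ P Q with hMdef
  set c : ℕ → ℝ≥0∞ := fun k => ENNReal.ofReal (Real.exp (-k)) with hc
  set S : ℕ → Set Ω := fun k => {ω | ∃ n : ℕ, t.1 ≤ n ∧ (n : ℕ∞) ∈ H.times ∧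
      M (n : ℕ∞) ω ≤ c k * M t.1 ω} with hS
  have hSm : ∀ k, MeasurableSet (S k) := by
    intro k
    have : S k = ⋃ n : ℕ, {ω | t.1 ≤ n ∧ (n : ℕ∞) ∈ H.times ∧
      M (n : ℕ∞) ω ≤ c k * M t.1 ω} := by ext; simp [hS]
    rw [this]
    refine MeasurableSet.iUnion fun n => (MeasurableSet.const (t.1 ≤ n)).inter
      ((MeasurableSet.const ((n : ℕ∞) ∈ H.times)).inter
        (measurableSet_le (f := M (n : ℕ∞)) (g := fun ω => c k * M t.1 ω) ?_
          (Measurable.const_mul ?_ _)))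
    all_goals exact (measurable_densityProc ℱ P Q _).mono (sigmaAt_le ℱ _) le_rfl
  -- The majorant counts the levels `e^{-k}` below which `M_n / M_t` falls. A number `y` is at most
  -- the number of integers `k ≥ 0` with `k < y`, and the maximal inequality bounds the expected
  -- count by `∑ e^{-k}`.
  refine ⟨fun ω => ∑' k, (S k).indicator 1 ω, ?_, ?_⟩
  · rw [lintegral_tsum fun k => (measurable_one.indicator (hSm k)).aemeasurable]
    simp only [lintegral_indicator_one (hSm _)]
    have h1 : ∑' k, Q (S k) ≤ ∑' k, c k :=
      ENNReal.tsum_le_tsum fun k => measure_exists_densityProc_le h t (c k)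
    refine ne_top_of_le_ne_top ?_ h1
    rw [hc, ← ENNReal.ofReal_tsum_of_nonneg (fun k => (Real.exp_pos _).le) Real.summable_exp_neg_nat]
    exact ENNReal.ofReal_ne_top
  · have hcoe : ∀ᵐ ω ∂Q, M t.1 ω ≠ ⊤ := by
      obtain ⟨n, hn⟩ := ENat.ne_top_iff_exists.1 ht
      have := ae_densityProc_coe_ne_top (P := P) (Q := Q) h (n := n) (by rw [hn]; exact t.2)
      rwa [hn] at this
    filter_upwards [ae_densityProc_ne_zero h t, hcoe] with ω h0 h1 s
    refine (le_tsum_ite_natCast_lt _).trans (ENNReal.tsum_le_tsum fun k => ?_)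
    split_ifs with hk
    swap; · exact zero_le
    have hlt : M s.1.1 ω < c k * M t.1 ω := by
      rw [← ENNReal.div_lt_iff (Or.inl h0) (Or.inl h1), ← ENNReal.log_lt_log_iff, hc,
        ENNReal.log_ofReal_of_pos (Real.exp_pos _), Real.log_exp]
      rw [← EReal.neg_lt_neg_iff]
      have h2 : ((k : ℝ≥0∞) : EReal) < _ := EReal.coe_ennreal_lt_coe_ennreal_iff.2 hk
      rw [EReal.coe_toENNReal_eq_max] at h2
      rcases lt_max_iff.1 h2 with h3 | h3
      · exact absurd h3 (not_lt.2 (EReal.coe_ennreal_nonneg _))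
      · rw [← ENNReal.ofReal_natCast, EReal.coe_ennreal_ofReal, max_eq_left k.cast_nonneg] at h3
        simpa [hMdef] using h3
    have hmem : ω ∈ S k := by
      obtain ⟨⟨s, hs⟩, hts⟩ := s
      have hts : t.1 ≤ s := hts
      induction s using ENat.recTopCoe with
      | coe n => exact ⟨n, hts, hs, hlt.le⟩
      -- If the upper limit `M_∞` lies strictly below the level, so does `M_n` for all large `n`,
      -- and a finite time past `t` serves as a witness.
      | top =>
        simp only [hMdef, densityProc_top] at hlt
        have hev := eventually_lt_of_limsup_lt hlt
        obtain ⟨m, hm⟩ := ENat.ne_top_iff_exists.1 ht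
        obtain ⟨n, hn, hmn⟩ := (hev.and (eventually_ge_atTop m)).exists
        exact ⟨n, by rw [← hm]; exact_mod_cast hmn, Horizon.coe_mem_times hs n, hn.le⟩
    rw [Set.indicator_of_mem hmem]; rfl

end Maximal

end ProcessRisk

namespace ProcessRisk

variable {Ω : Type*} {mΩ : MeasurableSpace Ω} {ℱ : Filtration ℕ mΩ} {P Q : Measure Ω} {H : Horizon}

/-! ### Normalized weights -/

section Weights

theorem finite_Iic_time {t : H.Time} (ht : t.1 ≠ ⊤) : (Set.Iic t).Finite := by
  obtain ⟨n, hn⟩ := ENat.ne_top_iff_exists.1 ht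
  have h1 : (Set.Iic t.1).Finite := by
    rw [← hn]
    refine ((Set.finite_Iic n).image ((↑) : ℕ → ℕ∞)).subset fun s hs => ?_
    obtain ⟨k, rfl⟩ := ENat.ne_top_iff_exists.1 (ne_top_of_le_ne_top (ENat.natCast_ne_top n) hs)
    exact ⟨k, by simpa using hs, rfl⟩
  exact Set.Finite.preimage (f := Subtype.val) Subtype.val_injective.injOn h1

theorem finite_Iio_time {t : H.Time} (ht : t.1 ≠ ⊤) : (Set.Iio t).Finite :=
  (finite_Iic_time ht).subset Set.Iio_subset_Iic_self

theorem sigmaAt_time_mono {s t : H.Time} (hst : s ≤ t) : sigmaAt ℱ s.1 ≤ sigmaAt ℱ t.1 :=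
  sigmaAt_mono ℱ hst

theorem measurable_discount {γ : H.Time → Ω → ℝ} (hγ : IsAdapted ℱ γ) {t : H.Time}
    (ht : t.1 ≠ ⊤) : Measurable[sigmaAt ℱ t.1] (discount γ t) := by
  have := (finite_Iio_time ht).fintype
  have h : discount γ t = fun ω => 1 - ∑ s : Set.Iio t, γ s ω := by
    ext ω; simp only [discount, tsum_fintype]
  rw [h]
  exact measurable_const.sub (Finset.measurable_sum _ fun s _ =>
    (hγ s).mono (sigmaAt_time_mono s.2.le) le_rfl)

/-- Total mass one turns the tail sum, which involves the future, into one minus a sum over the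
past. This makes the normalizing constant `ℱ_t`-measurable. -/
theorem tsum_Ici_eq_discount {γ : H.Time → Ω → ℝ} {ω : Ω} (h1 : HasSum (fun s => γ s ω) 1)
    (t : H.Time) : ∑' s : Set.Ici t, γ s ω = discount γ t ω := by
  have h := h1.summable.tsum_subtype_add_tsum_subtype_compl (Set.Iio t)
  rw [Set.compl_Iio, h1.tsum_eq] at h
  rw [discount, ← h]; ring

/-- The weights of the normalized restriction of `γ` to `𝕋_t`, in adapted form. -/
def weight (t : H.Time) (γ : H.Time → Ω → ℝ) (s : H.Time) (ω : Ω) : ℝ≥0∞ :=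
  if 0 < discount γ t ω then ENNReal.ofReal (γ s ω / discount γ t ω) else 0

theorem weight_ne_top (t : H.Time) (γ : H.Time → Ω → ℝ) (s : H.Time) (ω : Ω) :
    weight t γ s ω ≠ ⊤ := by
  unfold weight; split_ifs <;> simp

theorem measurable_weight {γ : H.Time → Ω → ℝ} (hγ : IsAdapted ℱ γ) {t s : H.Time}
    (ht : t.1 ≠ ⊤) (hts : t ≤ s) : Measurable[sigmaAt ℱ s.1] (weight t γ s) := by
  have hd := (measurable_discount hγ ht).mono (sigmaAt_time_mono (ℱ := ℱ) hts) le_rfl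
  have hd2 : MeasurableSet[sigmaAt ℱ s.1] {ω | 0 < discount γ t ω} := hd measurableSet_Ioi
  exact Measurable.ite hd2 ((hγ s).div hd).ennreal_ofReal measurable_const

/-- Where `D_t` is not positive, every `γ_s` with `s ≥ t` vanishes, so the default value `0` of the
weight does no harm. -/
theorem ofReal_eq_discount_mul_weight {γ : H.Time → Ω → ℝ} {ω : Ω} (h0 : ∀ s, 0 ≤ γ s ω)
    (h1 : HasSum (fun s => γ s ω) 1) {t s : H.Time} (hts : t ≤ s) :
    ENNReal.ofReal (γ s ω) = ENNReal.ofReal (discount γ t ω) * weight t γ s ω := by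
  unfold weight
  split_ifs with hd
  · rw [← ENNReal.ofReal_mul hd.le, mul_div_cancel₀ _ hd.ne']
  · rw [mul_zero, ENNReal.ofReal_eq_zero]
    have hs : Summable fun s : Set.Ici t => γ s ω :=
      h1.summable.comp_injective Subtype.val_injective
    have h2 := hs.le_tsum ⟨s, hts⟩ fun j _ => h0 j
    rw [tsum_Ici_eq_discount h1] at h2
    exact h2.trans (not_lt.1 hd)

theorem normRestr_eq {γ : H.Time → Ω → ℝ} {ω : Ω} (h0 : ∀ s, 0 ≤ γ s ω)
    (h1 : HasSum (fun s => γ s ω) 1) (t : H.Time) (s : Set.Ici t) :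
    normRestr t (fun j => γ j ω) s = γ s ω / discount γ t ω := by
  unfold normRestr
  rw [tsum_Ici_eq_discount h1]
  split_ifs with hd
  · rfl
  · have : discount γ t ω = 0 := by
      refine le_antisymm (not_lt.1 hd) ?_
      rw [← tsum_Ici_eq_discount h1]
      exact tsum_nonneg fun j => h0 j
    rw [this, div_zero]

theorem normRestr_eq_toReal_weight {γ : H.Time → Ω → ℝ} {ω : Ω} (h0 : ∀ s, 0 ≤ γ s ω)
    (h1 : HasSum (fun s => γ s ω) 1) (t : H.Time) (s : Set.Ici t) :
    normRestr t (fun j => γ j ω) s = (weight t γ s ω).toReal := by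
  rw [normRestr_eq h0 h1, weight]
  split_ifs with hd
  · rw [ENNReal.toReal_ofReal (div_nonneg (h0 _) hd.le)]
  · have : discount γ t ω = 0 := by
      refine le_antisymm (not_lt.1 hd) ?_
      rw [← tsum_Ici_eq_discount h1]
      exact tsum_nonneg fun j => h0 j
    simp [this]

theorem ofReal_discount_eq_tsum {γ : H.Time → Ω → ℝ} {ω : Ω} (h0 : ∀ s, 0 ≤ γ s ω)
    (h1 : HasSum (fun s => γ s ω) 1) (t : H.Time) :
    ∑' s : Set.Ici t, ENNReal.ofReal (γ s ω) = ENNReal.ofReal (discount γ t ω) := by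
  rw [← tsum_Ici_eq_discount h1]
  exact (ENNReal.ofReal_tsum_of_nonneg (fun j => h0 _)
    (h1.summable.comp_injective Subtype.val_injective)).symm

theorem tsum_weight {γ : H.Time → Ω → ℝ} {ω : Ω} (h0 : ∀ s, 0 ≤ γ s ω)
    (h1 : HasSum (fun s => γ s ω) 1) {t : H.Time} :
    ∑' s : Set.Ici t, weight t γ s ω = {ω | 0 < discount γ t ω}.indicator 1 ω := by
  by_cases hd : 0 < discount γ t ω
  · have h2 := ofReal_discount_eq_tsum h0 h1 t
    rw [tsum_congr fun s : Set.Ici t => ofReal_eq_discount_mul_weight h0 h1 s.2,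
      ENNReal.tsum_mul_left] at h2
    rw [Set.indicator_of_mem (by exact hd), Pi.one_apply]
    have h3 : ENNReal.ofReal (discount γ t ω) ≠ 0 := by simpa using hd
    exact (ENNReal.mul_eq_left h3 ENNReal.ofReal_ne_top).1 h2
  · simp [weight, hd]

theorem discount_pos {γ : H.Time → Ω → ℝ} {ω : Ω} (h0 : ∀ s, 0 ≤ γ s ω)
    (h1 : HasSum (fun s => γ s ω) 1) {t : H.Time} (ht : 0 < γ t ω) : 0 < discount γ t ω := by
  rw [← tsum_Ici_eq_discount h1]
  exact (h1.summable.comp_injective (Subtype.val_injective (p := (· ∈ Set.Ici t)))).tsum_pos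
    (fun j => h0 j) ⟨t, Set.self_mem_Ici⟩ ht

end Weights

/-! ### The optional product space -/

section OptSpace

theorem measurable_mk (s : H.Time) :
    Measurable[sigmaAt ℱ s.1] (fun ω => (⟨ω, s⟩ : OptSpace ℱ H)) := by
  refine @measurable_generateFrom _ _ (sigmaAt ℱ s.1) _ _ ?_
  rintro B ⟨j, A, hA, rfl⟩
  by_cases hj : s = j
  · subst hj
    convert hA using 1
    ext ω; simp [rect]
  · convert @MeasurableSet.empty _ (sigmaAt ℱ s.1)
    ext ω; simp [rect, hj]

theorem measurable_mk' (s : H.Time) : Measurable (fun ω => (⟨ω, s⟩ : OptSpace ℱ H)) :=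
  (measurable_mk s).mono (sigmaAt_le ℱ _) le_rfl

theorem lintegral_optMeasure {μ : H.Time → Ω → ℝ} (hμ : IsAdapted ℱ μ)
    {f : OptSpace ℱ H → ℝ≥0∞} (hf : Measurable f) :
    ∫⁻ z, f z ∂(optMeasure ℱ P μ) = ∑' s, ∫⁻ ω, ENNReal.ofReal (μ s ω) * f ⟨ω, s⟩ ∂P := by
  rw [optMeasure, lintegral_sum_measure]
  refine tsum_congr fun s => ?_
  rw [lintegral_map hf (measurable_mk' s)]
  exact lintegral_withDensity_eq_lintegral_mul _
    ((hμ s).mono (sigmaAt_le ℱ _) le_rfl).ennreal_ofReal (hf.comp (measurable_mk' s))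

theorem lintegral_optMeasure_eq_add {μ : H.Time → Ω → ℝ} (hμ : IsAdapted ℱ μ)
    {f : OptSpace ℱ H → ℝ≥0∞} (hf : Measurable f) (t : H.Time) :
    ∫⁻ z, f z ∂(optMeasure ℱ P μ) =
      ∑' s : Set.Iio t, ∫⁻ ω, ENNReal.ofReal (μ s ω) * f ⟨ω, s⟩ ∂P +
      ∑' s : Set.Ici t, ∫⁻ ω, ENNReal.ofReal (μ s ω) * f ⟨ω, s⟩ ∂P := by
  have h := Summable.tsum_add_tsum_compl (s := Set.Iio t)
    (f := fun s : H.Time => ∫⁻ ω, ENNReal.ofReal (μ s ω) * f ⟨ω, s⟩ ∂P)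
    ENNReal.summable ENNReal.summable
  rw [Set.compl_Iio] at h
  rw [lintegral_optMeasure hμ hf, ← h]

theorem isProbabilityMeasure_optMeasure [IsProbabilityMeasure P] {μ : H.Time → Ω → ℝ}
    (hμ : IsOptionalProb ℱ P μ) : IsProbabilityMeasure (optMeasure ℱ P μ) := by
  constructor
  rw [← lintegral_one, lintegral_optMeasure hμ.1 measurable_const]
  simp only [mul_one]
  rw [← lintegral_tsum fun s =>
    ((hμ.1 s).mono (sigmaAt_le ℱ _) le_rfl).ennreal_ofReal.aemeasurable]
  calc _ = ∫⁻ _, 1 ∂P := by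
        refine lintegral_congr_ae ?_
        filter_upwards [hμ.2] with ω h
        rw [← ENNReal.ofReal_tsum_of_nonneg h.1 h.2.summable, h.2.tsum_eq, ENNReal.ofReal_one]
    _ = 1 := by simp

theorem measurable_process {β : Type*} [MeasurableSpace β] {Z : H.Time → Ω → β}
    (hZ : ∀ s, Measurable[sigmaAt ℱ s.1] (Z s)) :
    Measurable (fun z : OptSpace ℱ H => Z z.time z.scen) := by
  intro S hS
  have : (fun z : OptSpace ℱ H => Z z.time z.scen) ⁻¹' S = ⋃ s, rect ℱ (Z s ⁻¹' S) {s} := by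
    ext z; simp [rect]
  rw [this]
  exact MeasurableSet.iUnion fun s => MeasurableSpace.measurableSet_generateFrom
    ⟨s, _, hZ s hS, rfl⟩

theorem optSigma_le (t : H.Time) :
    optSigma ℱ t ≤ instMeasurableSpaceOptSpace ℱ H := by
  refine MeasurableSpace.generateFrom_le ?_
  rintro B (⟨j, A, _, hA, rfl⟩ | ⟨A, hA, rfl⟩)
  · exact MeasurableSpace.measurableSet_generateFrom ⟨j, A, hA, rfl⟩
  · have : rect ℱ A (Set.Ici t) = ⋃ s : Set.Ici t, rect ℱ A {s.1} := by
      ext z; simp [rect]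
    rw [this]
    exact MeasurableSet.iUnion fun s => MeasurableSpace.measurableSet_generateFrom
      ⟨s, _, sigmaAt_time_mono s.2 _ hA, rfl⟩

/-- The generators `A × {j}` with `j < t` miss `𝕋_t` and the others are cylinders over it; this form
survives complements and countable unions. -/
theorem exists_slice_of_measurableSet_optSigma {t : H.Time} {B : Set (OptSpace ℱ H)}
    (hB : MeasurableSet[optSigma ℱ t] B) :
    ∃ A, MeasurableSet[sigmaAt ℱ t.1] A ∧ ∀ s, t ≤ s → ∀ ω, (⟨ω, s⟩ : OptSpace ℱ H) ∈ B ↔ ω ∈ A := by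
  induction B, hB using MeasurableSpace.generateFrom_induction with
  | hC B hB =>
    rcases hB with ⟨j, A, hj, hA, rfl⟩ | ⟨A, hA, rfl⟩
    · refine ⟨∅, @MeasurableSet.empty _ (sigmaAt ℱ t.1), fun s hs ω => ?_⟩
      simp [rect, (hj.trans_le hs).ne']
    · exact ⟨A, hA, fun s hs ω => by simp [rect, hs]⟩
  | empty => exact ⟨∅, @MeasurableSet.empty _ (sigmaAt ℱ t.1), by simp⟩
  | compl B _ ih =>
    obtain ⟨A, hA, h⟩ := ih
    exact ⟨Aᶜ, @MeasurableSet.compl _ _ (sigmaAt ℱ t.1) hA, fun s hs ω => by simp [h s hs]⟩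
  | iUnion f _ ih =>
    choose A hA h using ih
    exact ⟨⋃ n, A n, @MeasurableSet.iUnion _ _ (sigmaAt ℱ t.1) _ _ hA, fun s hs ω => by simp [h _ s hs]⟩

theorem measurable_optSigma {β : Type*} [MeasurableSpace β] {t : H.Time} {Z : H.Time → Ω → β}
    (hZ : ∀ s, Measurable[sigmaAt ℱ s.1] (Z s)) {v : Ω → β} (hv : Measurable[sigmaAt ℱ t.1] v) :
    Measurable[optSigma ℱ t]
      (fun z : OptSpace ℱ H => if z.time < t then Z z.time z.scen else v z.scen) := by
  intro S hS
  have : (fun z : OptSpace ℱ H => if z.time < t then Z z.time z.scen else v z.scen) ⁻¹' S =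
      (⋃ s : Set.Iio t, rect ℱ (Z s ⁻¹' S) {s.1}) ∪ rect ℱ (v ⁻¹' S) (Set.Ici t) := by
    ext z
    by_cases h : z.time < t
    · simp [rect, h]
    · simp [rect, h, not_lt.1 h]
  rw [this]
  refine @MeasurableSet.union _ (optSigma ℱ t) _ _ (@MeasurableSet.iUnion _ _ (optSigma ℱ t) _ _
    fun s => ?_) ?_
  · exact MeasurableSpace.measurableSet_generateFrom (Or.inl ⟨s, _, s.2, hZ s hS, rfl⟩)
  · exact MeasurableSpace.measurableSet_generateFrom (Or.inr ⟨_, hv hS, rfl⟩)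

/-- Since every `μ_s` is positive, a set null for `P ⊗ μ` has `P`-null sections at each of the
countably many times. -/
theorem ae_of_ae_optMeasure {μ : H.Time → Ω → ℝ} (hμ : IsAdapted ℱ μ)
    (hpos : ∀ᵐ ω ∂P, ∀ s, 0 < μ s ω) {p : OptSpace ℱ H → Prop}
    (h : ∀ᵐ z ∂(optMeasure ℱ P μ), p z) : ∀ᵐ ω ∂P, ∀ s, p ⟨ω, s⟩ := by
  rw [optMeasure, Measure.ae_sum_iff] at h
  have h1 : ∀ᵐ ω ∂P, ∀ s, ENNReal.ofReal (μ s ω) ≠ 0 → p ⟨ω, s⟩ := by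
    refine ae_all_iff.2 fun s => ?_
    have h2 := ae_of_ae_map (measurable_mk' s).aemeasurable (h s)
    rwa [ae_withDensity_iff ((hμ s).mono (sigmaAt_le ℱ _) le_rfl).ennreal_ofReal] at h2
  filter_upwards [h1, hpos] with ω h2 h3 s
  exact h2 s (by simpa using h3 s)

theorem ae_optMeasure_of_ae {μ : H.Time → Ω → ℝ} {p : OptSpace ℱ H → Prop}
    (hp : MeasurableSet {z | p z}) (h : ∀ s, ∀ᵐ ω ∂P, p ⟨ω, s⟩) :
    ∀ᵐ z ∂(optMeasure ℱ P μ), p z := by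
  rw [optMeasure, Measure.ae_sum_iff]
  intro s
  rw [ae_map_iff (measurable_mk' s).aemeasurable hp]
  exact withDensity_absolutelyContinuous _ _ |>.ae_le (h s)

/-- Conditional expectations on the optional product space, in terms of those on `Ω`. -/
theorem condLExp_optMeasure [IsProbabilityMeasure P] {μ : H.Time → Ω → ℝ}
    (hμ : IsOptionalProb ℱ P μ) {t : H.Time} (ht : t.1 ≠ ⊤) {Z : H.Time → Ω → ℝ≥0∞}
    (hZ : ∀ s, Measurable[sigmaAt ℱ s.1] (Z s)) :
    condLExp (optSigma ℱ t) (optMeasure ℱ P μ) (fun z => Z z.time z.scen)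
      =ᵐ[optMeasure ℱ P μ] fun z => if z.time < t then Z z.time z.scen else
        condLExp (sigmaAt ℱ t.1) P (fun ω => ∑' s : Set.Ici t, weight t μ s ω * Z s ω) z.scen := by
  have := isProbabilityMeasure_optMeasure hμ
  set W : Ω → ℝ≥0∞ := fun ω => ∑' s : Set.Ici t, weight t μ s ω * Z s ω with hW
  set v := condLExp (sigmaAt ℱ t.1) P W with hv
  have hZ' (s) : Measurable (Z s) := (hZ s).mono (sigmaAt_le ℱ _) le_rfl
  have hμ' (s) : Measurable (fun ω => ENNReal.ofReal (μ s ω)) :=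
    ((hμ.1 s).mono (sigmaAt_le ℱ _) le_rfl).ennreal_ofReal
  have hwm (s : Set.Ici t) : Measurable (weight t μ s) :=
    (measurable_weight hμ.1 ht s.2).mono (sigmaAt_le ℱ _) le_rfl
  have hWm : Measurable W := Measurable.tsum fun s => (hwm s).mul (hZ' s)
  have hvm : Measurable[sigmaAt ℱ t.1] v := measurable_condLExp _ _ _
  have hvm' : Measurable v := measurable_condLExp' _ _ _
  have hVm := measurable_optSigma hZ hvm
  refine (ae_eq_condLExp (optSigma_le t) _ _ hVm fun B hB => ?_).symm
  have hB' := optSigma_le t B hB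
  obtain ⟨A, hA, hAB⟩ := exists_slice_of_measurableSet_optSigma hB
  have hm1 := (hVm.mono (optSigma_le t) le_rfl).indicator hB'
  have hm2 := (measurable_process hZ).indicator hB'
  rw [← lintegral_indicator hB', ← lintegral_indicator hB',
    lintegral_optMeasure_eq_add hμ.1 hm1 t, lintegral_optMeasure_eq_add hμ.1 hm2 t]
  -- Before `t` the candidate equals `Z` itself. From `t` on, `B` is a cylinder `A × 𝕋_t`, and the
  -- weights sum to `D_t`.
  congr 1
  · refine tsum_congr fun s => lintegral_congr fun ω => ?_
    have hs : s.1 < t := s.2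
    congr 1
    by_cases hz : (⟨ω, s⟩ : OptSpace ℱ H) ∈ B <;> simp [hz, hs]
  · have h1 : ∀ (f : OptSpace ℱ H → ℝ≥0∞) (s : Set.Ici t) (ω : Ω),
        B.indicator f ⟨ω, s⟩ = A.indicator (fun ω => f ⟨ω, s⟩) ω := by
      intro f s ω
      by_cases hω : ω ∈ A
      · rw [Set.indicator_of_mem hω, Set.indicator_of_mem ((hAB s s.2 ω).2 hω)]
      · rw [Set.indicator_of_notMem hω, Set.indicator_of_notMem (mt (hAB s s.2 ω).1 hω)]
    have hnlt (s : Set.Ici t) : ¬ s.1 < t := not_lt.2 s.2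
    simp only [h1, hnlt, if_false]
    have hA' := sigmaAt_le ℱ _ _ hA
    have e1 := lintegral_tsum (μ := P)
      (f := fun (s : Set.Ici t) ω => ENNReal.ofReal (μ s ω) * A.indicator v ω)
      fun s => ((hμ' s).mul (hvm'.indicator hA')).aemeasurable
    have e2 := lintegral_tsum (μ := P)
      (f := fun (s : Set.Ici t) ω => ENNReal.ofReal (μ s ω) * A.indicator (Z s) ω)
      fun s => ((hμ' s).mul ((hZ' s).indicator hA')).aemeasurable
    refine e1.symm.trans (Eq.trans ?_ e2)
    -- Since `μ_s = D_t μ_s^t` for `s ≥ t` and `1_A D_t` is `ℱ_t`-measurable, the conditional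
    -- expectation may be exchanged for `W` under this factor.
    have hf : Measurable[sigmaAt ℱ t.1]
        (A.indicator fun ω => ENNReal.ofReal (discount μ t ω)) :=
      (measurable_discount hμ.1 ht).ennreal_ofReal.indicator hA
    have h2 := lintegral_mul_condLExp (sigmaAt_le ℱ t.1) (ν := P) hf hWm.aemeasurable
    rw [← hv] at h2
    calc _ = ∫⁻ ω, A.indicator (fun ω => ENNReal.ofReal (discount μ t ω)) ω * v ω ∂P := by
          refine lintegral_congr_ae ?_
          filter_upwards [hμ.2] with ω h
          rw [ENNReal.tsum_mul_right, ofReal_discount_eq_tsum h.1 h.2]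
          by_cases hω : ω ∈ A <;> simp [hω]
      _ = ∫⁻ ω, A.indicator (fun ω => ENNReal.ofReal (discount μ t ω)) ω * W ω ∂P := h2
      _ = _ := by
          refine lintegral_congr_ae ?_
          filter_upwards [hμ.2] with ω h
          by_cases hω : ω ∈ A
          · simp only [Set.indicator_of_mem hω, hW]
            rw [← ENNReal.tsum_mul_left]
            refine tsum_congr fun s => ?_
            rw [ofReal_eq_discount_mul_weight h.1 h.2 s.2, mul_assoc]
          · simp [hω]

end OptSpace

end ProcessRisk

namespace ProcessRisk

variable {Ω : Type*} {mΩ : MeasurableSpace Ω} {ℱ : Filtration ℕ mΩ} {P Q : Measure Ω} {H : Horizon}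

/-! ### The conditional entropic risk measure on the optional product space -/

section Entropic

theorem proj_mem_RInf {X : H.Time → Ω → ℝ} (hX : X ∈ RInf ℱ P H) (t : H.Time) :
    proj t X ∈ RInf ℱ P H := by
  obtain ⟨h1, C, hC⟩ := hX
  refine ⟨fun s => ?_, C, ?_⟩
  · by_cases hs : t ≤ s
    · have h : proj t X s = X s := by ext ω; simp [proj, hs]
      rw [h]; exact h1 s
    · have h : proj t X s = fun _ => 0 := by ext ω; simp [proj, hs]
      rw [h]; exact measurable_const
  · filter_upwards [hC] with ω h s
    by_cases hs : t ≤ s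
    · simpa [proj, hs] using h s
    · simpa [proj, hs] using (abs_nonneg _).trans (h s)

theorem RInfFrom_subset {t : H.Time} : RInfFrom ℱ P t ⊆ RInf ℱ P H := by
  rintro _ ⟨X, hX, rfl⟩
  exact proj_mem_RInf hX t

theorem mem_RInfFrom {t : H.Time} {X : H.Time → Ω → ℝ} (hX : X ∈ RInf ℱ P H)
    (h0 : ∀ s < t, X s = 0) : X ∈ RInfFrom ℱ P t := by
  refine ⟨X, hX, ?_⟩
  ext s ω
  by_cases hs : t ≤ s
  · simp [proj, hs]
  · simp [proj, hs, h0 s (not_le.1 hs)]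

/-- The weighted sum `∑_{s ∈ 𝕋_t} μ_s^t exp(-q X_s)`. -/
def expSum (t : H.Time) (μ : H.Time → Ω → ℝ) (q : Ω → ℝ) (X : H.Time → Ω → ℝ) (ω : Ω) : ℝ≥0∞ :=
  ∑' s : Set.Ici t, weight t μ s ω * ENNReal.ofReal (Real.exp (-q ω * X s ω))

theorem expSum_proj (t : H.Time) (μ : H.Time → Ω → ℝ) (q : Ω → ℝ) (X : H.Time → Ω → ℝ) :
    expSum t μ q (proj t X) = expSum t μ q X := by
  ext ω
  refine tsum_congr fun s => ?_
  have hs : t ≤ s.1 := s.2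
  simp [proj, hs]

/-- The risk measure for processes associated to the entropic one on the product space. -/
def entropicCond (ℱ : Filtration ℕ mΩ) (P : Measure Ω) (μ : H.Time → Ω → ℝ) (q : Ω → ℝ)
    (t : H.Time) (X : H.Time → Ω → ℝ) (ω : Ω) : ℝ :=
  1 / q ω * Real.log (condLExp (sigmaAt ℱ t.1) P (expSum t μ q X) ω).toReal

theorem ae_tsum_weight_eq_one {μ : H.Time → Ω → ℝ} (hμ : IsOptionalProb ℱ P μ)
    (hμ_pos : ∀ᵐ ω ∂P, ∀ s, 0 < μ s ω) (t : H.Time) :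
    ∀ᵐ ω ∂P, ∑' s : Set.Ici t, weight t μ s ω = 1 := by
  filter_upwards [hμ.2, hμ_pos] with ω h1 h2
  rw [tsum_weight h1.1 h1.2,
    Set.indicator_of_mem (show ω ∈ {ω | 0 < discount μ t ω} from discount_pos h1.1 h1.2 (h2 t)),
    Pi.one_apply]

theorem ae_expSum_bounds {μ : H.Time → Ω → ℝ} {t : H.Time}
    (hw : ∀ᵐ ω ∂P, ∑' s : Set.Ici t, weight t μ s ω = 1) {q : Ω → ℝ} {Cq : ℝ}
    (hq : ∀ᵐ ω ∂P, |q ω| ≤ Cq) {X : H.Time → Ω → ℝ} {C : ℝ}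
    (hX : ∀ᵐ ω ∂P, ∀ s, |X s ω| ≤ C) :
    ∀ᵐ ω ∂P, ENNReal.ofReal (Real.exp (-(Cq * C))) ≤ expSum t μ q X ω ∧
      expSum t μ q X ω ≤ ENNReal.ofReal (Real.exp (Cq * C)) := by
  filter_upwards [hw, hq, hX] with ω h1 h2 h3
  have h4 : ∀ s, |-q ω * X s ω| ≤ Cq * C := fun s => by
    rw [abs_mul, abs_neg]
    exact mul_le_mul h2 (h3 s) (abs_nonneg _) ((abs_nonneg _).trans h2)
  constructor
  · rw [← one_mul (ENNReal.ofReal _), ← h1, ← ENNReal.tsum_mul_right]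
    refine ENNReal.tsum_le_tsum fun s => ?_
    gcongr
    exact (abs_le.1 (h4 s)).1
  · rw [← one_mul (ENNReal.ofReal (Real.exp (Cq * C))), ← h1, ← ENNReal.tsum_mul_right]
    refine ENNReal.tsum_le_tsum fun s => mul_le_mul_right (ENNReal.ofReal_le_ofReal
      (Real.exp_le_exp.2 (abs_le.1 (h4 s)).2)) _

theorem measurable_expSum {μ : H.Time → Ω → ℝ} (hμ : IsAdapted ℱ μ) {t : H.Time} (ht : t.1 ≠ ⊤)
    {q : Ω → ℝ} (hq : Measurable[sigmaAt ℱ t.1] q) {X : H.Time → Ω → ℝ} (hX : IsAdapted ℱ X) :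
    Measurable (expSum t μ q X) := by
  refine Measurable.tsum fun s : Set.Ici t => ?_
  refine ((measurable_weight hμ ht s.2).mono (sigmaAt_le ℱ _) le_rfl).mul ?_
  exact (((hq.mono (sigmaAt_le ℱ _) le_rfl).neg.mul
    ((hX s).mono (sigmaAt_le ℱ _) le_rfl)).exp).ennreal_ofReal

theorem ae_condLExp_expSum_bounds [IsProbabilityMeasure P] {μ : H.Time → Ω → ℝ} {t : H.Time}
    (hw : ∀ᵐ ω ∂P, ∑' s : Set.Ici t, weight t μ s ω = 1) {q : Ω → ℝ} {Cq : ℝ}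
    (hq : ∀ᵐ ω ∂P, |q ω| ≤ Cq) {X : H.Time → Ω → ℝ} {C : ℝ}
    (hX : ∀ᵐ ω ∂P, ∀ s, |X s ω| ≤ C) :
    ∀ᵐ ω ∂P, ENNReal.ofReal (Real.exp (-(Cq * C))) ≤
        condLExp (sigmaAt ℱ t.1) P (expSum t μ q X) ω ∧
      condLExp (sigmaAt ℱ t.1) P (expSum t μ q X) ω ≤ ENNReal.ofReal (Real.exp (Cq * C)) := by
  have hb := ae_expSum_bounds hw hq hX
  have h1 := condLExp_mono (mΩ := sigmaAt ℱ t.1) (hb.mono fun ω h => h.1)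
  have h2 := condLExp_mono (mΩ := sigmaAt ℱ t.1) (hb.mono fun ω h => h.2)
  rw [condLExp_const (sigmaAt_le ℱ _)] at h1 h2
  filter_upwards [h1, h2] with ω h1 h2
  exact ⟨h1, h2⟩

theorem memLInf_entropicCond [IsProbabilityMeasure P] {μ : H.Time → Ω → ℝ}
    {t : H.Time} (hw : ∀ᵐ ω ∂P, ∑' s : Set.Ici t, weight t μ s ω = 1)
    {q : Ω → ℝ} (hq : MemLInf P (sigmaAt ℱ t.1) q)
    (hqi : MemLInf P (sigmaAt ℱ t.1) fun ω => (q ω)⁻¹)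
    {X : H.Time → Ω → ℝ} (hX : X ∈ RInf ℱ P H) :
    MemLInf P (sigmaAt ℱ t.1) (entropicCond ℱ P μ q t X) := by
  obtain ⟨hqm, Cq, hCq⟩ := hq
  obtain ⟨hqim, Ci, hCi⟩ := hqi
  obtain ⟨hXm, C, hC⟩ := hX
  refine ⟨(measurable_const.div hqm).mul (measurable_condLExp _ _ _).ennreal_toReal.log,
    Ci * (Cq * C), ?_⟩
  filter_upwards [hCi, ae_condLExp_expSum_bounds (ℱ := ℱ) hw hCq hC] with ω h1 h2
  rw [entropicCond, abs_mul, one_div]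
  refine mul_le_mul h1 ?_ (abs_nonneg _) ((abs_nonneg _).trans h1)
  set v := condLExp (sigmaAt ℱ t.1) P (expSum t μ q X) ω
  have hv : v ≠ ⊤ := ne_top_of_le_ne_top ENNReal.ofReal_ne_top h2.2
  have h3 := (ENNReal.ofReal_le_iff_le_toReal hv).1 h2.1
  have h4 := ENNReal.toReal_le_of_le_ofReal (Real.exp_pos _).le h2.2
  have h5 : 0 < v.toReal := (Real.exp_pos _).trans_le h3
  exact abs_le.2 ⟨(Real.le_log_iff_exp_le h5).2 h3, (Real.log_le_iff_le_exp h5).2 h4⟩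

/-- At `s < t` the conditional expectation is the exponential itself, with the same `r_s` inside and
outside, and the logarithm undoes it. From `t` on, the block formula `condLExp_optMeasure` applies
with `R_t = r_t`. -/
theorem entropicBar_ae_eq [IsProbabilityMeasure P] {μ : H.Time → Ω → ℝ}
    (hμ : IsOptionalProb ℱ P μ) {t : H.Time} (ht : t.1 ≠ ⊤) {r : H.Time → Ω → ℝ}
    (hr : ∀ s ≤ t, MemLInf P (sigmaAt ℱ s.1) (r s)) (hr_pos : ∀ s ≤ t, ∀ᵐ ω ∂P, 0 < r s ω)
    {X : H.Time → Ω → ℝ} (hX : X ∈ RInf ℱ P H) :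
    entropicBar ℱ P μ r t X =ᵐ[optMeasure ℱ P μ] fun z =>
      if z.time < t then -X z.time z.scen else entropicCond ℱ P μ (r t) t X z.scen := by
  have := isProbabilityMeasure_optMeasure hμ
  obtain ⟨hXm, C, hC⟩ := hX
  have hrm : ∀ s, Measurable[sigmaAt ℱ s.1] (r (min s t)) := fun s =>
    (hr _ (min_le_right s t)).1.mono (sigmaAt_time_mono (min_le_left s t)) le_rfl
  -- Only the finitely many `r_s` with `s ≤ t` occur. A common bound makes the exponential bounded,
  -- hence integrable, so real and Lebesgue conditional expectations agree.
  obtain ⟨K, hK⟩ : ∃ K : ℝ, ∀ s ≤ t, ∀ᵐ ω ∂P, |r s ω| ≤ K := by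
    have := (finite_Iic_time ht).to_subtype
    choose c hc using fun s : Set.Iic t => (hr s s.2).2
    obtain ⟨K, hK⟩ := (Set.finite_range c).bddAbove
    exact ⟨K, fun s hs => (hc ⟨s, hs⟩).mono fun ω h => h.trans (hK ⟨⟨s, hs⟩, rfl⟩)⟩
  set Z : H.Time → Ω → ℝ≥0∞ :=
    fun s ω => ENNReal.ofReal (Real.exp (-r (min s t) ω * X s ω)) with hZdef
  have hZ : ∀ s, Measurable[sigmaAt ℱ s.1] (Z s) := fun s =>
    ((hrm s).neg.mul (hXm s)).exp.ennreal_ofReal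
  have hZm := measurable_process hZ
  have hbound : ∀ᵐ z ∂(optMeasure ℱ P μ), Z z.time z.scen ≤ ENNReal.ofReal (Real.exp (K * C)) := by
    refine ae_optMeasure_of_ae (measurableSet_le hZm measurable_const) fun s => ?_
    filter_upwards [hC, hK _ (min_le_right s t)] with ω h1 h2
    refine ENNReal.ofReal_le_ofReal (Real.exp_le_exp.2 ?_)
    refine (le_abs_self _).trans ?_
    rw [abs_mul, abs_neg]
    exact mul_le_mul h2 (h1 s) (abs_nonneg _) ((abs_nonneg _).trans h2)
  have hfin : ∫⁻ z, Z z.time z.scen ∂(optMeasure ℱ P μ) ≠ ⊤ := by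
    refine ne_top_of_le_ne_top ENNReal.ofReal_ne_top
      ((lintegral_mono_ae hbound).trans (?_ : _ ≤ ENNReal.ofReal (Real.exp (K * C))))
    simp
  have hpos : ∀ᵐ z ∂(optMeasure ℱ P μ), 0 < r (min z.time t) z.scen := by
    refine ae_optMeasure_of_ae (p := fun z => 0 < r (min z.time t) z.scen)
      (measurableSet_lt measurable_const (measurable_process hrm)) fun s => ?_
    exact hr_pos _ (min_le_right s t)
  have h1 := toReal_condLExp (optSigma ℱ t) hZm.aemeasurable hfin
  have h2 : (fun z : OptSpace ℱ H => (Z z.time z.scen).toReal) =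
      fun y => Real.exp (-r (min y.time t) y.scen * X y.time y.scen) := by
    ext z; exact ENNReal.toReal_ofReal (Real.exp_pos _).le
  rw [h2] at h1
  have h3 : (fun ω => ∑' s : Set.Ici t, weight t μ s ω * Z s ω) = expSum t μ (r t) X := by
    ext ω
    refine tsum_congr fun s => ?_
    have hs : min s.1 t = t := min_eq_right s.2
    simp [Z, hs]
  have h4 := condLExp_optMeasure hμ ht hZ
  rw [h3] at h4
  filter_upwards [h1, h4, hpos] with z h5 h6 h7
  simp only [entropicBar]
  rw [← h5, h6]
  by_cases hz : z.time < t
  · rw [if_pos hz, if_pos hz]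
    have hm : min z.time t = z.time := min_eq_left hz.le
    simp only [Z, hm] at h7 ⊢
    rw [ENNReal.toReal_ofReal (Real.exp_pos _).le, Real.log_exp]
    field_simp
  · rw [if_neg hz, if_neg hz, min_eq_right (not_lt.1 hz), entropicCond]

theorem isAssociated_entropicCond [IsProbabilityMeasure P] {μ : H.Time → Ω → ℝ}
    (hμ : IsOptionalProb ℱ P μ) (hμ_pos : ∀ᵐ ω ∂P, ∀ s, 0 < μ s ω) {t : H.Time} (ht : t.1 ≠ ⊤)
    {r : H.Time → Ω → ℝ} (hr : ∀ s ≤ t, MemLInf P (sigmaAt ℱ s.1) (r s))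
    (hr_pos : ∀ s ≤ t, ∀ᵐ ω ∂P, 0 < r s ω)
    (hri : MemLInf P (sigmaAt ℱ t.1) fun ω => (r t ω)⁻¹) :
    IsAssociated ℱ P μ t (entropicBar ℱ P μ r t) (entropicCond ℱ P μ (r t) t) := by
  refine ⟨fun X hX => memLInf_entropicCond (ae_tsum_weight_eq_one hμ hμ_pos t) (hr t le_rfl) hri
    (RInfFrom_subset hX), fun X hX => ?_⟩
  refine (entropicBar_ae_eq hμ ht hr hr_pos hX).trans (.of_eq ?_)
  ext z
  simp only [entropicCond, expSum_proj]

/-- Uniqueness: the defining identity, read at the single time `t`, determines `ρ` up to `P`-null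
sets because `μ_t > 0`. -/
theorem IsAssociated.ae_eq_entropicCond [IsProbabilityMeasure P] {μ : H.Time → Ω → ℝ}
    (hμ : IsOptionalProb ℱ P μ) (hμ_pos : ∀ᵐ ω ∂P, ∀ s, 0 < μ s ω) {t : H.Time} (ht : t.1 ≠ ⊤)
    {r : H.Time → Ω → ℝ} (hr : ∀ s ≤ t, MemLInf P (sigmaAt ℱ s.1) (r s))
    (hr_pos : ∀ s ≤ t, ∀ᵐ ω ∂P, 0 < r s ω) {ρ : (H.Time → Ω → ℝ) → Ω → ℝ}
    (hρ : IsAssociated ℱ P μ t (entropicBar ℱ P μ r t) ρ) {X : H.Time → Ω → ℝ}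
    (hX : X ∈ RInfFrom ℱ P t) : ρ X =ᵐ[P] entropicCond ℱ P μ (r t) t X := by
  obtain ⟨Y, hY, rfl⟩ := hX
  filter_upwards [ae_of_ae_optMeasure hμ.1 hμ_pos
    ((hρ.2 Y hY).symm.trans (entropicBar_ae_eq hμ ht hr hr_pos hY))] with ω h
  simpa [entropicCond, expSum_proj] using h t

/-- The exponential of `q` times the risk in time is the weighted sum itself, since both use the
same `q`; what remains is a conditional expectation under `P`. -/
theorem entropicCond_ae_eq_entropicRV [IsProbabilityMeasure P] {μ : H.Time → Ω → ℝ}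
    (hμ : IsOptionalProb ℱ P μ) (hμ_pos : ∀ᵐ ω ∂P, ∀ s, 0 < μ s ω) {t : H.Time} (ht : t.1 ≠ ⊤)
    {q : Ω → ℝ} (hq : MemLInf P (sigmaAt ℱ t.1) q) (hq_pos : ∀ᵐ ω ∂P, 0 < q ω)
    {X : H.Time → Ω → ℝ} (hX : X ∈ RInf ℱ P H) :
    entropicCond ℱ P μ q t X =ᵐ[P] entropicRV ℱ P q t fun ω =>
      -entropicTime t (fun s => μ s ω) (q ω) (fun s => X s ω) := by
  have hw := ae_tsum_weight_eq_one hμ hμ_pos t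
  obtain ⟨hqm, Cq, hCq⟩ := hq
  obtain ⟨hXm, C, hC⟩ := hX
  have hb := ae_expSum_bounds hw hCq hC
  have hfin : ∫⁻ ω, expSum t μ q X ω ∂P ≠ ⊤ := by
    refine ne_top_of_le_ne_top ENNReal.ofReal_ne_top
      ((lintegral_mono_ae (hb.mono fun ω h => h.2)).trans
        (?_ : _ ≤ ENNReal.ofReal (Real.exp (Cq * C))))
    simp
  have h1 := toReal_condLExp (sigmaAt ℱ t.1) (measurable_expSum hμ.1 ht hqm hXm).aemeasurable hfin
  have h2 : (fun ω => (expSum t μ q X ω).toReal) =ᵐ[P] fun ω =>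
      Real.exp (-q ω * -entropicTime t (fun s => μ s ω) (q ω) (fun s => X s ω)) := by
    filter_upwards [hb, hμ.2, hq_pos] with ω h3 h4 h5
    have h6 : (expSum t μ q X ω).toReal =
        ∑' s : Set.Ici t, Real.exp (-q ω * X s ω) * normRestr t (fun s => μ s ω) s := by
      rw [expSum, ENNReal.tsum_toReal_eq fun s => ENNReal.mul_ne_top (weight_ne_top _ _ _ _)
        ENNReal.ofReal_ne_top]
      refine tsum_congr fun s => ?_
      rw [ENNReal.toReal_mul, ENNReal.toReal_ofReal (Real.exp_pos _).le,
        normRestr_eq_toReal_weight h4.1 h4.2, mul_comm]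
    have h7 : 0 < (expSum t μ q X ω).toReal := by
      refine ENNReal.toReal_pos ?_ (ne_top_of_le_ne_top ENNReal.ofReal_ne_top h3.2)
      exact ((ENNReal.ofReal_pos.2 (Real.exp_pos _)).trans_le h3.1).ne'
    rw [entropicTime, ← h6]
    have h8 : -q ω * -(1 / q ω * Real.log (expSum t μ q X ω).toReal) =
        Real.log (expSum t μ q X ω).toReal := by field_simp
    rw [h8, Real.exp_log h7]
  filter_upwards [h1.trans (condExp_congr_ae h2)] with ω h3
  rw [entropicCond, entropicRV, h3]

/-- The acceptance set, in terms of conditional exponential moments. -/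
theorem entropicCond_nonpos_iff [IsProbabilityMeasure P] {μ : H.Time → Ω → ℝ}
    (hμ : IsOptionalProb ℱ P μ) (hμ_pos : ∀ᵐ ω ∂P, ∀ s, 0 < μ s ω) {t : H.Time}
    {q : Ω → ℝ} (hq : MemLInf P (sigmaAt ℱ t.1) q) (hq_pos : ∀ᵐ ω ∂P, 0 < q ω)
    {X : H.Time → Ω → ℝ} (hX : X ∈ RInf ℱ P H) :
    entropicCond ℱ P μ q t X ≤ᵐ[P] 0 ↔
      condLExp (sigmaAt ℱ t.1) P (expSum t μ q X) ≤ᵐ[P] 1 := by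
  have hw := ae_tsum_weight_eq_one hμ hμ_pos t
  obtain ⟨hqm, Cq, hCq⟩ := hq
  obtain ⟨hXm, C, hC⟩ := hX
  refine eventually_congr ?_
  filter_upwards [ae_condLExp_expSum_bounds (ℱ := ℱ) hw hCq hC, hq_pos] with ω h1 h2
  have hv := ne_top_of_le_ne_top ENNReal.ofReal_ne_top h1.2
  rw [entropicCond, Pi.zero_apply, Pi.one_apply, mul_nonpos_iff_pos_imp_nonpos]
  have h3 : 0 < 1 / q ω := by positivity
  rw [← ENNReal.toReal_le_toReal hv ENNReal.one_ne_top, ENNReal.toReal_one,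
    ← Real.log_nonpos_iff ENNReal.toReal_nonneg]
  constructor
  · exact fun h => h.1 h3
  · exact fun h => ⟨fun _ => h, fun h' => h3.le⟩

end Entropic

end ProcessRisk

namespace ProcessRisk

/-! ### Pointwise inequalities for relative entropies -/

section Pointwise

/-- The positive part of the logarithm. -/
def posLog (x : ℝ≥0∞) : ℝ≥0∞ := (ENNReal.log x).toENNReal

/-- The negative part of the logarithm. -/
def negLog (x : ℝ≥0∞) : ℝ≥0∞ := (-ENNReal.log x).toENNReal

theorem measurable_posLog : Measurable posLog :=
  ENNReal.measurable_log.ereal_toENNReal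

theorem measurable_negLog : Measurable negLog :=
  (continuous_neg.measurable.comp ENNReal.measurable_log).ereal_toENNReal

theorem posLog_ofReal {x : ℝ} (hx : 0 < x) :
    posLog (ENNReal.ofReal x) = ENNReal.ofReal (max (Real.log x) 0) := by
  rw [posLog, ENNReal.log_ofReal_of_pos hx, EReal.real_coe_toENNReal]
  rcases le_total (Real.log x) 0 with h | h
  · rw [max_eq_right h, ENNReal.ofReal_of_nonpos h, ENNReal.ofReal_zero]
  · rw [max_eq_left h]

theorem negLog_ofReal {x : ℝ} (hx : 0 < x) :
    negLog (ENNReal.ofReal x) = ENNReal.ofReal (max (-Real.log x) 0) := by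
  rw [negLog, ENNReal.log_ofReal_of_pos hx, ← EReal.coe_neg, EReal.real_coe_toENNReal]
  rcases le_total (-Real.log x) 0 with h | h
  · rw [max_eq_right h, ENNReal.ofReal_of_nonpos h, ENNReal.ofReal_zero]
  · rw [max_eq_left h]

theorem ofReal_eq_ofReal_max (a : ℝ) : ENNReal.ofReal a = ENNReal.ofReal (max a 0) := by
  rcases le_total a 0 with h | h
  · rw [max_eq_right h, ENNReal.ofReal_of_nonpos h, ENNReal.ofReal_zero]
  · rw [max_eq_left h]

theorem exists_ofReal_eq {x : ℝ≥0∞} (h0 : x ≠ 0) (h : x ≠ ⊤) :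
    ∃ y : ℝ, 0 < y ∧ x = ENNReal.ofReal y :=
  ⟨x.toReal, ENNReal.toReal_pos h0 h, (ENNReal.ofReal_toReal h).symm⟩

/-- This is `g log (g m / u) = g log m + u klFun (g / u) + g - u`, from `klFun x = x log x + 1 - x`,
with all negative terms moved across so that it makes sense in `[0, ∞]`. It separates the entropy in
time from the density process. -/
theorem mul_posLog_add_eq {g u m : ℝ≥0∞} (hg : g ≠ ⊤) (hu : u ≠ ⊤)
    (h : g ≠ 0 → u ≠ 0 ∧ m ≠ 0 ∧ m ≠ ⊤) :
    g * posLog (g / u * m) + g * negLog m + u =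
      g * negLog (g / u * m) + g * posLog m +
        u * ENNReal.ofReal (InformationTheory.klFun (g.toReal / u.toReal)) + g := by
  -- Here the logarithmic terms vanish, and `klFun 0 = 1` leaves `u` on both sides.
  by_cases hg0 : g = 0
  · simp [hg0, InformationTheory.klFun_zero]
  obtain ⟨hu0, hm0, hm⟩ := h hg0
  obtain ⟨x, hx, rfl⟩ := exists_ofReal_eq hg0 hg
  obtain ⟨y, hy, rfl⟩ := exists_ofReal_eq hu0 hu
  obtain ⟨z, hz, rfl⟩ := exists_ofReal_eq hm0 hm
  have hxy : 0 < x / y * z := by positivity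
  have hk := InformationTheory.klFun_nonneg (div_nonneg hx.le hy.le)
  rw [← ENNReal.ofReal_div_of_pos hy, ← ENNReal.ofReal_mul (p := x / y) (by positivity), posLog_ofReal hxy,
    negLog_ofReal hxy, posLog_ofReal hz, negLog_ofReal hz, ENNReal.toReal_ofReal hx.le,
    ENNReal.toReal_ofReal hy.le]
  simp only [← ENNReal.ofReal_mul hx.le, ← ENNReal.ofReal_mul hy.le]
  rw [← ENNReal.ofReal_add (by positivity) (by positivity),
    ← ENNReal.ofReal_add (by positivity) (by positivity),
    ← ENNReal.ofReal_add (by positivity) (by positivity),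
    ← ENNReal.ofReal_add (by positivity) (by positivity),
    ← ENNReal.ofReal_add (by positivity) (by positivity)]
  congr 1
  have e1 : ∀ a : ℝ, max a 0 = a + max (-a) 0 := fun a => by
    rcases le_total a 0 with h | h
    · rw [max_eq_right h, max_eq_left (by linarith)]; ring
    · rw [max_eq_left h, max_eq_right (by linarith)]; ring
  rw [e1 (Real.log (x / y * z)), e1 (Real.log z), InformationTheory.klFun_apply,
    Real.log_mul (by positivity) hz.ne']
  field_simp
  ring

/-- With `J = (g / u) m`, this is `a - log J + 1 ≤ exp (a - log J)` multiplied by `g`, because `g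
exp(a) / J = u exp(a) / m`. Signed terms are again split into parts. -/
theorem young_le {g u m : ℝ≥0∞} (hg : g ≠ ⊤) (hu : u ≠ ⊤)
    (h : g ≠ 0 → u ≠ 0 ∧ m ≠ 0 ∧ m ≠ ⊤) (a : ℝ) :
    g * ENNReal.ofReal a + g * negLog (g / u * m) + g ≤
      g * ENNReal.ofReal (-a) + g * posLog (g / u * m) + u * ENNReal.ofReal (Real.exp a) * m⁻¹ := by
  by_cases hg0 : g = 0
  · simp [hg0]
  obtain ⟨hu0, hm0, hm⟩ := h hg0
  obtain ⟨x, hx, rfl⟩ := exists_ofReal_eq hg0 hg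
  obtain ⟨y, hy, rfl⟩ := exists_ofReal_eq hu0 hu
  obtain ⟨z, hz, rfl⟩ := exists_ofReal_eq hm0 hm
  have hxy : 0 < x / y * z := by positivity
  rw [← ENNReal.ofReal_div_of_pos hy, ← ENNReal.ofReal_mul (p := x / y) (by positivity), posLog_ofReal hxy,
    negLog_ofReal hxy, ofReal_eq_ofReal_max a, ofReal_eq_ofReal_max (-a),
    ← ENNReal.ofReal_inv_of_pos hz]
  have hexp := Real.exp_pos a
  simp only [← ENNReal.ofReal_mul hx.le, ← ENNReal.ofReal_mul hy.le]
  rw [← ENNReal.ofReal_mul (by positivity), ← ENNReal.ofReal_add (by positivity) (by positivity),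
    ← ENNReal.ofReal_add (by positivity) (by positivity),
    ← ENNReal.ofReal_add (by positivity) (by positivity),
    ← ENNReal.ofReal_add (by positivity) (by positivity)]
  refine ENNReal.ofReal_le_ofReal ?_
  have e1 : ∀ a : ℝ, max a 0 = a + max (-a) 0 := fun a => by
    rcases le_total a 0 with h | h
    · rw [max_eq_right h, max_eq_left (by linarith)]; ring
    · rw [max_eq_left h, max_eq_right (by linarith)]; ring
  rw [e1 a, e1 (Real.log (x / y * z))]
  have h1 := Real.add_one_le_exp (a - Real.log (x / y * z))
  rw [Real.exp_sub, Real.exp_log hxy] at h1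
  have h2 := mul_le_mul_of_nonneg_left h1 hx.le
  have h3 : x * (Real.exp a / (x / y * z)) = y * Real.exp a * z⁻¹ := by field_simp
  rw [h3] at h2
  nlinarith

/-- From `-log x ≤ 1 / x` at `x = g m / u`. The bound no longer contains `g`, so it can be
integrated by changing measure. -/
theorem mul_negLog_le {g u m : ℝ≥0∞} (hg : g ≠ ⊤) (hu : u ≠ ⊤)
    (h : g ≠ 0 → u ≠ 0 ∧ m ≠ 0 ∧ m ≠ ⊤) : g * negLog (g / u * m) ≤ u * m⁻¹ := by
  by_cases hg0 : g = 0
  · simp [hg0]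
  obtain ⟨hu0, hm0, hm⟩ := h hg0
  obtain ⟨x, hx, rfl⟩ := exists_ofReal_eq hg0 hg
  obtain ⟨y, hy, rfl⟩ := exists_ofReal_eq hu0 hu
  obtain ⟨z, hz, rfl⟩ := exists_ofReal_eq hm0 hm
  have hxy : 0 < x / y * z := by positivity
  rw [← ENNReal.ofReal_div_of_pos hy, ← ENNReal.ofReal_mul (p := x / y) (by positivity), negLog_ofReal hxy,
    ← ENNReal.ofReal_inv_of_pos hz, ← ENNReal.ofReal_mul hx.le, ← ENNReal.ofReal_mul hy.le]
  refine ENNReal.ofReal_le_ofReal ?_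
  have h1 : max (-Real.log (x / y * z)) 0 ≤ (x / y * z)⁻¹ := by
    refine max_le ?_ (by positivity)
    rw [← Real.log_inv]
    exact (Real.log_le_sub_one_of_pos (by positivity)).trans (by linarith)
  calc x * max (-Real.log (x / y * z)) 0 ≤ x * (x / y * z)⁻¹ := by gcongr
    _ = y * z⁻¹ := by field_simp

/-- The truncation of `x` to the interval `[c⁻¹, c]`. -/
def clip (c : ℝ) (x : ℝ≥0∞) : ℝ≥0∞ := max (min x (ENNReal.ofReal c)) (ENNReal.ofReal c⁻¹)

theorem measurable_clip (c : ℝ) : Measurable (clip c) :=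
  (measurable_id.min measurable_const).max measurable_const

theorem clip_le {c : ℝ} (hc : 1 ≤ c) (x : ℝ≥0∞) : clip c x ≤ ENNReal.ofReal c :=
  max_le (min_le_right _ _) (ENNReal.ofReal_le_ofReal ((inv_le_one_of_one_le₀ hc).trans hc))

theorem clip_ne_top {c : ℝ} (hc : 1 ≤ c) (x : ℝ≥0∞) : clip c x ≠ ⊤ :=
  ne_top_of_le_ne_top ENNReal.ofReal_ne_top (clip_le hc x)

theorem inv_le_toReal_clip {c : ℝ} (hc : 1 ≤ c) (x : ℝ≥0∞) : c⁻¹ ≤ (clip c x).toReal :=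
  (ENNReal.ofReal_le_iff_le_toReal (clip_ne_top hc x)).1 (le_max_right _ _)

theorem toReal_clip_pos {c : ℝ} (hc : 1 ≤ c) (x : ℝ≥0∞) : 0 < (clip c x).toReal :=
  (inv_pos.2 (zero_lt_one.trans_le hc)).trans_le (inv_le_toReal_clip hc x)

theorem clip_le_add (c : ℝ) (x : ℝ≥0∞) : clip c x ≤ x + ENNReal.ofReal c⁻¹ :=
  max_le ((min_le_left _ _).trans le_self_add) le_add_self

theorem abs_log_clip_le {c : ℝ} (hc : 1 ≤ c) (x : ℝ≥0∞) :
    |Real.log (clip c x).toReal| ≤ Real.log c := by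
  have hc0 : 0 < c := zero_lt_one.trans_le hc
  rw [abs_le, ← Real.log_inv]
  exact ⟨Real.log_le_log (inv_pos.2 hc0) (inv_le_toReal_clip hc x),
    Real.log_le_log (toReal_clip_pos hc x) (ENNReal.toReal_le_of_le_ofReal hc0.le (clip_le hc x))⟩

/-- For `x ≥ 1` clipping only caps the logarithm at `log c`. For `x ≤ 1` the left side is zero and
`clip c x ≥ x`, so the negative part of `log x` compensates. -/
theorem min_log_le_log_clip {c : ℝ} (hc : 1 ≤ c) {x : ℝ} (hx : 0 < x) :
    min (max (Real.log x) 0) (Real.log c) ≤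
      Real.log (clip c (ENNReal.ofReal x)).toReal + max (-Real.log x) 0 := by
  have hc0 : 0 < c := zero_lt_one.trans_le hc
  have h1 : Real.log (min x c) ≤ Real.log (clip c (ENNReal.ofReal x)).toReal := by
    refine Real.log_le_log (lt_min hx hc0) ?_
    rw [← ENNReal.ofReal_le_iff_le_toReal (clip_ne_top hc _), ENNReal.ofReal_min]
    exact le_max_left _ _
  rcases le_total x 1 with h | h
  · have h2 := Real.log_nonpos hx.le h
    rw [min_eq_left (h.trans hc)] at h1
    rw [max_eq_right h2, max_eq_left (by linarith), min_eq_left (Real.log_nonneg hc)]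
    linarith
  · have h2 := Real.log_nonneg h
    rw [max_eq_left h2, max_eq_right (by linarith), add_zero]
    refine le_trans ?_ h1
    rcases le_total x c with h3 | h3
    · rw [min_eq_left h3]; exact min_le_left _ _
    · rw [min_eq_right h3]; exact min_le_right _ _

/-- The bound `min_log_le_log_clip` for the clipped logarithm lowered by `δ`, in subtraction-free
form. It controls the value of the penalty functional at a near-optimal process. -/
theorem mul_min_posLog_le {g x : ℝ≥0∞} (h : g ≠ 0 → x ≠ 0 ∧ x ≠ ⊤) {c : ℝ}
    (hc : 1 ≤ c) {δ : ℝ} (hδ : 0 ≤ δ) :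
    g * ENNReal.ofReal (-(Real.log (clip c x).toReal - δ)) +
        g * min (posLog x) (ENNReal.ofReal (Real.log c)) ≤
      g * ENNReal.ofReal (Real.log (clip c x).toReal - δ) + g * negLog x +
        g * ENNReal.ofReal δ := by
  by_cases hg0 : g = 0
  · simp [hg0]
  obtain ⟨hx0, hxt⟩ := h hg0
  obtain ⟨x, hx, rfl⟩ := exists_ofReal_eq hx0 hxt
  rw [← mul_add, ← mul_add, ← mul_add]
  refine mul_le_mul_right ?_ _
  have h1 := min_log_le_log_clip hc hx
  set b := Real.log (clip c (ENNReal.ofReal x)).toReal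
  rw [posLog_ofReal hx, negLog_ofReal hx, ← ENNReal.ofReal_min, ofReal_eq_ofReal_max (-(b - δ)),
    ofReal_eq_ofReal_max (b - δ)]
  have h2 : 0 ≤ min (max (Real.log x) 0) (Real.log c) :=
    le_min (le_max_right _ _) (Real.log_nonneg hc)
  rw [← ENNReal.ofReal_add (by positivity) h2, ← ENNReal.ofReal_add (by positivity) (by positivity),
    ← ENNReal.ofReal_add (by positivity) hδ]
  refine ENNReal.ofReal_le_ofReal ?_
  have e1 : max (b - δ) 0 = (b - δ) + max (-(b - δ)) 0 := by
    rcases le_total (b - δ) 0 with h | h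
    · rw [max_eq_right h, max_eq_left (by linarith)]; ring
    · rw [max_eq_left h, max_eq_right (by linarith)]; ring
  rw [e1]
  linarith

end Pointwise

/-! ### Relative entropies of weights on a countable set -/

section KL

variable {H : Horizon} {t : H.Time}

instance : DiscreteMeasurableSpace H.Time := ⟨fun _ => trivial⟩

theorem lintegral_weightMeasure (w : Set.Ici t → ℝ) (f : Set.Ici t → ℝ≥0∞) :
    ∫⁻ s, f s ∂(weightMeasure w) = ∑' s, ENNReal.ofReal (w s) * f s := by
  rw [weightMeasure, lintegral_sum_measure]
  refine tsum_congr fun s => ?_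
  rw [lintegral_smul_measure, lintegral_dirac, smul_eq_mul]

theorem weightMeasure_eq_withDensity {w v : Set.Ici t → ℝ} (hv : ∀ s, 0 ≤ v s)
    (h : ∀ s, v s = 0 → w s = 0) :
    weightMeasure w = (weightMeasure v).withDensity fun s => ENNReal.ofReal (w s / v s) := by
  ext B hB
  rw [withDensity_apply _ hB, ← lintegral_indicator hB, lintegral_weightMeasure,
    ← lintegral_indicator_one hB, lintegral_weightMeasure]
  refine tsum_congr fun s => ?_
  by_cases hs : s ∈ B
  · rw [Set.indicator_of_mem hs, Set.indicator_of_mem hs, Pi.one_apply, mul_one,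
      ← ENNReal.ofReal_mul (hv s)]
    by_cases h0 : v s = 0
    · simp [h s h0]
    · rw [mul_div_cancel₀ _ h0]
  · simp [hs]

theorem isFiniteMeasure_weightMeasure {w : Set.Ici t → ℝ}
    (hw : ∑' s, ENNReal.ofReal (w s) ≠ ⊤) : IsFiniteMeasure (weightMeasure w) := by
  constructor
  rw [← setLIntegral_one, Measure.restrict_univ, lintegral_weightMeasure]
  simpa using hw.lt_top

/-- Vanishing of `w` wherever `v` vanishes is absolute continuity here, with the explicit density `w
/ v`, so the `klFun` form of the divergence applies. -/
theorem klDiv_weightMeasure {w v : Set.Ici t → ℝ} (hw0 : ∀ s, 0 ≤ w s) (hv0 : ∀ s, 0 ≤ v s)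
    (hw : ∑' s, ENNReal.ofReal (w s) ≠ ⊤) (hv : ∑' s, ENNReal.ofReal (v s) ≠ ⊤)
    (h : ∀ s, v s = 0 → w s = 0) :
    InformationTheory.klDiv (weightMeasure w) (weightMeasure v) =
      ∑' s, ENNReal.ofReal (v s) * ENNReal.ofReal (InformationTheory.klFun (w s / v s)) := by
  have := isFiniteMeasure_weightMeasure hw
  have := isFiniteMeasure_weightMeasure hv
  have h1 := weightMeasure_eq_withDensity hv0 h
  have hac : weightMeasure w ≪ weightMeasure v := by
    rw [h1]; exact withDensity_absolutelyContinuous _ _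
  rw [InformationTheory.klDiv_eq_lintegral_klFun_of_ac hac, ← lintegral_weightMeasure]
  refine lintegral_congr_ae ?_
  have h2 : (weightMeasure w).rnDeriv (weightMeasure v) =ᵐ[weightMeasure v]
      fun s => ENNReal.ofReal (w s / v s) := by
    conv_lhs => rw [h1]
    exact Measure.rnDeriv_withDensity _ (Measurable.of_discrete)
  filter_upwards [h2] with s hs
  rw [hs, ENNReal.toReal_ofReal (div_nonneg (hw0 s) (hv0 s))]

end KL

end ProcessRisk

namespace ProcessRisk

variable {Ω : Type*} {mΩ : MeasurableSpace Ω} {ℱ : Filtration ℕ mΩ} {P Q : Measure Ω} {H : Horizon}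

/-! ### Densities of `Q ⊗ γ` with respect to `P ⊗ μ`, conditionally on `ℱ_t` -/

section Densities

/-- The hypotheses on `Q` and `γ` under which the penalty is computed. -/
structure PenaltyHyp (ℱ : Filtration ℕ mΩ) (P Q : Measure Ω) (μ γ : H.Time → Ω → ℝ)
    (t : H.Time) : Prop where
  locAC : IsLocAC ℱ H P Q
  ne_top : t.1 ≠ ⊤
  optP : IsOptionalProb ℱ P μ
  pos : ∀ᵐ ω ∂P, ∀ s, 0 < μ s ω
  optQ : IsOptionalProb ℱ Q μ
  mem : γ ∈ Gam ℱ P Q H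

/-- The density `M_s / M_t`. -/
def ratio (ℱ : Filtration ℕ mΩ) (P Q : Measure Ω) (t s : H.Time) (ω : Ω) : ℝ≥0∞ :=
  densityProc ℱ P Q s.1 ω / densityProc ℱ P Q t.1 ω

/-- The density `(γ_s^t M_s) / (μ_s^t M_t)`. -/
def jointDensity (ℱ : Filtration ℕ mΩ) (P Q : Measure Ω) (μ γ : H.Time → Ω → ℝ) (t s : H.Time)
    (ω : Ω) : ℝ≥0∞ :=
  weight t γ s ω / weight t μ s ω * ratio ℱ P Q t s ω

theorem measurable_ratio {t s : H.Time} (hts : t ≤ s) :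
    Measurable[sigmaAt ℱ s.1] (ratio ℱ P Q t s) :=
  (measurable_densityProc ℱ P Q s.1).div
    ((measurable_densityProc ℱ P Q t.1).mono (sigmaAt_time_mono hts) le_rfl)

/-- On `ℱ_s` the part of `Q` on `{M_s ≠ ∞}` is `M_s P`, so it ignores `P`-null sets. The exception
matters at `s = ∞`, where `Q` may have a singular part. -/
theorem ae_of_ae_of_locAC [IsFiniteMeasure P] [IsFiniteMeasure Q] (h : IsLocAC ℱ H P Q)
    (s : H.Time) {p : Ω → Prop} (hp : MeasurableSet[sigmaAt ℱ s.1] {ω | p ω})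
    (hP : ∀ᵐ ω ∂P, p ω) : ∀ᵐ ω ∂Q, densityProc ℱ P Q s.1 ω ≠ ⊤ → p ω := by
  have hM := measurable_densityProc ℱ P Q s.1
  have hS : MeasurableSet[sigmaAt ℱ s.1] {ω | densityProc ℱ P Q s.1 ω ≠ ⊤} :=
    @MeasurableSet.compl _ _ (sigmaAt ℱ s.1) (hM (measurableSet_singleton ⊤))
  have hpc := @MeasurableSet.compl _ _ (sigmaAt ℱ s.1) hp
  have h1 := lintegral_mul_densityProc h s ((measurable_const (a := (1 : ℝ≥0∞))).indicator hpc)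
  have h2 : ∫⁻ ω, {ω | p ω}ᶜ.indicator (fun _ => (1 : ℝ≥0∞)) ω * densityProc ℱ P Q s.1 ω ∂P = 0 := by
    rw [← lintegral_zero (μ := P)]
    refine lintegral_congr_ae ?_
    filter_upwards [hP] with ω hω
    simp [hω]
  rw [h2, Set.indicator_indicator, lintegral_indicator_const
    (sigmaAt_le ℱ _ _ (@MeasurableSet.inter _ (sigmaAt ℱ s.1) _ _ hS hpc)), one_mul] at h1
  rw [ae_iff]
  convert h1.symm using 2
  ext ω; simp

theorem ae_densityProc_time_ne_top [IsFiniteMeasure P] [IsFiniteMeasure Q] (h : IsLocAC ℱ H P Q)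
    {s : H.Time} (hs : s.1 ≠ ⊤) : ∀ᵐ ω ∂Q, densityProc ℱ P Q s.1 ω ≠ ⊤ := by
  obtain ⟨n, hn⟩ := ENat.ne_top_iff_exists.1 hs
  have := ae_densityProc_coe_ne_top (P := P) (Q := Q) h (n := n) (by rw [hn]; exact s.2)
  rwa [hn] at this

theorem ae_of_ae_of_locAC' [IsFiniteMeasure P] [IsFiniteMeasure Q] (h : IsLocAC ℱ H P Q)
    {s : H.Time} (hs : s.1 ≠ ⊤) {p : Ω → Prop} (hp : MeasurableSet[sigmaAt ℱ s.1] {ω | p ω})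
    (hP : ∀ᵐ ω ∂P, p ω) : ∀ᵐ ω ∂Q, p ω := by
  filter_upwards [ae_of_ae_of_locAC h s hp hP, ae_densityProc_time_ne_top h hs] with ω h1 h2
  exact h1 h2

variable {μ γ : H.Time → Ω → ℝ} {t : H.Time}

namespace PenaltyHyp

theorem measurable_weight_left (h : PenaltyHyp ℱ P Q μ γ t) {s : H.Time} (hts : t ≤ s) :
    Measurable[sigmaAt ℱ s.1] (weight t μ s) := measurable_weight h.optP.1 h.ne_top hts

theorem measurable_weight_right (h : PenaltyHyp ℱ P Q μ γ t) {s : H.Time} (hts : t ≤ s) :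
    Measurable[sigmaAt ℱ s.1] (weight t γ s) := measurable_weight h.mem.1.1 h.ne_top hts

theorem measurable_jointDensity (h : PenaltyHyp ℱ P Q μ γ t) {s : H.Time} (hts : t ≤ s) :
    Measurable[sigmaAt ℱ s.1] (jointDensity ℱ P Q μ γ t s) :=
  ((h.measurable_weight_right hts).div (h.measurable_weight_left hts)).mul (measurable_ratio hts)

theorem ae_weight_ne_zero (h : PenaltyHyp ℱ P Q μ γ t) :
    ∀ᵐ ω ∂P, ∀ s : Set.Ici t, weight t μ s ω ≠ 0 := by
  filter_upwards [h.optP.2, h.pos] with ω h1 h2 s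
  have hd := discount_pos h1.1 h1.2 (h2 t)
  rw [weight, if_pos hd]
  simpa using div_pos (h2 s) hd

/-- At finite times `M_s = ∞` is a `Q`-null event; at `∞` this is the extra condition in `Γ(Q)`. -/
theorem ae_weight_eq_zero (h : PenaltyHyp ℱ P Q μ γ t) [IsFiniteMeasure P] [IsFiniteMeasure Q] :
    ∀ᵐ ω ∂Q, ∀ s : Set.Ici t, densityProc ℱ P Q s.1.1 ω = ⊤ → weight t γ s ω = 0 := by
  refine ae_all_iff.2 fun s => ?_
  by_cases hs : s.1.1 = ⊤
  · filter_upwards [h.mem.2 s hs] with ω h1 h2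
    rw [hs] at h2
    simp [weight, h1 h2]
  · filter_upwards [ae_densityProc_time_ne_top h.locAC hs] with ω h1 h2
    exact absurd h2 h1

/-- This is the pointwise form of `Q ⊗ γ ≪ P ⊗ μ`. Where `γ_s^t` charges, `M_s` is finite, so the
`P`-a.s. positivity of `μ_s^t` carries over to `Q`. All logarithms that enter with positive weight
are then finite. -/
theorem ae_support [IsProbabilityMeasure P] [IsProbabilityMeasure Q]
    (h : PenaltyHyp ℱ P Q μ γ t) :
    ∀ᵐ ω ∂Q, ∀ s : Set.Ici t, weight t γ s ω ≠ 0 →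
      weight t μ s ω ≠ 0 ∧ ratio ℱ P Q t s ω ≠ 0 ∧ ratio ℱ P Q t s ω ≠ ⊤ := by
  have h1 : ∀ᵐ ω ∂Q, ∀ s : Set.Ici t, densityProc ℱ P Q s.1.1 ω ≠ ⊤ → weight t μ s ω ≠ 0 := by
    refine ae_all_iff.2 fun s => ae_of_ae_of_locAC h.locAC s
      (@MeasurableSet.compl _ _ (sigmaAt ℱ s.1.1)
        (h.measurable_weight_left s.2 (measurableSet_singleton 0))) ?_
    filter_upwards [h.ae_weight_ne_zero] with ω hω using hω s
  have h2 : ∀ᵐ ω ∂Q, ∀ s : Set.Ici t, densityProc ℱ P Q s.1.1 ω ≠ 0 :=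
    ae_all_iff.2 fun s => ae_densityProc_ne_zero h.locAC s.1
  filter_upwards [h1, h2, h.ae_weight_eq_zero, ae_densityProc_ne_zero h.locAC t,
    ae_densityProc_time_ne_top h.locAC h.ne_top] with ω h1 h2 h3 h4 h5 s hs
  have h6 : densityProc ℱ P Q s.1.1 ω ≠ ⊤ := fun h => hs (h3 s h)
  exact ⟨h1 s h6, ENNReal.div_ne_zero.2 ⟨h2 s, h5⟩, ENNReal.div_ne_top h6 h4⟩

/-- Positivity of `μ_t` is an event of `ℱ_t` and passes from `P` to `Q`. Total mass one may involve
all of `ℱ_∞`, where absolute continuity can fail, and is taken from `optQ`. -/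
theorem ae_tsum_weight_left [IsProbabilityMeasure P] [IsProbabilityMeasure Q]
    (h : PenaltyHyp ℱ P Q μ γ t) : ∀ᵐ ω ∂Q, ∑' s : Set.Ici t, weight t μ s ω = 1 := by
  have h1 : ∀ᵐ ω ∂Q, 0 < μ t ω :=
    ae_of_ae_of_locAC' h.locAC h.ne_top (h.optP.1 t measurableSet_Ioi)
      (h.pos.mono fun ω hω => hω t)
  filter_upwards [h.optQ.2, h1] with ω h2 h3
  rw [tsum_weight h2.1 h2.2,
    Set.indicator_of_mem (show ω ∈ {ω | 0 < discount μ t ω} from discount_pos h2.1 h2.2 h3),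
    Pi.one_apply]

theorem ae_tsum_weight_right (h : PenaltyHyp ℱ P Q μ γ t) :
    ∀ᵐ ω ∂Q, ∑' s : Set.Ici t, weight t γ s ω = {ω | 0 < discount γ t ω}.indicator 1 ω := by
  filter_upwards [h.mem.1.2] with ω h2
  exact tsum_weight h2.1 h2.2

/-- Change of measure from `P ⊗ μ` to `Q ⊗ γ`. -/
theorem condLExp_tsum_div_ratio_le [IsProbabilityMeasure P] [IsProbabilityMeasure Q]
    (h : PenaltyHyp ℱ P Q μ γ t) {Y : H.Time → Ω → ℝ≥0∞}
    (hY : ∀ s, t ≤ s → Measurable[sigmaAt ℱ s.1] (Y s))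
    (hle : condLExp (sigmaAt ℱ t.1) P (fun ω => ∑' s : Set.Ici t, weight t μ s ω * Y s ω) ≤ᵐ[P] 1) :
    condLExp (sigmaAt ℱ t.1) Q (fun ω => ∑' s : Set.Ici t,
      weight t μ s ω * Y s ω * (ratio ℱ P Q t s ω)⁻¹) ≤ᵐ[Q] 1 := by
  refine condLExp_le_of_forall_setLIntegral_le (sigmaAt_le ℱ _)
    (@measurable_const _ _ _ (sigmaAt ℱ t.1) 1) fun A hA => ?_
  have hA' := sigmaAt_le ℱ _ _ hA
  set N := densityProc ℱ P Q t.1 with hN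
  have hNm := measurable_densityProc ℱ P Q t.1
  set W : Ω → ℝ≥0∞ := fun ω => ∑' s : Set.Ici t, weight t μ s ω * Y s ω with hW
  have hWs (s : Set.Ici t) : Measurable[sigmaAt ℱ s.1.1] fun ω => weight t μ s ω * Y s ω :=
    (h.measurable_weight_left s.2).mul (hY s s.2)
  have hWm : Measurable W := Measurable.tsum fun s => (hWs s).mono (sigmaAt_le ℱ _) le_rfl
  have hterm (s : Set.Ici t) : ∫⁻ ω in A, weight t μ s ω * Y s ω * (ratio ℱ P Q t s ω)⁻¹ ∂Q ≤
      ∫⁻ ω, A.indicator N ω * (weight t μ s ω * Y s ω) ∂P := by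
    set f : Ω → ℝ≥0∞ := A.indicator fun ω =>
      weight t μ s ω * Y s ω * (N ω * (densityProc ℱ P Q s.1.1 ω)⁻¹) with hf
    have hfm : Measurable[sigmaAt ℱ s.1.1] f :=
      ((hWs s).mul ((hNm.mono (sigmaAt_time_mono s.2) le_rfl).mul
        (measurable_densityProc ℱ P Q _).inv)).indicator (sigmaAt_time_mono s.2 _ hA)
    have h1 : ∫⁻ ω in A, weight t μ s ω * Y s ω * (ratio ℱ P Q t s ω)⁻¹ ∂Q =
        ∫⁻ ω, {ω | densityProc ℱ P Q s.1.1 ω ≠ ⊤}.indicator f ω ∂Q := by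
      rw [← lintegral_indicator hA']
      refine lintegral_congr_ae ?_
      filter_upwards [ae_densityProc_ne_zero h.locAC t,
        ae_densityProc_time_ne_top h.locAC h.ne_top] with ω h2 h3
      by_cases hω : ω ∈ A
      · rw [Set.indicator_of_mem hω]
        -- On `{M_s = ∞}` the factor `M_t / M_s` is zero, so the singular part of `Q` contributes
        -- nothing.
        by_cases h4 : densityProc ℱ P Q s.1.1 ω = ⊤
        · have h5 : ω ∉ {ω | densityProc ℱ P Q s.1.1 ω ≠ ⊤} := fun h => h h4
          rw [Set.indicator_of_notMem h5, ratio, h4, ENNReal.top_div_of_ne_top h3]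
          simp
        · have h5 : ω ∈ {ω | densityProc ℱ P Q s.1.1 ω ≠ ⊤} := h4
          rw [Set.indicator_of_mem h5, hf, Set.indicator_of_mem hω, ratio,
            ENNReal.inv_div (Or.inl h3) (Or.inl h2), div_eq_mul_inv]
      · simp [hf, hω, Set.indicator]
    rw [h1, ← lintegral_mul_densityProc h.locAC s hfm]
    refine lintegral_mono fun ω => ?_
    by_cases hω : ω ∈ A
    · simp only [hf, Set.indicator_of_mem hω]
      calc weight t μ s ω * Y s ω * (N ω * (densityProc ℱ P Q s.1.1 ω)⁻¹) *
            densityProc ℱ P Q s.1.1 ω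
          = N ω * (weight t μ s ω * Y s ω) *
            ((densityProc ℱ P Q s.1.1 ω)⁻¹ * densityProc ℱ P Q s.1.1 ω) := by ring
        -- Only an inequality, because `M_s` may vanish with positive `P`-probability.
        _ ≤ N ω * (weight t μ s ω * Y s ω) * 1 := by gcongr; exact ENNReal.inv_mul_le_one _
        _ = _ := mul_one _
    · simp [hf, hω]
  have hm1 (s : Set.Ici t) : Measurable fun ω =>
      weight t μ s ω * Y s ω * (ratio ℱ P Q t s ω)⁻¹ :=
    ((hWs s).mul (measurable_ratio s.2).inv).mono (sigmaAt_le ℱ _) le_rfl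
  have hm2 (s : Set.Ici t) : Measurable fun ω => A.indicator N ω * (weight t μ s ω * Y s ω) :=
    ((hNm.mono (sigmaAt_le ℱ _) le_rfl).indicator hA').mul
      ((hWs s).mono (sigmaAt_le ℱ _) le_rfl)
  calc _ = ∑' s : Set.Ici t, ∫⁻ ω in A, weight t μ s ω * Y s ω * (ratio ℱ P Q t s ω)⁻¹ ∂Q :=
        lintegral_tsum fun s => (hm1 s).aemeasurable
    _ ≤ ∑' s : Set.Ici t, ∫⁻ ω, A.indicator N ω * (weight t μ s ω * Y s ω) ∂P :=
        ENNReal.tsum_le_tsum hterm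
    _ = ∫⁻ ω, A.indicator N ω * W ω ∂P := by
        rw [← lintegral_tsum fun s => (hm2 s).aemeasurable]
        exact lintegral_congr fun ω => ENNReal.tsum_mul_left
    _ = ∫⁻ ω, A.indicator N ω * condLExp (sigmaAt ℱ t.1) P W ω ∂P :=
        (lintegral_mul_condLExp (sigmaAt_le ℱ _) (hNm.indicator hA) hWm.aemeasurable).symm
    _ ≤ ∫⁻ ω, A.indicator 1 ω * N ω ∂P := by
        refine lintegral_mono_ae ?_
        filter_upwards [hle] with ω hω
        by_cases hωA : ω ∈ A
        · simp only [Set.indicator_of_mem hωA, Pi.one_apply, one_mul]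
          exact (mul_le_mul_right hω _).trans (mul_one _).le
        · simp [hωA]
    _ = ∫⁻ ω, {ω | N ω ≠ ⊤}.indicator (A.indicator 1) ω ∂Q :=
        lintegral_mul_densityProc h.locAC t ((@measurable_const _ _ _ (sigmaAt ℱ t.1) 1).indicator hA)
    _ ≤ ∫⁻ ω, A.indicator 1 ω ∂Q := lintegral_mono fun ω => Set.indicator_le_self _ _ ω
    _ = ∫⁻ ω in A, (1 : Ω → ℝ≥0∞) ω ∂Q := lintegral_indicator hA' _

/-- The density of `Q ⊗ γ` with respect to `P ⊗ μ` has conditional expectation at most one. -/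
theorem condLExp_tsum_jointDensity_le [IsProbabilityMeasure P] [IsProbabilityMeasure Q]
    (h : PenaltyHyp ℱ P Q μ γ t) :
    condLExp (sigmaAt ℱ t.1) P (fun ω => ∑' s : Set.Ici t,
      weight t μ s ω * jointDensity ℱ P Q μ γ t s ω) ≤ᵐ[P] 1 := by
  refine condLExp_le_of_forall_setLIntegral_le (sigmaAt_le ℱ _)
    (@measurable_const _ _ _ (sigmaAt ℱ t.1) 1) fun A hA => ?_
  have hA' := sigmaAt_le ℱ _ _ hA
  set N := densityProc ℱ P Q t.1 with hN
  have hNm := measurable_densityProc ℱ P Q t.1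
  set f : Set.Ici t → Ω → ℝ≥0∞ := fun s => A.indicator fun ω => weight t γ s ω * (N ω)⁻¹ with hf
  have hfm (s : Set.Ici t) : Measurable[sigmaAt ℱ s.1.1] (f s) :=
    ((h.measurable_weight_right s.2).mul
      (hNm.mono (sigmaAt_time_mono s.2) le_rfl).inv).indicator (sigmaAt_time_mono s.2 _ hA)
  have hfm' (s : Set.Ici t) : Measurable (f s) := (hfm s).mono (sigmaAt_le ℱ _) le_rfl
  calc _ = ∫⁻ ω, ∑' s : Set.Ici t, f s ω * densityProc ℱ P Q s.1.1 ω ∂P := by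
        rw [← lintegral_indicator hA']
        refine lintegral_congr_ae ?_
        filter_upwards [h.ae_weight_ne_zero] with ω h1
        by_cases hω : ω ∈ A
        · rw [Set.indicator_of_mem hω]
          refine tsum_congr fun s => ?_
          simp only [hf, Set.indicator_of_mem hω, jointDensity, ratio]
          rw [← mul_assoc, ENNReal.mul_div_cancel (h1 s) (weight_ne_top _ _ _ _), div_eq_mul_inv,
            mul_assoc, mul_comm (densityProc ℱ P Q s.1.1 ω)]
        · simp [hω, hf]
    _ = ∑' s : Set.Ici t, ∫⁻ ω, f s ω * densityProc ℱ P Q s.1.1 ω ∂P :=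
        lintegral_tsum fun s => ((hfm' s).mul ((measurable_densityProc ℱ P Q _).mono
          (sigmaAt_le ℱ _) le_rfl)).aemeasurable
    -- The passage to `Q` removes the indicator of `{M_s < ∞}`. The sum of the `γ_s^t` is controlled
    -- only under `Q`, so it is evaluated there before the return to `P` at time `t`.
    _ ≤ ∑' s : Set.Ici t, ∫⁻ ω, f s ω ∂Q := by
        refine ENNReal.tsum_le_tsum fun s => ?_
        rw [lintegral_mul_densityProc h.locAC s (hfm s)]
        exact lintegral_mono fun ω => Set.indicator_le_self _ _ ω
    _ = ∫⁻ ω, ∑' s : Set.Ici t, f s ω ∂Q := (lintegral_tsum fun s => (hfm' s).aemeasurable).symm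
    _ ≤ ∫⁻ ω, {ω | N ω ≠ ⊤}.indicator (A.indicator fun ω => (N ω)⁻¹) ω ∂Q := by
        refine lintegral_mono_ae ?_
        filter_upwards [h.ae_tsum_weight_right,
          ae_densityProc_time_ne_top h.locAC h.ne_top] with ω h1 h2
        rw [Set.indicator_of_mem (by exact h2)]
        by_cases hω : ω ∈ A
        · simp only [hf, Set.indicator_of_mem hω]
          rw [ENNReal.tsum_mul_right, h1]
          refine mul_le_of_le_one_left zero_le ?_
          exact Set.indicator_le_self _ _ ω
        · simp [hf, hω]
    _ = ∫⁻ ω, A.indicator (fun ω => (N ω)⁻¹) ω * N ω ∂P :=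
        (lintegral_mul_densityProc h.locAC t (hNm.inv.indicator hA)).symm
    _ ≤ ∫⁻ ω, A.indicator 1 ω ∂P := by
        refine lintegral_mono fun ω => ?_
        by_cases hω : ω ∈ A
        · simp only [Set.indicator_of_mem hω]; exact ENNReal.inv_mul_le_one _
        · simp [hω]
    _ = ∫⁻ ω in A, (1 : Ω → ℝ≥0∞) ω ∂P := lintegral_indicator hA' _

end PenaltyHyp

end Densities

end ProcessRisk

namespace ProcessRisk

variable {Ω : Type*} {mΩ : MeasurableSpace Ω} {ℱ : Filtration ℕ mΩ} {P Q : Measure Ω} {H : Horizon}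

/-! ### The penalty as a conditional relative entropy -/

section Penalty

/-- The weighted sum `∑_{s ∈ 𝕋_t} γ_s^t φ_s`. -/
def wsum (t : H.Time) (γ : H.Time → Ω → ℝ) (φ : H.Time → Ω → ℝ≥0∞) (ω : Ω) : ℝ≥0∞ :=
  ∑' s : Set.Ici t, weight t γ s ω * φ s ω

variable {μ γ : H.Time → Ω → ℝ} {t : H.Time}

theorem erealSum_mul_log {w : Set.Ici t → ℝ} (hw : ∀ s, 0 ≤ w s) (m : Set.Ici t → ℝ≥0∞) :
    erealSum (fun s => ((w s : ℝ) : EReal) * ENNReal.log (m s)) =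
      ((∑' s, ENNReal.ofReal (w s) * posLog (m s) : ℝ≥0∞) : EReal) -
        ((∑' s, ENNReal.ofReal (w s) * negLog (m s) : ℝ≥0∞) : EReal) := by
  unfold erealSum posLog negLog
  have h1 (s) : (((w s : ℝ) : EReal) * ENNReal.log (m s)).toENNReal =
      ENNReal.ofReal (w s) * (ENNReal.log (m s)).toENNReal := by
    rw [EReal.toENNReal_mul (EReal.coe_nonneg.2 (hw s)), EReal.real_coe_toENNReal]
  have h2 (s) : (-(((w s : ℝ) : EReal) * ENNReal.log (m s))).toENNReal =
      ENNReal.ofReal (w s) * (-ENNReal.log (m s)).toENNReal := by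
    rw [← mul_neg, EReal.toENNReal_mul (EReal.coe_nonneg.2 (hw s)), EReal.real_coe_toENNReal]
  simp only [h1, h2]

/-- `condEReal` splits the summed variable into parts, while `wsum` splits every term. The two
splittings differ by a common amount, and this identity relates them without subtraction. -/
theorem toENNReal_sub_add {a b : ℝ≥0∞} (hb : b ≠ ⊤) :
    ((a : EReal) - (b : EReal)).toENNReal + b = a + (-((a : EReal) - (b : EReal))).toENNReal := by
  lift b to NNReal using hb
  induction a with
  | top => simp
  | coe a =>
    have h1 : (((a : ℝ≥0∞) : EReal) - ((b : ℝ≥0∞) : EReal)) = (((a : ℝ) - (b : ℝ) : ℝ) : EReal) := by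
      rw [EReal.coe_sub]; rfl
    rw [h1, ← EReal.coe_neg, EReal.real_coe_toENNReal, EReal.real_coe_toENNReal,
      ofReal_eq_ofReal_max (a - b), ofReal_eq_ofReal_max (-(a - b : ℝ)),
      ← ENNReal.ofReal_coe_nnreal, ← ENNReal.ofReal_coe_nnreal,
      ← ENNReal.ofReal_add (by positivity) (by positivity),
      ← ENNReal.ofReal_add (by positivity) (by positivity)]
    congr 1
    rcases le_total (a : ℝ) b with h | h
    · rw [max_eq_right (by linarith), max_eq_left (by linarith)]; ring
    · rw [max_eq_left (by linarith), max_eq_right (by linarith)]; ring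

theorem toENNReal_neg_sub_le (a b : ℝ≥0∞) : (-((a : EReal) - (b : EReal))).toENNReal ≤ b := by
  rcases eq_or_ne b ⊤ with rfl | hb
  · exact le_top
  rw [← EReal.toENNReal_coe (x := b)]
  refine EReal.toENNReal_le_toENNReal ?_
  rw [EReal.toENNReal_coe, EReal.neg_sub (by simp) (by simp [hb])]
  calc -(a : EReal) + b ≤ 0 + b := by
        gcongr
        simpa using EReal.coe_ennreal_nonneg a
    _ = b := zero_add _

/-- Eliminates the termwise parts `x`, `y` of `log (M_s / M_t)` in favour of the parts `c`, `d` of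
their sum; `y` may be infinite, and only the finite `x` is cancelled. -/
theorem add_eq_of_add_eq_add {a b c d k x y : ℝ≥0∞} (hx : x ≠ ⊤) (h1 : a + x = b + y + k)
    (h2 : c + x = y + d) : a + d = b + c + k := by
  refine (ENNReal.add_left_inj hx).1 ?_
  calc a + d + x = a + x + d := add_right_comm _ _ _
    _ = b + k + (y + d) := by rw [h1]; ring
    _ = b + c + k + x := by rw [← h2]; ring

theorem mul_sub_add_mul_eq {a b c d k : ℝ≥0∞} (hb : b ≠ ⊤) (hd : d ≠ ⊤) (h : a + d = b + c + k)
    {r : ℝ} (hr : 0 < r) :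
    ((r : ℝ) : EReal) * ((c : EReal) - (d : EReal)) + ((r : ℝ) : EReal) * (k : EReal) =
      ((r : ℝ) : EReal) * ((a : EReal) - (b : EReal)) := by
  lift b to NNReal using hb
  lift d to NNReal using hd
  have hdt : ((d : ℝ≥0∞) : EReal) = ((d : ℝ) : EReal) := rfl
  have hbt : ((b : ℝ≥0∞) : EReal) = ((b : ℝ) : EReal) := rfl
  induction a with
  | top =>
    have h1 : (c : EReal) = ⊤ ∨ (k : EReal) = ⊤ := by
      by_contra! hc
      have h2 : c ≠ ⊤ := fun h => hc.1 (by simp [h])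
      have h3 : k ≠ ⊤ := fun h => hc.2 (by simp [h])
      rw [top_add] at h
      exact (ENNReal.add_ne_top.2 ⟨ENNReal.add_ne_top.2 ⟨ENNReal.coe_ne_top, h2⟩, h3⟩) h.symm
    rw [EReal.coe_ennreal_top, hbt, hdt, EReal.top_sub_coe, EReal.coe_mul_top_of_pos hr]
    rcases h1 with h1 | h1
    · rw [h1, EReal.top_sub_coe, EReal.coe_mul_top_of_pos hr]
      refine EReal.top_add_of_ne_bot (ne_of_gt ?_)
      exact lt_of_lt_of_le EReal.bot_lt_zero
        (mul_nonneg (EReal.coe_nonneg.2 hr.le) (EReal.coe_ennreal_nonneg k))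
    · rw [h1, EReal.coe_mul_top_of_pos hr]
      refine EReal.add_top_of_ne_bot ?_
      induction c with
      | top => rw [EReal.coe_ennreal_top, EReal.top_sub_coe, EReal.coe_mul_top_of_pos hr]; simp
      | coe c =>
        have hct : ((c : ℝ≥0∞) : EReal) = ((c : ℝ) : EReal) := rfl
        rw [hct, ← EReal.coe_sub, ← EReal.coe_mul]
        exact EReal.coe_ne_bot _
  | coe a =>
    have h1 : (a : ℝ≥0∞) + d ≠ ⊤ := by simp
    rw [h] at h1
    have hk : k ≠ ⊤ := (ENNReal.add_ne_top.1 h1).2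
    have hc : c ≠ ⊤ := (ENNReal.add_ne_top.1 (ENNReal.add_ne_top.1 h1).1).2
    lift k to NNReal using hk
    lift c to NNReal using hc
    have hct : ((c : ℝ≥0∞) : EReal) = ((c : ℝ) : EReal) := rfl
    have hat : ((a : ℝ≥0∞) : EReal) = ((a : ℝ) : EReal) := rfl
    have hkt : ((k : ℝ≥0∞) : EReal) = ((k : ℝ) : EReal) := rfl
    have h2 : (a : ℝ) + d = b + c + k := by exact_mod_cast h
    rw [hct, hat, hkt, hbt, hdt, ← EReal.coe_sub, ← EReal.coe_sub, ← EReal.coe_mul, ← EReal.coe_mul,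
      ← EReal.coe_mul, ← EReal.coe_add]
    congr 1
    have h3 : (a : ℝ) = b + c + k - d := by linarith
    rw [h3]; ring

namespace PenaltyHyp

theorem measurable_wsum_right (h : PenaltyHyp ℱ P Q μ γ t) {φ : H.Time → Ω → ℝ≥0∞}
    (hφ : ∀ s, t ≤ s → Measurable[sigmaAt ℱ s.1] (φ s)) : Measurable (wsum t γ φ) :=
  Measurable.tsum fun s => ((h.measurable_weight_right s.2).mul (hφ s s.2)).mono
    (sigmaAt_le ℱ _) le_rfl

theorem measurable_wsum_left (h : PenaltyHyp ℱ P Q μ γ t) {φ : H.Time → Ω → ℝ≥0∞}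
    (hφ : ∀ s, t ≤ s → Measurable[sigmaAt ℱ s.1] (φ s)) : Measurable (wsum t μ φ) :=
  Measurable.tsum fun s => ((h.measurable_weight_left s.2).mul (hφ s s.2)).mono
    (sigmaAt_le ℱ _) le_rfl

theorem measurable_jointPos (h : PenaltyHyp ℱ P Q μ γ t) :
    Measurable (wsum t γ fun s ω => posLog (jointDensity ℱ P Q μ γ t s ω)) :=
  h.measurable_wsum_right fun _ hs => measurable_posLog.comp (h.measurable_jointDensity hs)

theorem measurable_jointNeg (h : PenaltyHyp ℱ P Q μ γ t) :
    Measurable (wsum t γ fun s ω => negLog (jointDensity ℱ P Q μ γ t s ω)) :=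
  h.measurable_wsum_right fun _ hs => measurable_negLog.comp (h.measurable_jointDensity hs)

theorem measurable_ratioPos (h : PenaltyHyp ℱ P Q μ γ t) :
    Measurable (wsum t γ fun s ω => posLog (ratio ℱ P Q t s ω)) :=
  h.measurable_wsum_right fun _ hs => measurable_posLog.comp (measurable_ratio hs)

theorem measurable_ratioNeg (h : PenaltyHyp ℱ P Q μ γ t) :
    Measurable (wsum t γ fun s ω => negLog (ratio ℱ P Q t s ω)) :=
  h.measurable_wsum_right fun _ hs => measurable_negLog.comp (measurable_ratio hs)

theorem ae_tsum_weight_right_le (h : PenaltyHyp ℱ P Q μ γ t) :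
    ∀ᵐ ω ∂Q, ∑' s : Set.Ici t, weight t γ s ω ≤ 1 := by
  filter_upwards [h.ae_tsum_weight_right] with ω hω
  rw [hω]
  exact Set.indicator_le_self _ _ ω

theorem condLExp_tsum_weight_right [IsProbabilityMeasure Q] (h : PenaltyHyp ℱ P Q μ γ t) :
    condLExp (sigmaAt ℱ t.1) Q (fun ω => ∑' s : Set.Ici t, weight t γ s ω) =ᵐ[Q]
      {ω | 0 < discount γ t ω}.indicator 1 := by
  have hD : MeasurableSet[sigmaAt ℱ t.1] {ω | 0 < discount γ t ω} :=
    measurable_discount h.mem.1.1 h.ne_top measurableSet_Ioi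
  refine (condLExp_congr_ae h.ae_tsum_weight_right).trans (.of_eq ?_)
  exact condLExp_eq_self (sigmaAt_le ℱ _) Q
    ((@measurable_const _ _ _ (sigmaAt ℱ t.1) 1).indicator hD)

/-- The majorant of the negative parts is uniform in `s`, and the weights have total mass at most
one. -/
theorem lintegral_ratioNeg_ne_top [IsProbabilityMeasure P] [IsProbabilityMeasure Q]
    (h : PenaltyHyp ℱ P Q μ γ t) :
    ∫⁻ ω, wsum t γ (fun s ω => negLog (ratio ℱ P Q t s ω)) ω ∂Q ≠ ⊤ := by
  obtain ⟨N, hN, hle⟩ := exists_majorant_neg_log_densityProc h.locAC t h.ne_top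
  refine ne_top_of_le_ne_top hN (lintegral_mono_ae ?_)
  filter_upwards [hle, h.ae_tsum_weight_right_le] with ω h1 h2
  calc wsum t γ (fun s ω => negLog (ratio ℱ P Q t s ω)) ω
      ≤ ∑' s : Set.Ici t, weight t γ s ω * N ω :=
        ENNReal.tsum_le_tsum fun s => mul_le_mul_right (h1 s) _
    _ = (∑' s : Set.Ici t, weight t γ s ω) * N ω := ENNReal.tsum_mul_right
    _ ≤ 1 * N ω := by gcongr
    _ = N ω := one_mul _

/-- By `mul_negLog_le` the integrand is at most `∑ μ_s^t M_t / M_s`, whose conditional expectation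
under `Q` is at most one by the change of measure applied to the constant process `1`. -/
theorem lintegral_jointNeg_ne_top [IsProbabilityMeasure P] [IsProbabilityMeasure Q]
    (h : PenaltyHyp ℱ P Q μ γ t) :
    ∫⁻ ω, wsum t γ (fun s ω => negLog (jointDensity ℱ P Q μ γ t s ω)) ω ∂Q ≠ ⊤ := by
  have h1 : condLExp (sigmaAt ℱ t.1) P
      (fun ω => ∑' s : Set.Ici t, weight t μ s ω * (1 : ℝ≥0∞)) ≤ᵐ[P] 1 := by
    have h2 : (fun ω => ∑' s : Set.Ici t, weight t μ s ω * (1 : ℝ≥0∞)) =ᵐ[P] fun _ => 1 := by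
      simp only [mul_one]
      exact ae_tsum_weight_eq_one h.optP h.pos t
    exact ((condLExp_congr_ae h2).trans (.of_eq (condLExp_const (sigmaAt_le ℱ _) P 1))).le
  have h3 := h.condLExp_tsum_div_ratio_le (Y := fun _ _ => 1) (fun _ _ => measurable_const) h1
  have h4 := lintegral_mono_ae h3
  rw [lintegral_condLExp (sigmaAt_le ℱ _)] at h4
  refine ne_top_of_le_ne_top (by simp) ((lintegral_mono_ae ?_).trans h4)
  filter_upwards [h.ae_support] with ω hω
  refine ENNReal.tsum_le_tsum fun s => ?_
  rw [mul_one]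
  exact mul_negLog_le (weight_ne_top _ _ _ _) (weight_ne_top _ _ _ _) (hω s)

/-- The relative entropy of the normalized weights, as a sum. -/
theorem ae_klDiv_eq [IsProbabilityMeasure P] [IsProbabilityMeasure Q]
    (h : PenaltyHyp ℱ P Q μ γ t) : ∀ᵐ ω ∂Q,
    InformationTheory.klDiv (weightMeasure (normRestr t fun j => γ j ω))
      (weightMeasure (normRestr t fun j => μ j ω)) =
    wsum t μ (fun s ω => ENNReal.ofReal
      (InformationTheory.klFun ((weight t γ s ω).toReal / (weight t μ s ω).toReal))) ω := by
  filter_upwards [h.optQ.2, h.mem.1.2, h.ae_support, h.ae_tsum_weight_left,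
    h.ae_tsum_weight_right_le] with ω h1 h2 h3 h4 h5
  have e1 : normRestr t (fun j => γ j ω) = fun s : Set.Ici t => (weight t γ s ω).toReal :=
    funext fun s => normRestr_eq_toReal_weight h2.1 h2.2 t s
  have e2 : normRestr t (fun j => μ j ω) = fun s : Set.Ici t => (weight t μ s ω).toReal :=
    funext fun s => normRestr_eq_toReal_weight h1.1 h1.2 t s
  have e3 (ν : H.Time → Ω → ℝ) (s : Set.Ici t) :
      ENNReal.ofReal (weight t ν s ω).toReal = weight t ν s ω :=
    ENNReal.ofReal_toReal (weight_ne_top _ _ _ _)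
  rw [e1, e2, klDiv_weightMeasure (fun _ => ENNReal.toReal_nonneg)
    (fun _ => ENNReal.toReal_nonneg)]
  · simp only [e3]; rfl
  · simp only [e3]; exact ne_top_of_le_ne_top ENNReal.one_ne_top h5
  · simp only [e3, h4]; exact ENNReal.one_ne_top
  · intro s hs
    by_contra hne
    have h6 : weight t γ s ω ≠ 0 := fun h => hne (by simp [h])
    exact (h3 s h6).1 (((ENNReal.toReal_eq_zero_iff _).1 hs).resolve_right (weight_ne_top _ _ _ _))

/-- The identity `mul_posLog_add_eq`, summed over `s` and conditioned: the logarithm of the joint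
density splits into that of `M_s / M_t` and the relative entropy in time. -/
theorem ae_condLExp_entropy_eq [IsProbabilityMeasure P] [IsProbabilityMeasure Q]
    (h : PenaltyHyp ℱ P Q μ γ t) : ∀ᵐ ω ∂Q, 0 < discount γ t ω →
    condLExp (sigmaAt ℱ t.1) Q (wsum t γ fun s ω => posLog (jointDensity ℱ P Q μ γ t s ω)) ω +
      condLExp (sigmaAt ℱ t.1) Q (wsum t γ fun s ω => negLog (ratio ℱ P Q t s ω)) ω =
    condLExp (sigmaAt ℱ t.1) Q (wsum t γ fun s ω => negLog (jointDensity ℱ P Q μ γ t s ω)) ω +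
      condLExp (sigmaAt ℱ t.1) Q (wsum t γ fun s ω => posLog (ratio ℱ P Q t s ω)) ω +
      condLExp (sigmaAt ℱ t.1) Q (wsum t μ fun s ω => ENNReal.ofReal
        (InformationTheory.klFun ((weight t γ s ω).toReal / (weight t μ s ω).toReal))) ω := by
  set Gp := wsum t γ fun s ω => posLog (jointDensity ℱ P Q μ γ t s ω) with hGp
  set Gn := wsum t γ fun s ω => negLog (jointDensity ℱ P Q μ γ t s ω) with hGn
  set Fp := wsum t γ fun s ω => posLog (ratio ℱ P Q t s ω) with hFp
  set Fn := wsum t γ fun s ω => negLog (ratio ℱ P Q t s ω) with hFn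
  set K := wsum t μ fun s ω => ENNReal.ofReal
        (InformationTheory.klFun ((weight t γ s ω).toReal / (weight t μ s ω).toReal)) with hK
  have hm := sigmaAt_le ℱ t.1
  have hKm : Measurable K := h.measurable_wsum_left fun s hs =>
    (InformationTheory.measurable_klFun.comp ((h.measurable_weight_right hs).ennreal_toReal.div
      (h.measurable_weight_left hs).ennreal_toReal)).ennreal_ofReal
  -- The extra terms are the total masses of `μ^t` and `γ^t`. Their conditional expectations are
  -- both one on `{D_t > 0}` and cancel at the end.
  have hpt : Gp + Fn + (fun _ => 1) =ᵐ[Q]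
      Gn + Fp + K + fun ω => ∑' s : Set.Ici t, weight t γ s ω := by
    filter_upwards [h.ae_support, h.ae_tsum_weight_left] with ω h1 h2
    simp only [Pi.add_apply, hGp, hGn, hFp, hFn, hK, wsum]
    rw [← h2, ← ENNReal.tsum_add, ← ENNReal.tsum_add, ← ENNReal.tsum_add, ← ENNReal.tsum_add,
      ← ENNReal.tsum_add]
    exact tsum_congr fun s =>
      mul_posLog_add_eq (weight_ne_top _ _ _ _) (weight_ne_top _ _ _ _) (h1 s)
  have a1 := condLExp_add_left (mΩ := sigmaAt ℱ t.1) (P := Q) (X := Gp + Fn) (fun _ => 1)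
    (h.measurable_jointPos.add h.measurable_ratioNeg).aemeasurable
  have a2 := condLExp_add_left (mΩ := sigmaAt ℱ t.1) (P := Q) Fn h.measurable_jointPos.aemeasurable
  have b1 := condLExp_add_left (mΩ := sigmaAt ℱ t.1) (P := Q) (X := Gn + Fp + K)
    (fun ω => ∑' s : Set.Ici t, weight t γ s ω)
    ((h.measurable_jointNeg.add h.measurable_ratioPos).add hKm).aemeasurable
  have b2 := condLExp_add_left (mΩ := sigmaAt ℱ t.1) (P := Q) (X := Gn + Fp) K
    (h.measurable_jointNeg.add h.measurable_ratioPos).aemeasurable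
  have b3 := condLExp_add_left (mΩ := sigmaAt ℱ t.1) (P := Q) Fp h.measurable_jointNeg.aemeasurable
  rw [condLExp_const hm] at a1
  filter_upwards [condLExp_congr_ae (mΩ := sigmaAt ℱ t.1) hpt, a1, a2, b1, b2, b3,
    h.condLExp_tsum_weight_right] with ω e a1 a2 b1 b2 b3 b4 hω
  rw [a1, b1] at e
  simp only [Pi.add_apply] at e a2 b2 b3
  rw [a2, b2, b3, b4,
    Set.indicator_of_mem (show ω ∈ {ω | 0 < discount γ t ω} from hω), Pi.one_apply] at e
  exact (ENNReal.add_left_inj ENNReal.one_ne_top).1 e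

/-- The entropic penalty is a conditional relative entropy on the optional product space. -/
theorem ae_entropicPenalty_eq [IsProbabilityMeasure P] [IsProbabilityMeasure Q]
    (h : PenaltyHyp ℱ P Q μ γ t) {q : Ω → ℝ} (hq : ∀ᵐ ω ∂Q, 0 < q ω) :
    ∀ᵐ ω ∂Q, 0 < discount γ t ω → entropicPenalty ℱ P μ q t Q γ ω = ((1 / q ω : ℝ) : EReal) *
      (((condLExp (sigmaAt ℱ t.1) Q
          (wsum t γ fun s ω => posLog (jointDensity ℱ P Q μ γ t s ω)) ω : ℝ≥0∞) : EReal) -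
        ((condLExp (sigmaAt ℱ t.1) Q
          (wsum t γ fun s ω => negLog (jointDensity ℱ P Q μ γ t s ω)) ω : ℝ≥0∞) : EReal)) := by
  set Fp := wsum t γ fun s ω => posLog (ratio ℱ P Q t s ω) with hFp
  set Fn := wsum t γ fun s ω => negLog (ratio ℱ P Q t s ω) with hFn
  set f : Ω → EReal := fun ω' => erealSum fun s : Set.Ici t =>
    ((normRestr t (fun j => γ j ω') s : ℝ) : EReal) *
      ENNReal.log (densityProc ℱ P Q s.1.1 ω' / densityProc ℱ P Q t.1 ω') with hf
  have hfe : ∀ᵐ ω ∂Q, f ω = ((Fp ω : ℝ≥0∞) : EReal) - ((Fn ω : ℝ≥0∞) : EReal) := by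
    filter_upwards [h.mem.1.2] with ω h2
    have e1 : normRestr t (fun j => γ j ω) = fun s : Set.Ici t => (weight t γ s ω).toReal :=
      funext fun s => normRestr_eq_toReal_weight h2.1 h2.2 t s
    simp only [hf, e1]
    rw [erealSum_mul_log fun s => ENNReal.toReal_nonneg]
    simp only [ENNReal.ofReal_toReal (weight_ne_top _ _ _ _)]
    rfl
  have hFn_lt : ∀ᵐ ω ∂Q, Fn ω ≠ ⊤ := by
    filter_upwards [ae_lt_top h.measurable_ratioNeg h.lintegral_ratioNeg_ne_top] with ω hω
      using hω.ne
  have e1 : (fun ω => (f ω).toENNReal) + Fn =ᵐ[Q] Fp + fun ω => (-f ω).toENNReal := by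
    filter_upwards [hfe, hFn_lt] with ω h1 h2
    simp only [Pi.add_apply, h1]
    exact toENNReal_sub_add h2
  have e2 : (fun ω => (-f ω).toENNReal) ≤ᵐ[Q] Fn := by
    filter_upwards [hfe] with ω h1
    rw [h1]
    exact toENNReal_neg_sub_le _ _
  have a1 := condLExp_add_right (mΩ := sigmaAt ℱ t.1) (P := Q) (fun ω => (f ω).toENNReal)
    h.measurable_ratioNeg.aemeasurable
  have a2 := condLExp_add_left (mΩ := sigmaAt ℱ t.1) (P := Q) (fun ω => (-f ω).toENNReal)
    h.measurable_ratioPos.aemeasurable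
  filter_upwards [h.ae_condLExp_entropy_eq, condLExp_congr_ae (mΩ := sigmaAt ℱ t.1) e1,
    condLExp_mono (mΩ := sigmaAt ℱ t.1) e2, a1, a2, hq,
    condLExp_ne_top (mΩ := sigmaAt ℱ t.1) h.lintegral_ratioNeg_ne_top,
    condLExp_ne_top (mΩ := sigmaAt ℱ t.1) h.lintegral_jointNeg_ne_top,
    condLExp_congr_ae (mΩ := sigmaAt ℱ t.1) h.ae_klDiv_eq] with ω h1 h2 h3 h4 h5 h6 h7 h8 h9 hω
  rw [h4, h5] at h2
  simp only [Pi.add_apply] at h2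
  unfold entropicPenalty condEReal
  rw [h9]
  -- Finiteness of both subtracted terms, the negative parts of the joint logarithm and of the
  -- summed `log (M_s / M_t)`, is what makes the differences in `[-∞, ∞]` genuine.
  refine mul_sub_add_mul_eq h8 (ne_top_of_le_ne_top h7 h3) ?_ (by positivity)
  exact add_eq_of_add_eq_add h7 (h1 hω) h2

end PenaltyHyp

end Penalty

end ProcessRisk

namespace ProcessRisk

variable {Ω : Type*} {mΩ : MeasurableSpace Ω} {ℱ : Filtration ℕ mΩ} {P Q : Measure Ω} {H : Horizon}

/-! ### The minimal penalty function -/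

section Minimal

variable {μ γ : H.Time → Ω → ℝ} {t : H.Time}

theorem iSup_min_of_tendsto_top {x : ℝ≥0∞} {c : ℕ → ℝ≥0∞} (hc : Tendsto c atTop (nhds ⊤)) :
    ⨆ n, min x (c n) = x := by
  refine le_antisymm (iSup_le fun n => min_le_left _ _) ?_
  have h : Tendsto (fun n => min x (c n)) atTop (nhds (min x ⊤)) := tendsto_const_nhds.min hc
  rw [min_top_right] at h
  exact le_of_tendsto' h fun n => le_iSup (fun n => min x (c n)) n

theorem iSup_tsum_of_monotone {ι : Type*} {f : ℕ → ι → ℝ≥0∞} (hf : ∀ i, Monotone fun n => f n i) :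
    ⨆ n, ∑' i, f n i = ∑' i, ⨆ n, f n i := by
  simp only [ENNReal.tsum_eq_iSup_sum]
  rw [iSup_comm]
  exact iSup_congr fun s => (ENNReal.finsetSum_iSup_of_monotone hf).symm

theorem coe_sub_le_of_add_le {a b c d : ℝ≥0∞} (ha : a ≠ ⊤) (hb : b ≠ ⊤) (hd : d ≠ ⊤) {r : ℝ}
    (hr : 0 < r) (h : ENNReal.ofReal r * a + d ≤ ENNReal.ofReal r * b + c) :
    ((a.toReal - b.toReal : ℝ) : EReal) ≤ ((1 / r : ℝ) : EReal) * ((c : EReal) - (d : EReal)) := by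
  lift a to NNReal using ha
  lift b to NNReal using hb
  lift d to NNReal using hd
  have hdt : ((d : ℝ≥0∞) : EReal) = ((d : ℝ) : EReal) := rfl
  have hr' : 0 < 1 / r := by positivity
  induction c with
  | top =>
    rw [EReal.coe_ennreal_top, hdt, EReal.top_sub_coe, EReal.coe_mul_top_of_pos hr']
    exact le_top
  | coe c =>
    have hct : ((c : ℝ≥0∞) : EReal) = ((c : ℝ) : EReal) := rfl
    rw [hct, hdt, ← EReal.coe_sub, ← EReal.coe_mul, EReal.coe_le_coe_iff]
    have h1 := (ENNReal.toReal_le_toReal (by finiteness) (by finiteness)).2 h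
    rw [ENNReal.toReal_add (by finiteness) (by finiteness),
      ENNReal.toReal_add (by finiteness) (by finiteness), ENNReal.toReal_mul, ENNReal.toReal_mul,
      ENNReal.toReal_ofReal hr.le] at h1
    simp only [ENNReal.coe_toReal] at h1 ⊢
    rw [one_div, inv_mul_eq_div, le_div_iff₀ hr]
    linarith

/-- For real `y` the hypotheses give `c n ≤ r (a n - b n) + d + e n ≤ r y + d + e n`, and `n → ∞`
yields `g ≤ r y + d`. In particular a finite upper bound forces `g` to be finite. -/
theorem mul_coe_sub_le {a c : ℕ → ℝ≥0∞} {b : ℕ → ℝ≥0∞} {g d : ℝ≥0∞} {e : ℕ → ℝ}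
    (ha : ∀ n, a n ≠ ⊤) (hb : ∀ n, b n ≠ ⊤) (hd : d ≠ ⊤) (he0 : ∀ n, 0 ≤ e n)
    (he : Tendsto e atTop (nhds 0)) (hc : Tendsto c atTop (nhds g)) {r : ℝ} (hr : 0 < r)
    (h : ∀ n, ENNReal.ofReal r * b n + c n ≤ ENNReal.ofReal r * a n + d + ENNReal.ofReal (e n))
    {y : EReal} (hy : ∀ n, (((a n).toReal - (b n).toReal : ℝ) : EReal) ≤ y) :
    ((1 / r : ℝ) : EReal) * ((g : EReal) - (d : EReal)) ≤ y := by
  have hr' : 0 < 1 / r := by positivity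
  lift d to NNReal using hd
  have hdt : ((d : ℝ≥0∞) : EReal) = ((d : ℝ) : EReal) := rfl
  induction y with
  | bot => exact absurd (hy 0) (by rw [not_le]; exact EReal.bot_lt_coe _)
  | top => exact le_top
  | coe y =>
    have h1 : ∀ n, c n ≤ ENNReal.ofReal (r * y + d + e n) := by
      intro n
      have hyn : (a n).toReal - (b n).toReal ≤ y := EReal.coe_le_coe_iff.1 (hy n)
      have h2 := h n
      have han := ha n
      have hbn := hb n
      have hcn : c n ≠ ⊤ := by
        refine ne_top_of_le_ne_top ?_ (le_add_self.trans h2)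
        finiteness
      rw [ENNReal.le_ofReal_iff_toReal_le hcn]
      · have h3 := (ENNReal.toReal_le_toReal (by finiteness) (by finiteness)).2 h2
        rw [ENNReal.toReal_add (by finiteness) (by finiteness),
          ENNReal.toReal_add (by finiteness) (by finiteness),
          ENNReal.toReal_add (by finiteness) (by finiteness), ENNReal.toReal_mul,
          ENNReal.toReal_mul, ENNReal.toReal_ofReal hr.le, ENNReal.toReal_ofReal (he0 n)] at h3
        simp only [ENNReal.coe_toReal] at h3
        nlinarith
      · have h3 := (ENNReal.toReal_le_toReal (by finiteness) (by finiteness)).2 h2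
        rw [ENNReal.toReal_add (by finiteness) (by finiteness),
          ENNReal.toReal_add (by finiteness) (by finiteness),
          ENNReal.toReal_add (by finiteness) (by finiteness), ENNReal.toReal_mul,
          ENNReal.toReal_mul, ENNReal.toReal_ofReal hr.le, ENNReal.toReal_ofReal (he0 n)] at h3
        simp only [ENNReal.coe_toReal] at h3
        have := ENNReal.toReal_nonneg (a := c n)
        nlinarith
    have h4 : Tendsto (fun n => ENNReal.ofReal (r * y + d + e n)) atTop
        (nhds (ENNReal.ofReal (r * y + d + 0))) :=
      (ENNReal.continuous_ofReal.tendsto _).comp (tendsto_const_nhds.add he)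
    have h5 := le_of_tendsto_of_tendsto' hc h4 h1
    rw [add_zero] at h5
    have hg : g ≠ ⊤ := ne_top_of_le_ne_top ENNReal.ofReal_ne_top h5
    -- `ENNReal.ofReal` truncates at zero, so the bound on `g` can be read in the reals only once
    -- the limit is known to be nonnegative.
    have h6 : 0 ≤ r * y + d := by
      have h7 : ∀ n, 0 ≤ r * y + d + e n := by
        intro n
        have hyn : (a n).toReal - (b n).toReal ≤ y := EReal.coe_le_coe_iff.1 (hy n)
        have h2 := h n
        have han := ha n
        have hbn := hb n
        have h3 := (ENNReal.toReal_le_toReal (by finiteness) (by finiteness)).2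
          (le_self_add.trans h2)
        rw [ENNReal.toReal_add (by finiteness) (by finiteness),
          ENNReal.toReal_add (by finiteness) (by finiteness), ENNReal.toReal_mul,
          ENNReal.toReal_mul, ENNReal.toReal_ofReal hr.le, ENNReal.toReal_ofReal (he0 n)] at h3
        simp only [ENNReal.coe_toReal] at h3
        nlinarith
      have h8 : Tendsto (fun n => r * y + d + e n) atTop (nhds (r * y + d + 0)) :=
        tendsto_const_nhds.add he
      rw [add_zero] at h8
      exact ge_of_tendsto' h8 h7
    have h9 := ENNReal.toReal_le_of_le_ofReal h6 h5
    lift g to NNReal using hg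
    have hgt : ((g : ℝ≥0∞) : EReal) = ((g : ℝ) : EReal) := rfl
    rw [hgt, hdt, ← EReal.coe_sub, ← EReal.coe_mul, EReal.coe_le_coe_iff, one_div, inv_mul_eq_div,
      div_le_iff₀ hr]
    simp only [ENNReal.coe_toReal] at h9
    linarith

namespace PenaltyHyp

/-- A `P`-essential bound says nothing under `Q` about `X_∞` on `{M_∞ = ∞}`, but `γ` has no mass
there. -/
theorem ae_bound [IsFiniteMeasure P] [IsFiniteMeasure Q] (h : PenaltyHyp ℱ P Q μ γ t)
    {X : H.Time → Ω → ℝ} (hX : IsAdapted ℱ X) {C : ℝ} (hC : ∀ᵐ ω ∂P, ∀ s, |X s ω| ≤ C) :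
    ∀ᵐ ω ∂Q, ∀ s : Set.Ici t, weight t γ s ω ≠ 0 → |X s ω| ≤ C := by
  have h1 : ∀ᵐ ω ∂Q, ∀ s : Set.Ici t, densityProc ℱ P Q s.1.1 ω ≠ ⊤ → |X s ω| ≤ C := by
    refine ae_all_iff.2 fun s => ae_of_ae_of_locAC h.locAC s ?_ (hC.mono fun ω hω => hω s)
    exact (hX s) (measurableSet_le measurable_norm measurable_const)
  filter_upwards [h1, h.ae_weight_eq_zero] with ω h2 h3 s hs
  exact h2 s fun h => hs (h3 s h)

theorem ae_wsum_ofReal_le [IsFiniteMeasure P] [IsFiniteMeasure Q] (h : PenaltyHyp ℱ P Q μ γ t)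
    {X : H.Time → Ω → ℝ} (hX : IsAdapted ℱ X) {C : ℝ} (hC : ∀ᵐ ω ∂P, ∀ s, |X s ω| ≤ C) :
    ∀ᵐ ω ∂Q, wsum t γ (fun s ω => ENNReal.ofReal (X s ω)) ω ≤ ENNReal.ofReal C := by
  filter_upwards [h.ae_bound hX hC, h.ae_tsum_weight_right_le] with ω h1 h2
  calc wsum t γ (fun s ω => ENNReal.ofReal (X s ω)) ω
      ≤ ∑' s : Set.Ici t, weight t γ s ω * ENNReal.ofReal C := by
        refine ENNReal.tsum_le_tsum fun s => ?_
        by_cases hs : weight t γ s ω = 0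
        · simp [hs]
        · exact mul_le_mul_right (ENNReal.ofReal_le_ofReal ((le_abs_self _).trans (h1 s hs))) _
    _ = (∑' s : Set.Ici t, weight t γ s ω) * ENNReal.ofReal C := ENNReal.tsum_mul_right
    _ ≤ 1 * ENNReal.ofReal C := by gcongr
    _ = _ := one_mul _

theorem lintegral_wsum_ofReal_ne_top [IsFiniteMeasure P] [IsFiniteMeasure Q]
    (h : PenaltyHyp ℱ P Q μ γ t) {X : H.Time → Ω → ℝ} (hX : X ∈ RInf ℱ P H) :
    ∫⁻ ω, wsum t γ (fun s ω => ENNReal.ofReal (X s ω)) ω ∂Q ≠ ⊤ := by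
  obtain ⟨hXm, C, hC⟩ := hX
  refine ne_top_of_le_ne_top ?_ (lintegral_mono_ae (h.ae_wsum_ofReal_le hXm hC))
  rw [lintegral_const]
  finiteness

theorem neg_mem_RInf {X : H.Time → Ω → ℝ} (hX : X ∈ RInf ℱ P H) :
    (fun s ω => -X s ω) ∈ RInf ℱ P H := by
  obtain ⟨hXm, C, hC⟩ := hX
  exact ⟨fun s => (hXm s).neg, C, by simpa only [abs_neg] using hC⟩

theorem measurable_wsum_ofReal (h : PenaltyHyp ℱ P Q μ γ t) {X : H.Time → Ω → ℝ}
    (hX : IsAdapted ℱ X) : Measurable (wsum t γ fun s ω => ENNReal.ofReal (X s ω)) :=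
  h.measurable_wsum_right fun s _ => (hX s).ennreal_ofReal

/-- The functional defining the penalty, as a difference of conditional Lebesgue expectations. -/
theorem ae_condExp_eq [IsProbabilityMeasure P] [IsProbabilityMeasure Q]
    (h : PenaltyHyp ℱ P Q μ γ t) {X : H.Time → Ω → ℝ} (hX : X ∈ RInf ℱ P H) :
    Q[fun ω' => -∑' s : Set.Ici t, γ s ω' / discount γ t ω' * X s ω' | sigmaAt ℱ t.1] =ᵐ[Q]
      fun ω => (condLExp (sigmaAt ℱ t.1) Q
          (wsum t γ fun s ω => ENNReal.ofReal (-X s ω)) ω).toReal -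
        (condLExp (sigmaAt ℱ t.1) Q (wsum t γ fun s ω => ENNReal.ofReal (X s ω)) ω).toReal := by
  have hX' := neg_mem_RInf hX
  have hi1 := h.lintegral_wsum_ofReal_ne_top hX
  have hi2 := h.lintegral_wsum_ofReal_ne_top hX'
  have hm1 := h.measurable_wsum_ofReal hX.1
  have hm2 := h.measurable_wsum_ofReal hX'.1
  set A := wsum t γ fun s ω => ENNReal.ofReal (-X s ω) with hA
  set B := wsum t γ fun s ω => ENNReal.ofReal (X s ω) with hB
  have e1 : (fun ω' => -∑' s : Set.Ici t, γ s ω' / discount γ t ω' * X s ω') =ᵐ[Q]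
      (fun ω => (A ω).toReal) - fun ω => (B ω).toReal := by
    filter_upwards [h.mem.1.2, ae_lt_top hm1 hi1, ae_lt_top hm2 hi2] with ω h1 h2 h3
    have hs1 : Summable fun s : Set.Ici t =>
      (weight t γ s ω * ENNReal.ofReal (-X s ω)).toReal := ENNReal.summable_toReal h3.ne
    have hs2 : Summable fun s : Set.Ici t =>
      (weight t γ s ω * ENNReal.ofReal (X s ω)).toReal := ENNReal.summable_toReal h2.ne
    have hA' : (A ω).toReal = ∑' s : Set.Ici t,
        (weight t γ s ω * ENNReal.ofReal (-X s ω)).toReal :=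
      ENNReal.tsum_toReal_eq fun s => ENNReal.mul_ne_top (weight_ne_top _ _ _ _)
        ENNReal.ofReal_ne_top
    have hB' : (B ω).toReal = ∑' s : Set.Ici t,
        (weight t γ s ω * ENNReal.ofReal (X s ω)).toReal :=
      ENNReal.tsum_toReal_eq fun s => ENNReal.mul_ne_top (weight_ne_top _ _ _ _)
        ENNReal.ofReal_ne_top
    rw [Pi.sub_apply, hA', hB', ← hs1.tsum_sub hs2, ← tsum_neg]
    refine tsum_congr fun s => ?_
    rw [← normRestr_eq h1.1 h1.2, normRestr_eq_toReal_weight h1.1 h1.2, ENNReal.toReal_mul,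
      ENNReal.toReal_mul, ENNReal.toReal_ofReal', ENNReal.toReal_ofReal', ← mul_sub, ← mul_neg]
    congr 1
    rcases le_total (X s ω) 0 with h | h
    · rw [max_eq_left (by linarith), max_eq_right h]; ring
    · rw [max_eq_right (by linarith), max_eq_left h]; ring
  have i1 : Integrable (fun ω => (A ω).toReal) Q := integrable_toReal_of_lintegral_ne_top
    hm2.aemeasurable hi2
  have i2 : Integrable (fun ω => (B ω).toReal) Q := integrable_toReal_of_lintegral_ne_top
    hm1.aemeasurable hi1
  filter_upwards [condExp_congr_ae (m := sigmaAt ℱ t.1) e1, condExp_sub i1 i2 (sigmaAt ℱ t.1),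
    toReal_condLExp (sigmaAt ℱ t.1) hm1.aemeasurable hi1,
    toReal_condLExp (sigmaAt ℱ t.1) hm2.aemeasurable hi2] with ω h1 h2 h3 h4
  rw [h1, h2, Pi.sub_apply, ← h3, ← h4]

theorem condLExp_wsum_smul [IsProbabilityMeasure Q]
    (h : PenaltyHyp ℱ P Q μ γ t) {q : Ω → ℝ} (hqm : Measurable[sigmaAt ℱ t.1] q)
    (hq : ∀ᵐ ω ∂Q, 0 < q ω) {X : H.Time → Ω → ℝ} (hX : IsAdapted ℱ X) :
    condLExp (sigmaAt ℱ t.1) Q (wsum t γ fun s ω => ENNReal.ofReal (q ω * X s ω)) =ᵐ[Q]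
      fun ω => ENNReal.ofReal (q ω) *
        condLExp (sigmaAt ℱ t.1) Q (wsum t γ fun s ω => ENNReal.ofReal (X s ω)) ω := by
  have h1 : wsum t γ (fun s ω => ENNReal.ofReal (q ω * X s ω)) =ᵐ[Q]
      fun ω => ENNReal.ofReal (q ω) * wsum t γ (fun s ω => ENNReal.ofReal (X s ω)) ω := by
    filter_upwards [hq] with ω hω
    rw [wsum, wsum, ← ENNReal.tsum_mul_left]
    refine tsum_congr fun s => ?_
    rw [ENNReal.ofReal_mul hω.le]
    ring
  exact (condLExp_congr_ae h1).trans (condLExp_mul_left (sigmaAt_le ℱ _) hqm.ennreal_ofReal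
    (h.measurable_wsum_ofReal hX).aemeasurable)

/-- Gibbs' variational inequality: the penalty dominates the functional on acceptable processes. -/
theorem ae_le_of_acceptable [IsProbabilityMeasure P] [IsProbabilityMeasure Q]
    (h : PenaltyHyp ℱ P Q μ γ t) {q : Ω → ℝ} (hqm : Measurable[sigmaAt ℱ t.1] q)
    (hq : ∀ᵐ ω ∂Q, 0 < q ω) {X : H.Time → Ω → ℝ} (hX : X ∈ RInf ℱ P H)
    (hacc : condLExp (sigmaAt ℱ t.1) P (expSum t μ q X) ≤ᵐ[P] 1) :
    ∀ᵐ ω ∂Q, 0 < discount γ t ω →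
      (((Q[fun ω' => -∑' s : Set.Ici t, γ s ω' / discount γ t ω' * X s ω' |
          sigmaAt ℱ t.1]) ω : ℝ) : EReal) ≤ ((1 / q ω : ℝ) : EReal) *
      (((condLExp (sigmaAt ℱ t.1) Q
          (wsum t γ fun s ω => posLog (jointDensity ℱ P Q μ γ t s ω)) ω : ℝ≥0∞) : EReal) -
        ((condLExp (sigmaAt ℱ t.1) Q
          (wsum t γ fun s ω => negLog (jointDensity ℱ P Q μ γ t s ω)) ω : ℝ≥0∞) : EReal)) := by
  have hX' := neg_mem_RInf hX
  have hmul (s : H.Time) (hs : t ≤ s) {Z : H.Time → Ω → ℝ} (hZ : IsAdapted ℱ Z) :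
      Measurable[sigmaAt ℱ s.1] fun ω => ENNReal.ofReal (q ω * Z s ω) :=
    ((hqm.mono (sigmaAt_time_mono hs) le_rfl).mul (hZ s)).ennreal_ofReal
  set Gp := wsum t γ fun s ω => posLog (jointDensity ℱ P Q μ γ t s ω) with hGp
  set Gn := wsum t γ fun s ω => negLog (jointDensity ℱ P Q μ γ t s ω) with hGn
  set A := wsum t γ fun s ω => ENNReal.ofReal (q ω * -X s ω) with hA
  set B := wsum t γ fun s ω => ENNReal.ofReal (q ω * X s ω) with hB
  have hAm : Measurable A := h.measurable_wsum_right fun s hs => hmul s hs hX'.1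
  have hBm : Measurable B := h.measurable_wsum_right fun s hs => hmul s hs hX.1
  set Y : Ω → ℝ≥0∞ := fun ω => ∑' s : Set.Ici t,
    weight t μ s ω * ENNReal.ofReal (Real.exp (-q ω * X s ω)) * (ratio ℱ P Q t s ω)⁻¹ with hY
  have hYle := h.condLExp_tsum_div_ratio_le
    (Y := fun s ω => ENNReal.ofReal (Real.exp (-q ω * X s ω)))
    (fun s hs => (((hqm.mono (sigmaAt_time_mono hs) le_rfl).neg.mul
      (hX.1 s)).exp).ennreal_ofReal) hacc
  -- Young's inequality at `a = -q X_s`, summed over `s`.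
  have hpt : A + Gn + (fun ω => ∑' s : Set.Ici t, weight t γ s ω) ≤ᵐ[Q] B + Gp + Y := by
    filter_upwards [h.ae_support] with ω h1
    simp only [Pi.add_apply, hA, hGn, hB, hGp, hY, wsum]
    rw [← ENNReal.tsum_add, ← ENNReal.tsum_add, ← ENNReal.tsum_add, ← ENNReal.tsum_add]
    refine ENNReal.tsum_le_tsum fun s => ?_
    have h2 := young_le (weight_ne_top t γ s ω) (weight_ne_top t μ s ω) (h1 s) (q ω * -X s ω)
    rw [mul_neg, neg_neg, ← neg_mul] at h2
    rw [mul_neg, ← neg_mul]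
    exact h2
  have a1 := condLExp_add_left (mΩ := sigmaAt ℱ t.1) (P := Q) (X := A + Gn)
    (fun ω => ∑' s : Set.Ici t, weight t γ s ω) (hAm.add h.measurable_jointNeg).aemeasurable
  have a2 := condLExp_add_left (mΩ := sigmaAt ℱ t.1) (P := Q) Gn hAm.aemeasurable
  have b1 := condLExp_add_left (mΩ := sigmaAt ℱ t.1) (P := Q) (X := B + Gp) Y
    (hBm.add h.measurable_jointPos).aemeasurable
  have b2 := condLExp_add_left (mΩ := sigmaAt ℱ t.1) (P := Q) Gp hBm.aemeasurable
  filter_upwards [condLExp_mono (mΩ := sigmaAt ℱ t.1) hpt, a1, a2, b1, b2,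
    h.condLExp_tsum_weight_right, hYle, h.condLExp_wsum_smul hqm hq hX.1,
    h.condLExp_wsum_smul hqm hq hX'.1, h.ae_condExp_eq hX, hq,
    condLExp_ne_top (mΩ := sigmaAt ℱ t.1) h.lintegral_jointNeg_ne_top,
    condLExp_ne_top (mΩ := sigmaAt ℱ t.1) (h.lintegral_wsum_ofReal_ne_top hX),
    condLExp_ne_top (mΩ := sigmaAt ℱ t.1) (h.lintegral_wsum_ofReal_ne_top hX')]
    with ω h1 a1 a2 b1 b2 h2 h3 h4 h5 h6 h7 h8 h9 h10 hω
  rw [a1, b1] at h1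
  simp only [Pi.add_apply] at h1 a2 b2
  rw [a2, b2, h2, h4, h5,
    Set.indicator_of_mem (show ω ∈ {ω | 0 < discount γ t ω} from hω), Pi.one_apply] at h1
  rw [h6]
  refine coe_sub_le_of_add_le h10 h9 h8 h7 ?_
  -- On `{D_t > 0}` the mass one of `γ^t` on the left offsets the bound one for the exponential term
  -- on the right.
  refine (ENNReal.add_le_add_iff_right ENNReal.one_ne_top).1 (h1.trans ?_)
  gcongr
  exact h3

end PenaltyHyp

end Minimal

end ProcessRisk

namespace ProcessRisk

variable {Ω : Type*} {mΩ : MeasurableSpace Ω} {ℱ : Filtration ℕ mΩ} {P Q : Measure Ω} {H : Horizon}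

/-! ### Optimality -/

section Optimality

variable {μ γ : H.Time → Ω → ℝ} {t : H.Time}

/-- Near-optimal acceptable processes: the truncated logarithm of the joint density, shifted by
`log (1 + c⁻¹)`. -/
def nearOptimal (ℱ : Filtration ℕ mΩ) (P Q : Measure Ω) (μ γ : H.Time → Ω → ℝ) (q : Ω → ℝ)
    (t : H.Time) (c : ℝ) (s : H.Time) (ω : Ω) : ℝ :=
  if t ≤ s then
    -((q ω)⁻¹ * (Real.log (clip c (jointDensity ℱ P Q μ γ t s ω)).toReal - Real.log (1 + c⁻¹)))
  else 0

theorem mul_nearOptimal {q : Ω → ℝ} {c : ℝ} {s : H.Time} (hs : t ≤ s) {ω : Ω} (hq : q ω ≠ 0) :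
    q ω * nearOptimal ℱ P Q μ γ q t c s ω =
      -(Real.log (clip c (jointDensity ℱ P Q μ γ t s ω)).toReal - Real.log (1 + c⁻¹)) := by
  rw [nearOptimal, if_pos hs, mul_neg, mul_inv_cancel_left₀ hq]

namespace PenaltyHyp

theorem nearOptimal_mem_RInf (h : PenaltyHyp ℱ P Q μ γ t) {q : Ω → ℝ}
    (hqi : MemLInf P (sigmaAt ℱ t.1) fun ω => (q ω)⁻¹) {c : ℝ} (hc : 1 ≤ c) :
    nearOptimal ℱ P Q μ γ q t c ∈ RInf ℱ P H := by
  obtain ⟨hqm, C, hC⟩ := hqi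
  refine ⟨fun s => ?_, C * (Real.log c + |Real.log (1 + c⁻¹)|), ?_⟩
  · by_cases hs : t ≤ s
    · have h1 : nearOptimal ℱ P Q μ γ q t c s = fun ω => -((q ω)⁻¹ *
          (Real.log (clip c (jointDensity ℱ P Q μ γ t s ω)).toReal - Real.log (1 + c⁻¹))) := by
        ext ω; rw [nearOptimal, if_pos hs]
      rw [h1]
      exact ((hqm.mono (sigmaAt_time_mono hs) le_rfl).mul
        ((Real.measurable_log.comp ((measurable_clip c).comp
          (h.measurable_jointDensity hs)).ennreal_toReal).sub measurable_const)).neg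
    · have h1 : nearOptimal ℱ P Q μ γ q t c s = fun _ => 0 := by
        ext ω; rw [nearOptimal, if_neg hs]
      rw [h1]
      exact measurable_const
  · filter_upwards [hC] with ω hω s
    have h0 : 0 ≤ Real.log c + |Real.log (1 + c⁻¹)| :=
      add_nonneg (Real.log_nonneg hc) (abs_nonneg _)
    rw [nearOptimal]
    by_cases hs : t ≤ s
    · rw [if_pos hs, abs_neg, abs_mul]
      refine mul_le_mul hω ?_ (abs_nonneg _) ((abs_nonneg _).trans hω)
      exact (abs_sub _ _).trans (add_le_add_left (abs_log_clip_le hc _) _)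
    · rw [if_neg hs, abs_zero]
      exact mul_nonneg ((abs_nonneg _).trans hω) h0

/-- Clipping adds at most `c⁻¹` to the joint density, whose conditional mean is at most one. The
shift by `log (1 + c⁻¹)` divides by exactly `1 + c⁻¹`. -/
theorem condLExp_expSum_nearOptimal_le [IsProbabilityMeasure P] [IsProbabilityMeasure Q]
    (h : PenaltyHyp ℱ P Q μ γ t) {q : Ω → ℝ} (hq : ∀ᵐ ω ∂P, 0 < q ω) {c : ℝ} (hc : 1 ≤ c) :
    condLExp (sigmaAt ℱ t.1) P (expSum t μ q (nearOptimal ℱ P Q μ γ q t c)) ≤ᵐ[P] 1 := by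
  have hc0 : 0 < c := zero_lt_one.trans_le hc
  have hci : 0 < 1 + c⁻¹ := by positivity
  set U : Ω → ℝ≥0∞ := fun ω => ∑' s : Set.Ici t,
    weight t μ s ω * jointDensity ℱ P Q μ γ t s ω with hU
  have hUm : Measurable U := h.measurable_wsum_left fun s hs => h.measurable_jointDensity hs
  have hpt : expSum t μ q (nearOptimal ℱ P Q μ γ q t c) ≤ᵐ[P]
      fun ω => ENNReal.ofReal (1 + c⁻¹)⁻¹ * (U + fun _ => ENNReal.ofReal c⁻¹ : Ω → ℝ≥0∞) ω := by
    filter_upwards [hq, ae_tsum_weight_eq_one h.optP h.pos t] with ω h1 h2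
    have h3 : ENNReal.ofReal c⁻¹ = ∑' s : Set.Ici t, weight t μ s ω * ENNReal.ofReal c⁻¹ := by
      rw [ENNReal.tsum_mul_right, h2, one_mul]
    rw [Pi.add_apply, h3, hU, ← ENNReal.tsum_add, ← ENNReal.tsum_mul_left]
    refine ENNReal.tsum_le_tsum fun s => ?_
    rw [neg_mul, mul_nearOptimal s.2 h1.ne', neg_neg, Real.exp_sub,
      Real.exp_log (toReal_clip_pos hc _), Real.exp_log hci, div_eq_mul_inv,
      ENNReal.ofReal_mul ENNReal.toReal_nonneg, ENNReal.ofReal_toReal (clip_ne_top hc _),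
      ← mul_add, mul_comm (clip _ _), mul_left_comm]
    gcongr
    exact clip_le_add _ _
  have a1 := condLExp_mul_left (ν := P) (sigmaAt_le ℱ t.1) (f := fun _ => ENNReal.ofReal (1 + c⁻¹)⁻¹)
    (@measurable_const _ _ _ (sigmaAt ℱ t.1) _)
    (g := U + fun _ => ENNReal.ofReal c⁻¹) (hUm.add measurable_const).aemeasurable
  have a2 := condLExp_add_left (mΩ := sigmaAt ℱ t.1) (P := P) (X := U)
    (fun _ => ENNReal.ofReal c⁻¹) hUm.aemeasurable
  rw [condLExp_const (sigmaAt_le ℱ _)] at a2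
  filter_upwards [condLExp_mono (mΩ := sigmaAt ℱ t.1) hpt, a1, a2,
    h.condLExp_tsum_jointDensity_le] with ω h1 h2 h3 h4
  refine h1.trans ?_
  rw [h2, h3]
  simp only [Pi.add_apply]
  calc _ ≤ ENNReal.ofReal (1 + c⁻¹)⁻¹ * (1 + ENNReal.ofReal c⁻¹) := by
        gcongr
        exact h4
    _ = 1 := by
        rw [← ENNReal.ofReal_one, ← ENNReal.ofReal_add zero_le_one (by positivity),
          ← ENNReal.ofReal_mul (by positivity), inv_mul_cancel₀ hci.ne']

/-- The part of `h.ae_le_of_acceptable` going the other way, up to a truncation. -/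
theorem ae_truncated_le [IsProbabilityMeasure P] [IsProbabilityMeasure Q]
    (h : PenaltyHyp ℱ P Q μ γ t) {q : Ω → ℝ} (hqm : Measurable[sigmaAt ℱ t.1] q)
    (hq : ∀ᵐ ω ∂Q, 0 < q ω) {c : ℝ} (hc : 1 ≤ c)
    (hX : nearOptimal ℱ P Q μ γ q t c ∈ RInf ℱ P H) :
    ∀ᵐ ω ∂Q, ENNReal.ofReal (q ω) * condLExp (sigmaAt ℱ t.1) Q
          (wsum t γ fun s ω => ENNReal.ofReal (nearOptimal ℱ P Q μ γ q t c s ω)) ω +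
        condLExp (sigmaAt ℱ t.1) Q (wsum t γ fun s ω =>
          min (posLog (jointDensity ℱ P Q μ γ t s ω)) (ENNReal.ofReal (Real.log c))) ω ≤
      ENNReal.ofReal (q ω) * condLExp (sigmaAt ℱ t.1) Q
          (wsum t γ fun s ω => ENNReal.ofReal (-nearOptimal ℱ P Q μ γ q t c s ω)) ω +
        condLExp (sigmaAt ℱ t.1) Q
          (wsum t γ fun s ω => negLog (jointDensity ℱ P Q μ γ t s ω)) ω +
        ENNReal.ofReal (Real.log (1 + c⁻¹)) := by
  have hc0 : 0 < c := zero_lt_one.trans_le hc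
  have hδ : 0 ≤ Real.log (1 + c⁻¹) := Real.log_nonneg (by linarith [inv_pos.2 hc0])
  have hX' := neg_mem_RInf hX
  have hmul (s : H.Time) (hs : t ≤ s) {Z : H.Time → Ω → ℝ} (hZ : IsAdapted ℱ Z) :
      Measurable[sigmaAt ℱ s.1] fun ω => ENNReal.ofReal (q ω * Z s ω) :=
    ((hqm.mono (sigmaAt_time_mono hs) le_rfl).mul (hZ s)).ennreal_ofReal
  set X := nearOptimal ℱ P Q μ γ q t c with hXdef
  set T := wsum t γ fun s ω =>
    min (posLog (jointDensity ℱ P Q μ γ t s ω)) (ENNReal.ofReal (Real.log c)) with hT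
  set Gn := wsum t γ fun s ω => negLog (jointDensity ℱ P Q μ γ t s ω) with hGn
  set A := wsum t γ fun s ω => ENNReal.ofReal (q ω * -X s ω) with hA
  set B := wsum t γ fun s ω => ENNReal.ofReal (q ω * X s ω) with hB
  have hAm : Measurable A := h.measurable_wsum_right fun s hs => hmul s hs hX'.1
  have hBm : Measurable B := h.measurable_wsum_right fun s hs => hmul s hs hX.1
  have hpt : B + T ≤ᵐ[Q] A + Gn + fun _ => ENNReal.ofReal (Real.log (1 + c⁻¹)) := by
    filter_upwards [h.ae_support, h.ae_tsum_weight_right_le, hq] with ω h1 h2 h3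
    have h4 : (∑' s : Set.Ici t, weight t γ s ω) * ENNReal.ofReal (Real.log (1 + c⁻¹)) ≤
        ENNReal.ofReal (Real.log (1 + c⁻¹)) := mul_le_of_le_one_left zero_le h2
    simp only [Pi.add_apply]
    refine le_trans ?_ (add_le_add_right h4 _)
    simp only [hA, hGn, hB, hT, wsum]
    rw [← ENNReal.tsum_mul_right, ← ENNReal.tsum_add, ← ENNReal.tsum_add, ← ENNReal.tsum_add]
    refine ENNReal.tsum_le_tsum fun s => ?_
    rw [mul_neg, hXdef, mul_nearOptimal s.2 h3.ne', neg_neg]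
    refine mul_min_posLog_le (fun h5 => ?_) hc hδ
    obtain ⟨h6, h7, h8⟩ := h1 s h5
    exact ⟨mul_ne_zero (ENNReal.div_ne_zero.2 ⟨h5, weight_ne_top _ _ _ _⟩) h7,
      ENNReal.mul_ne_top (ENNReal.div_ne_top (weight_ne_top _ _ _ _) h6) h8⟩
  have a1 := condLExp_add_left (mΩ := sigmaAt ℱ t.1) (P := Q) (X := A + Gn)
    (fun _ => ENNReal.ofReal (Real.log (1 + c⁻¹))) (hAm.add h.measurable_jointNeg).aemeasurable
  have a2 := condLExp_add_left (mΩ := sigmaAt ℱ t.1) (P := Q) Gn hAm.aemeasurable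
  have b1 := condLExp_add_left (mΩ := sigmaAt ℱ t.1) (P := Q) T hBm.aemeasurable
  rw [condLExp_const (sigmaAt_le ℱ _)] at a1
  filter_upwards [condLExp_mono (mΩ := sigmaAt ℱ t.1) hpt, a1, a2, b1,
    h.condLExp_wsum_smul hqm hq hX.1, h.condLExp_wsum_smul hqm hq hX'.1] with ω h1 a1 a2 b1 h4 h5
  rw [a1, b1] at h1
  simp only [Pi.add_apply] at h1 a2
  rwa [a2, h4, h5] at h1

theorem tendsto_condLExp_truncated [IsProbabilityMeasure Q] (h : PenaltyHyp ℱ P Q μ γ t)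
    {c : ℕ → ℝ≥0∞} (hc : Monotone c) (hc' : Tendsto c atTop (nhds ⊤)) :
    ∀ᵐ ω ∂Q, Tendsto (fun n => condLExp (sigmaAt ℱ t.1) Q
        (wsum t γ fun s ω => min (posLog (jointDensity ℱ P Q μ γ t s ω)) (c n)) ω) atTop
      (nhds (condLExp (sigmaAt ℱ t.1) Q
        (wsum t γ fun s ω => posLog (jointDensity ℱ P Q μ γ t s ω)) ω)) := by
  set T : ℕ → Ω → ℝ≥0∞ := fun n =>
    wsum t γ fun s ω => min (posLog (jointDensity ℱ P Q μ γ t s ω)) (c n) with hT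
  have hTm (n) : Measurable (T n) := h.measurable_wsum_right fun s hs =>
    (measurable_posLog.comp (h.measurable_jointDensity hs)).min measurable_const
  have hmono (ω) : Monotone fun n => T n ω := fun i j hij =>
    ENNReal.tsum_le_tsum fun s => mul_le_mul_right (min_le_min_left _ (hc hij)) _
  have hsup : (fun ω => ⨆ n, T n ω) =
      wsum t γ fun s ω => posLog (jointDensity ℱ P Q μ γ t s ω) := by
    ext ω
    simp only [hT, wsum]
    rw [iSup_tsum_of_monotone (f := fun n (s : Set.Ici t) =>
      weight t γ s ω * min (posLog (jointDensity ℱ P Q μ γ t s ω)) (c n))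
      fun s i j hij => mul_le_mul_right (min_le_min_left _ (hc hij)) _]
    refine tsum_congr fun s => ?_
    rw [← ENNReal.mul_iSup, iSup_min_of_tendsto_top hc']
  have hcm : ∀ᵐ ω ∂Q, ∀ n, condLExp (sigmaAt ℱ t.1) Q (T n) ω ≤
      condLExp (sigmaAt ℱ t.1) Q (T (n + 1)) ω :=
    ae_all_iff.2 fun n => condLExp_mono (ae_of_all _ fun ω => hmono ω n.le_succ)
  have hs := condLExp_iSup (ν := Q) (sigmaAt_le ℱ t.1) hTm hmono
  rw [hsup] at hs
  filter_upwards [hcm, hs] with ω h1 h2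
  rw [h2]
  exact tendsto_atTop_iSup (monotone_nat_of_le_succ h1)

/-- The penalty is the least upper bound of the functional over near-optimal processes. -/
theorem ae_le_of_forall_nearOptimal [IsProbabilityMeasure P] [IsProbabilityMeasure Q]
    (h : PenaltyHyp ℱ P Q μ γ t) {q : Ω → ℝ} (hqm : Measurable[sigmaAt ℱ t.1] q)
    (hq : ∀ᵐ ω ∂Q, 0 < q ω) (hqi : MemLInf P (sigmaAt ℱ t.1) fun ω => (q ω)⁻¹) {y : Ω → EReal}
    (hy : ∀ n : ℕ, ∀ᵐ ω ∂Q, 0 < discount γ t ω →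
      (((Q[fun ω' => -∑' s : Set.Ici t, γ s ω' / discount γ t ω' *
          nearOptimal ℱ P Q μ γ q t (n + 1) s ω' | sigmaAt ℱ t.1]) ω : ℝ) : EReal) ≤ y ω) :
    ∀ᵐ ω ∂Q, 0 < discount γ t ω → ((1 / q ω : ℝ) : EReal) *
      (((condLExp (sigmaAt ℱ t.1) Q
          (wsum t γ fun s ω => posLog (jointDensity ℱ P Q μ γ t s ω)) ω : ℝ≥0∞) : EReal) -
        ((condLExp (sigmaAt ℱ t.1) Q
          (wsum t γ fun s ω => negLog (jointDensity ℱ P Q μ γ t s ω)) ω : ℝ≥0∞) : EReal)) ≤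
      y ω := by
  -- The clipping levels `n + 1` are at least one and increase to infinity, while the shifts `log (1
  -- + 1/(n + 1))` tend to zero.
  have hc (n : ℕ) : (1 : ℝ) ≤ n + 1 := by simp
  have hX (n : ℕ) := h.nearOptimal_mem_RInf hqi (hc n)
  have hcinf : Tendsto (fun n : ℕ => (n : ℝ) + 1) atTop atTop :=
    tendsto_atTop_add_const_right _ _ tendsto_natCast_atTop_atTop
  have hlog : Tendsto (fun n : ℕ => ENNReal.ofReal (Real.log (n + 1))) atTop (nhds ⊤) :=
    ENNReal.tendsto_ofReal_nhds_top.2 (Real.tendsto_log_atTop.comp hcinf)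
  have hmono : Monotone fun n : ℕ => ENNReal.ofReal (Real.log (n + 1)) := fun i j hij =>
    ENNReal.ofReal_le_ofReal (Real.log_le_log (by positivity) (by gcongr))
  have he : Tendsto (fun n : ℕ => Real.log (1 + ((n : ℝ) + 1)⁻¹)) atTop (nhds 0) := by
    have h1 : Tendsto (fun n : ℕ => 1 + ((n : ℝ) + 1)⁻¹) atTop (nhds (1 + 0)) :=
      tendsto_const_nhds.add (tendsto_inv_atTop_zero.comp hcinf)
    rw [add_zero] at h1
    have h2 := h1.log one_ne_zero
    rwa [Real.log_one] at h2
  filter_upwards [hq, h.tendsto_condLExp_truncated hmono hlog, ae_all_iff.2 hy,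
    ae_all_iff.2 fun n => h.ae_truncated_le hqm hq (hc n) (hX n),
    ae_all_iff.2 fun n => h.ae_condExp_eq (hX n),
    ae_all_iff.2 fun n =>
      condLExp_ne_top (mΩ := sigmaAt ℱ t.1) (h.lintegral_wsum_ofReal_ne_top (hX n)),
    ae_all_iff.2 fun n =>
      condLExp_ne_top (mΩ := sigmaAt ℱ t.1) (h.lintegral_wsum_ofReal_ne_top (neg_mem_RInf (hX n))),
    condLExp_ne_top (mΩ := sigmaAt ℱ t.1) h.lintegral_jointNeg_ne_top]
    with ω h1 h2 h3 h4 h5 h6 h7 h8 hω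
  refine mul_coe_sub_le h7 h6 h8 (fun n => ?_) he h2 h1 h4 fun n => ?_
  · exact Real.log_nonneg (by simp; positivity)
  · rw [← h5 n]
    exact h3 n hω

/-- Gibbs' inequality makes the conditional entropy an upper bound over the acceptance set. The
near-optimal processes, countably many and acceptable, show that no smaller upper bound exists. -/
theorem isMinimalPenalty [IsProbabilityMeasure P] [IsProbabilityMeasure Q]
    (h : PenaltyHyp ℱ P Q μ γ t) {q : Ω → ℝ} (hq : MemLInf P (sigmaAt ℱ t.1) q)
    (hq_pos : ∀ᵐ ω ∂P, 0 < q ω) (hqi : MemLInf P (sigmaAt ℱ t.1) fun ω => (q ω)⁻¹)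
    {ρ : (H.Time → Ω → ℝ) → Ω → ℝ}
    (hρ : ∀ X ∈ RInfFrom ℱ P t, ρ X =ᵐ[P] entropicCond ℱ P μ q t X) :
    IsMinimalPenalty ℱ P t ρ Q γ (entropicPenalty ℱ P μ q t Q γ) := by
  have hqQ : ∀ᵐ ω ∂Q, 0 < q ω :=
    ae_of_ae_of_locAC' h.locAC h.ne_top (hq.1 measurableSet_Ioi) hq_pos
  have hD : MeasurableSet {ω | 0 < discount γ t ω} :=
    sigmaAt_le ℱ _ _ (measurable_discount h.mem.1.1 h.ne_top measurableSet_Ioi)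
  have hα := h.ae_entropicPenalty_eq hqQ
  have hacc (X : H.Time → Ω → ℝ) (hX : X ∈ RInfFrom ℱ P t) : ρ X ≤ᵐ[P] 0 ↔
      condLExp (sigmaAt ℱ t.1) P (expSum t μ q X) ≤ᵐ[P] 1 := by
    rw [← entropicCond_nonpos_iff h.optP h.pos hq hq_pos (RInfFrom_subset hX)]
    refine eventually_congr ?_
    filter_upwards [hρ X hX] with ω hω
    rw [hω]
  refine ⟨?_, fun X => ?_, fun y _ hy => ?_⟩
  · have hqm : Measurable fun ω => ((1 / q ω : ℝ) : EReal) :=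
      ((hq.1.mono (sigmaAt_le ℱ _) le_rfl).const_div 1).coe_real_ereal
    have hc (f : Ω → ℝ≥0∞) :
        Measurable fun ω => ((condLExp (sigmaAt ℱ t.1) Q f ω : ℝ≥0∞) : EReal) :=
      (measurable_condLExp' _ _ _).coe_ereal_ennreal
    refine AEMeasurable.congr (f := fun ω => ((1 / q ω : ℝ) : EReal) *
      (((condLExp (sigmaAt ℱ t.1) Q
          (wsum t γ fun s ω => posLog (jointDensity ℱ P Q μ γ t s ω)) ω : ℝ≥0∞) : EReal) -
        ((condLExp (sigmaAt ℱ t.1) Q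
          (wsum t γ fun s ω => negLog (jointDensity ℱ P Q μ γ t s ω)) ω : ℝ≥0∞) : EReal))) ?_ ?_
    · simp only [sub_eq_add_neg]
      exact (hqm.mul ((hc _).add (continuous_neg.measurable.comp (hc _)))).aemeasurable
    · exact (ae_restrict_iff' hD).2 (hα.mono fun ω h1 h2 => (h1 h2).symm)
  · refine (ae_restrict_iff' hD).2 ?_
    filter_upwards [hα, h.ae_le_of_acceptable hq.1 hqQ (RInfFrom_subset X.2.1)
      ((hacc X.1 X.2.1).1 X.2.2)] with ω h1 h2 hω
    rw [h1 hω]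
    exact h2 hω
  · refine (ae_restrict_iff' hD).2 ?_
    have hX (n : ℕ) : nearOptimal ℱ P Q μ γ q t (n + 1) ∈ acceptance ℱ P t ρ := by
      have hc : (1 : ℝ) ≤ n + 1 := by simp
      have h1 : nearOptimal ℱ P Q μ γ q t (n + 1) ∈ RInfFrom ℱ P t :=
        mem_RInfFrom (h.nearOptimal_mem_RInf hqi hc) fun s hs => by
          ext ω; rw [nearOptimal, if_neg (not_le.2 hs), Pi.zero_apply]
      exact ⟨h1, (hacc _ h1).2 (h.condLExp_expSum_nearOptimal_le hq_pos hc)⟩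
    filter_upwards [hα, h.ae_le_of_forall_nearOptimal hq.1 hqQ hqi fun n =>
      (ae_restrict_iff' hD).1 (hy ⟨_, hX n⟩)] with ω h1 h2 hω
    rw [h1 hω]
    exact h2 hω

end PenaltyHyp

end Optimality

end ProcessRisk
end

/-! ### The proposition -/

theorem mainTheorem12 {Ω : Type*} {mΩ : MeasurableSpace Ω} (P : Measure Ω) [IsProbabilityMeasure P]
    (ℱ : Filtration ℕ mΩ) (H : ProcessRisk.Horizon)
    (μ : H.Time → Ω → ℝ) (hμ : ProcessRisk.IsOptionalProb ℱ P μ)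
    (hμ_pos : ∀ᵐ ω ∂P, ∀ s, 0 < μ s ω)
    (t : H.Time) (ht : t.1 ≠ ⊤)
    (r : H.Time → Ω → ℝ)
    (hr : ∀ s ≤ t, ProcessRisk.MemLInf P (ProcessRisk.sigmaAt ℱ s.1) (r s))
    (hr_pos : ∀ s ≤ t, ∀ᵐ ω ∂P, 0 < r s ω)
    (hr_inv : ∀ s ≤ t, ProcessRisk.MemLInf P (ProcessRisk.sigmaAt ℱ s.1) (fun ω => (r s ω)⁻¹)) :
    (∃ ρ : (H.Time → Ω → ℝ) → Ω → ℝ,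
      ProcessRisk.IsAssociated ℱ P μ t (ProcessRisk.entropicBar ℱ P μ r t) ρ) ∧
    ∀ ρ : (H.Time → Ω → ℝ) → Ω → ℝ,
      ProcessRisk.IsAssociated ℱ P μ t (ProcessRisk.entropicBar ℱ P μ r t) ρ →
      (∀ X ∈ ProcessRisk.RInfFrom ℱ P t,
        ρ X =ᵐ[P] ProcessRisk.entropicRV ℱ P (r t) t (fun ω =>
          -ProcessRisk.entropicTime t (fun s => μ s ω) (r t ω) (fun s => X s ω))) ∧
      (∀ Q : Measure Ω, IsProbabilityMeasure Q → ProcessRisk.IsLocAC ℱ H P Q →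
        ProcessRisk.IsOptionalProb ℱ Q μ →
        ∀ γ ∈ ProcessRisk.Gam ℱ P Q H,
          ProcessRisk.IsMinimalPenalty ℱ P t ρ Q γ
            (ProcessRisk.entropicPenalty ℱ P μ (r t) t Q γ)) := by
  -- Associated maps agree `P`-a.s. with `entropicCond` on `ℛ_t^∞`, so both claims need to be
  -- checked for that map only.
  have ae_eq := fun (ρ : (H.Time → Ω → ℝ) → Ω → ℝ)
      (hρ : ProcessRisk.IsAssociated ℱ P μ t (ProcessRisk.entropicBar ℱ P μ r t) ρ)
      (X : H.Time → Ω → ℝ) (hX : X ∈ ProcessRisk.RInfFrom ℱ P t) =>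
    hρ.ae_eq_entropicCond hμ hμ_pos ht hr hr_pos hX
  refine ⟨⟨_, ProcessRisk.isAssociated_entropicCond hμ hμ_pos ht hr hr_pos
      (hr_inv t le_rfl)⟩,
    fun ρ hρ => ⟨fun X hX => ?_, fun Q hQ hloc hμQ γ hγ => ?_⟩⟩
  · exact (ae_eq ρ hρ X hX).trans (ProcessRisk.entropicCond_ae_eq_entropicRV hμ hμ_pos ht
      (hr t le_rfl) (hr_pos t le_rfl) (ProcessRisk.RInfFrom_subset hX))
  · exact ProcessRisk.PenaltyHyp.isMinimalPenalty ⟨hloc, ht, hμ, hμ_pos, hμQ, hγ⟩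
      (hr t le_rfl) (hr_pos t le_rfl) (hr_inv t le_rfl) (ae_eq ρ hρ)
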